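/- Let $\mathsf M$ be a compact, connected, smooth $n$-dimensional Riemannian manifold ($n\ge 1$) with nonempty boundary $\Sigma=\partial\mathsf M$, metric $(\cdot|\cdot)_g$, Levi-Civita connection $\nabla$ and outward unit normal field $\nu$ on $\Sigma$. For a vector field $u$ put $D_u=\tfrac12(\nabla u+[\nabla u]^{\mathsf T})$, where $\mathsf T$ denotes the adjoint with respect to $g$ (for $u\in H^1_2$, $\nabla u$ is the weak covariant derivative). Let $\mathbb P_H$ be the Helmholtz projection on $L_2(\mathsf M;T\mathsf M)$, i.e. $\mathbb P_H u=u-\mathrm{grad}\,\psi$ where $\psi\in H^1_2(\mathsf M)$ satisfies $(\mathrm{grad}\,\psi|\mathrm{grad}\,\phi)_{\mathsf M}=(u|\mathrm{grad}\,\phi)_{\mathsf M}$ for all $\phi\in H^1_2(\mathsf M)$, where $(u|v)_{\mathsf M}=\int_{\mathsf M}(u|v)_g\,d\mu_g$, and set $H^1_{2,\sigma}(\mathsf M;T\mathsf M)=H^1_2(\mathsf M;T\mathsf M)\cap \mathbb P_H L_2(\mathsf M;T\mathsf M)$. For $\alpha\ge 0$ define, with boundary values in the sense of traces, $$\mathcal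 E_\alpha=\begin{cases}\{u\in H^1_{2,\sigma}(\mathsf M;T\mathsf M): D_u=0 \text{ on }\mathsf M,\ u=0\text{ on }\Sigma\}&\text{if }\alpha>0,\\ \{u\in H^1_{2,\sigma}(\mathsf M;T\mathsf M): D_u=0 \text{ on }\mathsf M,\ (u|\nu)_g=0\text{ on }\Sigma\}&\text{if }\alpha=0.\end{cases}$$ Then, identifying fields that agree almost everywhere: (a) if $\alpha>0$, then $\mathcal E_\alpha=\{0\}$; (b) if $\alpha=0$, then $\mathcal E_0=\{u\in C^\infty(\mathsf M;T\mathsf M): D_u=0\text{ on }\mathsf M,\ (u|\nu)_g=0\text{ on }\Sigma\}$. Moreover: (c) every $u\in H^1_2(\mathsf M;T\mathsf M)$ with $D_u=0$ almost everywhere on $\mathsf M$ has a representative in $C^\infty(\mathsf M;T\mathsf M)$, and $D_u=0$ everywhere on $\mathsf M$ for this representative; (d) every $u\in C^\infty(\mathsf M;T\mathsf M)$ with $D_u=0$ on $\mathsf M$ and $u=0$ on $\Sigma$ vanishes identically. -/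

import Mathlib

open Set Filter Topology MeasureTheory
open scoped Manifold ContDiff ENNReal Matrix

noncomputable section

namespace KillingNavier

/-- The coordinate space `ℝⁿ`. -/
abbrev Coord (n : ℕ) : Type := EuclideanSpace ℝ (Fin n)

/-- The standard basis vectors of `ℝⁿ`. -/
def stdVec {n : ℕ} (i : Fin n) : Coord n := EuclideanSpace.single i 1

/-! ### Weak derivatives on open subsets of `ℝⁿ` -/

/-- `h` is the weak `j`-th partial derivative of `f` on the open set `U`. -/
def HasWeakPartial {n : ℕ} (U : Set (Coord n)) (j : Fin n) (f h : Coord n → ℝ) : Prop :=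
  LocallyIntegrableOn f U ∧ LocallyIntegrableOn h U ∧
    ∀ φ : Coord n → ℝ, ContDiff ℝ ∞ φ → HasCompactSupport φ → tsupport φ ⊆ U →
      ∫ y in U, f y * fderiv ℝ φ y (stdVec j) = - ∫ y in U, h y * φ y

/-- The classical `j`-th partial derivative on the half-space `{y | 0 ≤ y 0}`
(one-sided at its boundary). -/
def partialH {n : ℕ} [NeZero n] (j : Fin n) (f : Coord n → ℝ) (y : Coord n) : ℝ :=
  fderivWithin ℝ f (range (𝓡∂ n)) y (stdVec j)

section Manifold

variable {n : ℕ} [NeZero n] {M : Type*} [TopologicalSpace M]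
  [ChartedSpace (EuclideanHalfSpace n) M] [IsManifold (𝓡∂ n) ∞ M]

/-! ### Vector fields, tensor fields and their coordinates

The local coordinates around `x₀` are those of the preferred chart `extChartAt (𝓡∂ n) x₀`; they
take values in the half-space `{y | 0 ≤ y 0}`. -/

variable (n M) in
/-- All (not necessarily continuous) vector fields on `M`. -/
abbrev VField : Type _ := (x : M) → TangentSpace (𝓡∂ n) x

variable (n M) in
/-- All (not necessarily continuous) `(1,1)`-tensor fields on `M`. -/
abbrev TField : Type _ := (x : M) → (TangentSpace (𝓡∂ n) x →ₗ[ℝ] TangentSpace (𝓡∂ n) x)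

variable (n M) in
/-- Smooth Riemannian metrics on `M` (smooth up to the boundary). -/
abbrev Metric : Type _ :=
  Bundle.ContMDiffRiemannianMetric (𝓡∂ n) ∞ (Coord n) (fun x : M => TangentSpace (𝓡∂ n) x)

/-- Smooth vector fields (smooth up to the boundary). -/
def IsSmooth (u : VField n M) : Prop :=
  ContMDiff (𝓡∂ n) (𝓡∂ n).tangent ∞ (fun x => (⟨x, u x⟩ : TangentBundle (𝓡∂ n) M))

/-- The domain `{y} ⊆ ℝⁿ` of the local coordinates around `x₀`. -/
def dom (x₀ : M) : Set (Coord n) := (extChartAt (𝓡∂ n) x₀).target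

/-- The point of `M` with coordinates `y` in the chart around `x₀`. -/
def pt (x₀ : M) (y : Coord n) : M := (extChartAt (𝓡∂ n) x₀).symm y

/-- The coordinate vector field `∂/∂xⁱ` of the chart around `x₀`, at the point `p`. -/
def frame (x₀ : M) (i : Fin n) (p : M) : TangentSpace (𝓡∂ n) p :=
  (trivializationAt (Coord n) (TangentSpace (𝓡∂ n)) x₀).symmL ℝ p (stdVec i)

/-- The coordinate one-form `dxⁱ` of the chart around `x₀`, at the point `p`. -/
def coframe (x₀ : M) (i : Fin n) (p : M) : TangentSpace (𝓡∂ n) p →ₗ[ℝ] ℝ :=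
  ((EuclideanSpace.proj i : Coord n →L[ℝ] ℝ).comp
    ((trivializationAt (Coord n) (TangentSpace (𝓡∂ n)) x₀).continuousLinearMapAt ℝ p)).toLinearMap

/-- The components `uⁱ` of a vector field. -/
def vcomp (x₀ : M) (u : VField n M) (i : Fin n) (y : Coord n) : ℝ :=
  coframe x₀ i (pt x₀ y) (u (pt x₀ y))

/-- The components `Tⁱⱼ` of a `(1,1)`-tensor field. -/
def tcomp (x₀ : M) (T : TField n M) (i j : Fin n) (y : Coord n) : ℝ :=
  coframe x₀ i (pt x₀ y) (T (pt x₀ y) (frame x₀ j (pt x₀ y)))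

/-- The matrix `(gᵢⱼ)` of the metric; the matrix `(gⁱʲ)` is its inverse. -/
def gram (g : Metric n M) (x₀ : M) (y : Coord n) : Matrix (Fin n) (Fin n) ℝ :=
  Matrix.of fun i j => g.inner (pt x₀ y) (frame x₀ i (pt x₀ y)) (frame x₀ j (pt x₀ y))

/-- The Christoffel symbols `Γⁱⱼₖ = ½ gⁱˡ (∂ⱼ gₖₗ + ∂ₖ gⱼₗ - ∂ₗ gⱼₖ)`. -/
def christoffel (g : Metric n M) (x₀ : M) (i j k : Fin n) (y : Coord n) : ℝ :=
  (1 / 2) * ∑ l, (gram g x₀ y)⁻¹ i l *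
    (partialH j (fun z => gram g x₀ z k l) y + partialH k (fun z => gram g x₀ z j l) y
      - partialH l (fun z => gram g x₀ z j k) y)

/-! ### Pointwise algebra of `(1,1)`-tensors -/

/-- The inner product `(v|w)_g` on a tangent space, as a bilinear form. -/
def form (g : Metric n M) (x : M) : LinearMap.BilinForm ℝ (TangentSpace (𝓡∂ n) x) :=
  LinearMap.mk₂ ℝ (fun v w => g.inner x v w)
    (fun _ _ _ => by simp) (fun _ _ _ => by simp) (fun _ _ _ => by simp) (fun _ _ _ => by simp)

lemma form_nondegenerate (g : Metric n M) (x : M) : (form g x).Nondegenerate := by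
  refine ⟨fun v hv => ?_, fun v hv => ?_⟩ <;>
  · by_contra h
    exact (g.pos x v h).ne' (hv v)

instance (x : M) : FiniteDimensional ℝ (TangentSpace (𝓡∂ n) x) :=
  inferInstanceAs (FiniteDimensional ℝ (Coord n))

/-- The adjoint `Sᵀ` with respect to `g`, that is `(Sᵀ v|w)_g = (v|S w)_g`. -/
def adj (g : Metric n M) (x : M) (S : TangentSpace (𝓡∂ n) x →ₗ[ℝ] TangentSpace (𝓡∂ n) x) :
    TangentSpace (𝓡∂ n) x →ₗ[ℝ] TangentSpace (𝓡∂ n) x :=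
  (form g x).leftAdjointOfNondegenerate (form_nondegenerate g x) S

/-- The symmetric part `½ (S + Sᵀ)`. For `S = ∇u` this is the deformation tensor `D_u`. -/
def symPart (g : Metric n M) (x : M) (S : TangentSpace (𝓡∂ n) x →ₗ[ℝ] TangentSpace (𝓡∂ n) x) :
    TangentSpace (𝓡∂ n) x →ₗ[ℝ] TangentSpace (𝓡∂ n) x :=
  (1 / 2 : ℝ) • (S + adj g x S)

/-- `|v|²_g` for a tangent vector. -/
def normSqV (g : Metric n M) (x : M) (v : TangentSpace (𝓡∂ n) x) : ℝ := g.inner x v v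

/-- `|S|²_g = tr (Sᵀ S)` for a `(1,1)`-tensor. -/
def normSqT (g : Metric n M) (x : M)
    (S : TangentSpace (𝓡∂ n) x →ₗ[ℝ] TangentSpace (𝓡∂ n) x) : ℝ :=
  LinearMap.trace ℝ (TangentSpace (𝓡∂ n) x) (adj g x S ∘ₗ S)

/-! ### The classical covariant derivative -/

/-- The Levi-Civita covariant derivative `∇u = (∂ⱼ uⁱ + Γⁱⱼₖ uᵏ) ∂/∂xⁱ ⊗ dxʲ` of a
differentiable vector field, computed at `x` in the chart around `x`. -/
def covDeriv (g : Metric n M) (u : VField n M) : TField n M := fun x =>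
  ∑ i, ∑ j,
    (partialH j (vcomp x u i) (extChartAt (𝓡∂ n) x x)
      + ∑ k, christoffel g x i j k (extChartAt (𝓡∂ n) x x)
          * vcomp x u k (extChartAt (𝓡∂ n) x x)) •
      (coframe x j x).smulRight (frame x i x)

/-- The deformation tensor `D_u = ½ (∇u + [∇u]ᵀ)` of a differentiable vector field. -/
def deformation (g : Metric n M) (u : VField n M) : TField n M :=
  fun x => symPart g x (covDeriv g u x)

/-- The outward unit normal `ν = - (g⁰⁰)^(-1/2) g⁰ʲ ∂/∂xʲ` of the boundary, computed at `p` in the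
chart around `p`; the manifold lies on the side `x⁰ ≥ 0`. Only used at boundary points. -/
def normal (g : Metric n M) (p : M) : TangentSpace (𝓡∂ n) p :=
  -((√((gram g p (extChartAt (𝓡∂ n) p p))⁻¹ 0 0))⁻¹ •
    ∑ j, (gram g p (extChartAt (𝓡∂ n) p p))⁻¹ 0 j • frame p j p)

/-! ### Riemannian measures

On each chart the volume measure is the image of `√(det gᵢⱼ) dy`. These measures agree on
overlaps, and the measure on `M` is their supremum. -/

variable [MeasurableSpace M]

/-- The Riemannian volume of the chart domain around `x₀`. -/
def chartVol (g : Metric n M) (x₀ : M) : Measure M :=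
  Measure.map (pt x₀) ((volume.restrict (dom x₀)).withDensity
    fun y => ENNReal.ofReal √(gram g x₀ y).det)

/-- The Riemannian volume measure `μ_g` of `M`. -/
def vol (g : Metric n M) : Measure M := ⨆ x₀ : M, chartVol g x₀

variable (n) in
/-- The coordinate space of the boundary. -/
abbrev BCoord : Type := EuclideanSpace ℝ {i : Fin n // i ≠ 0}

/-- The inclusion of `ℝⁿ⁻¹` as the hyperplane `{y | y 0 = 0}`. -/
def bincl (z : BCoord n) : Coord n :=
  WithLp.toLp 2 fun i => if h : i ≠ 0 then z ⟨i, h⟩ else 0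

/-- The domain in `ℝⁿ⁻¹` of the induced boundary chart. -/
def bdom (x₀ : M) : Set (BCoord n) := bincl ⁻¹' dom x₀

/-- The Riemannian surface measure of the boundary points in the chart domain around `x₀`. -/
def chartSurf (g : Metric n M) (x₀ : M) : Measure M :=
  Measure.map (fun z => pt x₀ (bincl z)) ((volume.restrict (bdom x₀)).withDensity
    fun z => ENNReal.ofReal
      √((gram g x₀ (bincl z)).submatrix (Subtype.val : {i : Fin n // i ≠ 0} → Fin n)
        Subtype.val).det)

/-- The Riemannian surface measure `σ_g` of the boundary, as a measure on `M`. -/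
def surf (g : Metric n M) : Measure M := ⨆ x₀ : M, chartSurf g x₀

/-! ### Function spaces

Elements of these spaces are represented by fields that are only determined almost everywhere. -/

/-- `u ∈ L₂(M;TM)`. -/
def MemL2 (g : Metric n M) (u : VField n M) : Prop :=
  (∀ (x₀ : M) (i : Fin n), AEStronglyMeasurable (vcomp x₀ u i) (volume.restrict (dom x₀))) ∧
    ∫⁻ x, ENNReal.ofReal (normSqV g x (u x)) ∂(vol g) < ⊤

/-- `T ∈ L₂(M;T¹₁M)`. -/
def MemL2T (g : Metric n M) (T : TField n M) : Prop :=
  (∀ (x₀ : M) (i j : Fin n), AEStronglyMeasurable (tcomp x₀ T i j) (volume.restrict (dom x₀))) ∧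
    ∫⁻ x, ENNReal.ofReal (normSqT g x (T x)) ∂(vol g) < ⊤

/-- `T ∈ L₂(M;T¹₁M)` is the weak covariant derivative `∇u` of `u`: in every chart
`Tⁱⱼ = ∂ⱼ uⁱ + Γⁱⱼₖ uᵏ` with weak partial derivatives `∂ⱼ uⁱ`. -/
def IsWeakCovDeriv (g : Metric n M) (u : VField n M) (T : TField n M) : Prop :=
  MemL2T g T ∧ ∀ (x₀ : M) (i j : Fin n),
    HasWeakPartial (interior (dom x₀)) j (vcomp x₀ u i)
      (fun y => tcomp x₀ T i j y - ∑ k, christoffel g x₀ i j k y * vcomp x₀ u k y)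

/-- `u ∈ H¹₂(M;TM)`. -/
def MemH1 (g : Metric n M) (u : VField n M) : Prop :=
  MemL2 g u ∧ ∃ T, IsWeakCovDeriv g u T

/-- `D_u = 0` on `M` for `u ∈ H¹₂(M;TM)`, with the weak covariant derivative. -/
def WeakDeformationZero (g : Metric n M) (u : VField n M) : Prop :=
  ∃ T, IsWeakCovDeriv g u T ∧ ∀ᵐ x ∂(vol g), symPart g x (T x) = 0

/-- `φ ∈ H¹₂(M)` with weak gradient `grad φ = G`: in every chart `(G|∂/∂xʲ)_g = ∂ⱼ φ`. -/
def HasGradient (g : Metric n M) (φ : M → ℝ) (G : VField n M) : Prop :=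
  MemLp φ 2 (vol g) ∧ MemL2 g G ∧ ∀ (x₀ : M) (j : Fin n),
    HasWeakPartial (interior (dom x₀)) j (fun y => φ (pt x₀ y))
      (fun y => g.inner (pt x₀ y) (G (pt x₀ y)) (frame x₀ j (pt x₀ y)))

/-- The pairing `(u|v)_M = ∫_M (u|v)_g dμ_g`. -/
def pairing (g : Metric n M) (u v : VField n M) : ℝ := ∫ x, g.inner x (u x) (v x) ∂(vol g)

/-- `w = ℙ_H u` for `u ∈ L₂(M;TM)`, where `ℙ_H u = u - grad ψ` is the Helmholtz projection:
`(grad ψ|grad φ)_M = (u|grad φ)_M` for all `φ ∈ H¹₂(M)`. -/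
def IsHelmholtzProjection (g : Metric n M) (u w : VField n M) : Prop :=
  ∃ (ψ : M → ℝ) (G : VField n M), HasGradient g ψ G ∧
    (∀ (φ : M → ℝ) (F : VField n M), HasGradient g φ F → pairing g G F = pairing g u F) ∧
    ∀ᵐ x ∂(vol g), w x = u x - G x

/-- `w ∈ L_{2,σ}(M;TM) = ℙ_H L₂(M;TM)`. -/
def MemL2sigma (g : Metric n M) (w : VField n M) : Prop :=
  ∃ u, MemL2 g u ∧ IsHelmholtzProjection g u w

/-- `u ∈ H¹_{2,σ}(M;TM) = H¹₂(M;TM) ∩ L_{2,σ}(M;TM)`. -/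
def MemH1sigma (g : Metric n M) (u : VField n M) : Prop := MemH1 g u ∧ MemL2sigma g u

/-- `w ∈ L₂(Σ;TM)` is the trace on `Σ = ∂M` of `u ∈ H¹₂(M;TM)`. The trace operator is the
continuous extension of `u ↦ u|_Σ` from smooth fields: there are smooth fields `uₖ` with `uₖ → u`
in `H¹₂(M;TM)` and `uₖ|_Σ → w` in `L₂(Σ;TM)`. -/
def HasTrace (g : Metric n M) (u w : VField n M) : Prop :=
  (∀ (x₀ : M) (i : Fin n),
    AEStronglyMeasurable (fun z => vcomp x₀ w i (bincl z)) (volume.restrict (bdom x₀))) ∧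
  ∃ (T : TField n M) (s : ℕ → VField n M), IsWeakCovDeriv g u T ∧ (∀ k, IsSmooth (s k)) ∧
    Tendsto (fun k => ∫⁻ x, ENNReal.ofReal (normSqV g x (s k x - u x)) ∂(vol g)) atTop (𝓝 0) ∧
    Tendsto (fun k => ∫⁻ x, ENNReal.ofReal (normSqT g x (covDeriv g (s k) x - T x)) ∂(vol g))
      atTop (𝓝 0) ∧
    Tendsto (fun k => ∫⁻ x, ENNReal.ofReal (normSqV g x (s k x - w x)) ∂(surf g)) atTop (𝓝 0)

/-- The space `𝓔_α`, for `α ≥ 0`: the fields `u ∈ H¹_{2,σ}(M;TM)` with `D_u = 0` on `M` and, in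
the sense of traces, `u = 0` on `Σ` if `α > 0`, and `(u|ν)_g = 0` on `Σ` if `α = 0`. -/
def Equil (g : Metric n M) (α : ℝ) : Set (VField n M) :=
  {u | MemH1sigma g u ∧ WeakDeformationZero g u ∧
    (0 < α → ∃ w, HasTrace g u w ∧ ∀ᵐ x ∂(surf g), w x = 0) ∧
    (α = 0 → ∃ w, HasTrace g u w ∧ ∀ᵐ x ∂(surf g), g.inner x (w x) (normal g x) = 0)}

end Manifold

end KillingNavier

end

noncomputable section

namespace KillingNavier

/-! ### Calculus of weak partial derivatives on open sets -/

section WeakDerivatives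

variable {n : ℕ} {U : Set (Coord n)} {j : Fin n} {f f' h h' a : Coord n → ℝ}

/-! The Killing equation is an overdetermined system of finite type. For the covariant components
`w_i = g_il u^l` in a chart, `D_u = 0` reads `∂_j w_i + ∂_i w_j = ∑ C_ijm w_m` with smooth `C`. All
second derivatives are recovered from the symmetrized gradient: `2 ∂_k ∂_j w_i = ∂_k (∂_j w_i + ∂_i
w_j) + ∂_j (∂_k w_i + ∂_i w_k) - ∂_i (∂_k w_j + ∂_j w_k)`. Hence `(w, ∂w)` solves a closed linear
first order system with smooth coefficients (`weakSystem_of_symmetrized`, `weakSystem_killing`),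
already in the weak sense.

Regularity, assertion (c): for such a system, the combinations of the unknowns with test function
coefficients form a class closed under weak differentiation. Their Fourier transforms therefore
decay rapidly, which gives interior smoothness. Grönwall's inequality on convex half-balls then
bounds the solution and its derivative up to the boundary, and a bootstrap extends it smoothly
(`exists_smooth_of_weakSystem_upTo_boundary`). The chartwise representatives agree on overlaps and
define a global smooth field (`exists_smooth_of_weakDeformationZero`).

Uniqueness, assertion (d): by Grönwall again, a Killing field whose 1-jet vanishes at one point
vanishes nearby, and connectedness spreads this over the manifold. At a boundary point the condition
`u = 0` kills the tangential derivatives, and the Killing equation, which is skew-symmetry of the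
derivative where `u = 0`, kills the normal one (`jet_eq_zero_of_boundary`,
`eq_zero_of_killing_of_boundary`).

Members of `Equil`: the trace inequality shows that the trace of a field with a smooth
representative is the restriction of that representative (`HasTrace.ae_eq`), so the boundary
conditions hold pointwise. This yields (a) and one inclusion of (b). For the other inclusion, a
tangential Killing field must be its own Helmholtz projection: it is divergence free, and a Gauss
theorem for weak derivatives makes it orthogonal to every weak gradient
(`HasWeakPartial.integral_eq_zero`, `pairing_eq_zero`).

Since `covDeriv` uses a different chart at each point while the weak notions run over all charts,
Koszul's formula is used to prove that the covariant derivative does not depend on the chart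
(`koszul_transform`, `covDeriv_eq_tensorOf`). -/

lemma integrable_mul_of_tsupport_subset {f ψ : Coord n → ℝ} (hf : LocallyIntegrableOn f U)
    (hψ : ContinuousOn ψ U) (hc : HasCompactSupport ψ) (hs : tsupport ψ ⊆ U) :
    Integrable (fun y => f y * ψ y) := by
  have h1 : IntegrableOn f (tsupport ψ) := hf.integrableOn_compact_subset hs hc
  have h2 : IntegrableOn (fun y => f y * ψ y) (tsupport ψ) :=
    h1.mul_continuousOn (hψ.mono hs) hc
  refine (integrableOn_iff_integrable_of_support_subset ?_).1 h2
  intro y hy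
  refine subset_tsupport ψ ?_
  intro h
  exact hy (by simp [h])

lemma contDiff_mul_of_tsupport_subset {a φ : Coord n → ℝ} (hU : IsOpen U)
    (ha : ContDiffOn ℝ ∞ a U) (hφ : ContDiff ℝ ∞ φ) (hs : tsupport φ ⊆ U) :
    ContDiff ℝ ∞ (fun y => a y * φ y) := by
  rw [contDiff_iff_contDiffAt]
  intro y
  by_cases hy : y ∈ U
  · exact (ha.contDiffAt (hU.mem_nhds hy)).mul hφ.contDiffAt
  · have : (fun y => a y * φ y) =ᶠ[𝓝 y] fun _ => 0 := by
      filter_upwards [(isClosed_tsupport φ).isOpen_compl.mem_nhds fun h => hy (hs h)] with z hz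
      rw [image_eq_zero_of_notMem_tsupport hz, mul_zero]
    exact contDiffAt_const.congr_of_eventuallyEq this

lemma tsupport_mul_subset_right' {a φ : Coord n → ℝ} :
    tsupport (fun y => a y * φ y) ⊆ tsupport φ := tsupport_mul_subset_right

lemma tsupport_fderiv_apply_subset {φ : Coord n → ℝ} (v : Coord n) :
    tsupport (fun y => fderiv ℝ φ y v) ⊆ tsupport φ := by
  refine (closure_mono ?_).trans (tsupport_fderiv_subset ℝ (f := φ))
  intro y hy h
  exact hy (by simp [h])

lemma contDiff_fderiv_apply {φ : Coord n → ℝ} (hφ : ContDiff ℝ ∞ φ) (v : Coord n) :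
    ContDiff ℝ ∞ (fun y => fderiv ℝ φ y v) :=
  (hφ.fderiv_right (by simp)).clm_apply contDiff_const

namespace HasWeakPartial

lemma congr_ae (hw : HasWeakPartial U j f h)
    (hf : f =ᵐ[volume.restrict U] f')
    (hh : h =ᵐ[volume.restrict U] h') : HasWeakPartial U j f' h' := by
  obtain ⟨h1, h2, h3⟩ := hw
  have key : ∀ {p q : Coord n → ℝ}, LocallyIntegrableOn p U → p =ᵐ[volume.restrict U] q →
      LocallyIntegrableOn q U := by
    intro p q hp hpq x hx
    obtain ⟨t, ht, hi⟩ := hp x hx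
    refine ⟨t ∩ U, inter_mem ht self_mem_nhdsWithin, ?_⟩
    exact (hi.mono_set inter_subset_left).congr
      (ae_mono (Measure.restrict_mono inter_subset_right le_rfl) hpq)
  refine ⟨key h1 hf, key h2 hh, fun φ hφ hc hs => ?_⟩
  have e1 : ∫ y in U, f' y * fderiv ℝ φ y (stdVec j) = ∫ y in U, f y * fderiv ℝ φ y (stdVec j) :=
    integral_congr_ae (by filter_upwards [hf] with y hy; rw [hy])
  have e2 : ∫ y in U, h' y * φ y = ∫ y in U, h y * φ y :=
    integral_congr_ae (by filter_upwards [hh] with y hy; rw [hy])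
  rw [e1, e2, h3 φ hφ hc hs]

lemma add (hw : HasWeakPartial U j f h) (hw' : HasWeakPartial U j f' h') :
    HasWeakPartial U j (fun y => f y + f' y) (fun y => h y + h' y) := by
  refine ⟨hw.1.add hw'.1, hw.2.1.add hw'.2.1, fun φ hφ hc hs => ?_⟩
  have hd := (contDiff_fderiv_apply hφ (stdVec j)).continuous.continuousOn (s := U)
  have hdc : HasCompactSupport fun y => fderiv ℝ φ y (stdVec j) :=
    hc.of_isClosed_subset (isClosed_tsupport _) (tsupport_fderiv_apply_subset _)
  have hds := (tsupport_fderiv_apply_subset (φ := φ) (stdVec j)).trans hs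
  simp_rw [add_mul]
  rw [integral_add (integrable_mul_of_tsupport_subset hw.1 hd hdc hds).integrableOn
      (integrable_mul_of_tsupport_subset hw'.1 hd hdc hds).integrableOn,
    integral_add (integrable_mul_of_tsupport_subset hw.2.1 hφ.continuous.continuousOn hc hs).integrableOn
      (integrable_mul_of_tsupport_subset hw'.2.1 hφ.continuous.continuousOn hc hs).integrableOn,
    hw.2.2 φ hφ hc hs, hw'.2.2 φ hφ hc hs]
  ring

lemma zero : HasWeakPartial U j (fun _ => 0) (fun _ => 0) :=
  ⟨locallyIntegrableOn_zero, locallyIntegrableOn_zero, fun φ _ _ _ => by simp⟩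

lemma sum {ι : Type*} (s : Finset ι) {f h : ι → Coord n → ℝ}
    (hw : ∀ i ∈ s, HasWeakPartial U j (f i) (h i)) :
    HasWeakPartial U j (fun y => ∑ i ∈ s, f i y) (fun y => ∑ i ∈ s, h i y) := by
  classical
  induction s using Finset.induction_on with
  | empty => simpa using zero
  | insert i s hi ih =>
    simp_rw [Finset.sum_insert hi]
    exact (hw i (by simp)).add (ih fun k hk => hw k (by simp [hk]))

/-- The product `a φ` is again a test function, although `a` is smooth only on `U`, because the
support of `φ` lies in `U`. Testing with it and expanding the derivative gives the product rule. -/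
lemma smooth_mul (hU : IsOpen U) (ha : ContDiffOn ℝ ∞ a U) (hw : HasWeakPartial U j f h) :
    HasWeakPartial U j (fun y => a y * f y)
      (fun y => fderiv ℝ a y (stdVec j) * f y + a y * h y) := by
  have hda : ContDiffOn ℝ ∞ (fun y => fderiv ℝ a y (stdVec j)) U :=
    (ha.fderiv_of_isOpen hU (by simp)).clm_apply contDiffOn_const
  have hL : ∀ {b p : Coord n → ℝ}, ContinuousOn b U → LocallyIntegrableOn p U →
      LocallyIntegrableOn (fun y => b y * p y) U := fun hb hp =>
    hp.continuousOn_mul hb hU.isLocallyClosed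
  refine ⟨hL ha.continuousOn hw.1, (hL hda.continuousOn hw.1).add (hL ha.continuousOn hw.2.1),
    fun φ hφ hc hs => ?_⟩
  have h1 := contDiff_mul_of_tsupport_subset hU ha hφ hs
  have h1s : tsupport (fun y => a y * φ y) ⊆ U := tsupport_mul_subset_right'.trans hs
  have h1c : HasCompactSupport (fun y => a y * φ y) :=
    hc.of_isClosed_subset (isClosed_tsupport _) tsupport_mul_subset_right'
  have h2 := hw.2.2 _ h1 h1c h1s
  have hd : ∀ y, fderiv ℝ (fun y => a y * φ y) y (stdVec j) =
      fderiv ℝ a y (stdVec j) * φ y + a y * fderiv ℝ φ y (stdVec j) := by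
    intro y
    by_cases hy : y ∈ U
    · rw [fderiv_fun_mul ((ha.contDiffAt (hU.mem_nhds hy)).differentiableAt (by simp))
        (hφ.differentiable (by simp) y)]
      simp
      ring
    · rw [image_eq_zero_of_notMem_tsupport (f := fun z => fderiv ℝ φ z (stdVec j))
          fun h => hy (hs (tsupport_fderiv_apply_subset _ h)),
        image_eq_zero_of_notMem_tsupport fun h => hy (hs h),
        image_eq_zero_of_notMem_tsupport (f := fun z => fderiv ℝ (fun y => a y * φ y) z (stdVec j))
          fun h => hy (h1s (tsupport_fderiv_apply_subset _ h))]
      simp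
  have hφU := hφ.continuous.continuousOn (s := U)
  have hdc : HasCompactSupport fun y => fderiv ℝ φ y (stdVec j) :=
    hc.of_isClosed_subset (isClosed_tsupport _) (tsupport_fderiv_apply_subset _)
  have hds := (tsupport_fderiv_apply_subset (φ := φ) (stdVec j)).trans hs
  have hdφ := (contDiff_fderiv_apply hφ (stdVec j)).continuous.continuousOn (s := U)
  have i1 := (integrable_mul_of_tsupport_subset (hL hda.continuousOn hw.1) hφU hc hs).integrableOn (s := U)
  have i2 := (integrable_mul_of_tsupport_subset (hL ha.continuousOn hw.1) hdφ hdc hds).integrableOn (s := U)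
  have i3 := (integrable_mul_of_tsupport_subset (hL ha.continuousOn hw.2.1) hφU hc hs).integrableOn (s := U)
  simp_rw [hd] at h2
  have e1 : ∀ y, f y * (fderiv ℝ a y (stdVec j) * φ y + a y * fderiv ℝ φ y (stdVec j)) =
      fderiv ℝ a y (stdVec j) * f y * φ y + a y * f y * fderiv ℝ φ y (stdVec j) := by
    intro y; ring
  have e2 : ∀ y, h y * (a y * φ y) = a y * h y * φ y := by intro y; ring
  simp_rw [e1, e2] at h2
  rw [integral_add i1 i2] at h2
  simp_rw [add_mul]
  rw [integral_add i1 i3]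
  linarith

/-- The product rule applied to the constant `1`, whose weak derivative vanishes since derivatives
of test functions integrate to zero. -/
lemma of_contDiffOn (hU : IsOpen U) (hf : ContDiffOn ℝ ∞ f U) :
    HasWeakPartial U j f (fun y => fderiv ℝ f y (stdVec j)) := by
  have h1 : HasWeakPartial U j (fun _ => 1) (fun _ => 0) := by
    refine ⟨locallyIntegrable_const 1 |>.locallyIntegrableOn _, locallyIntegrableOn_zero,
      fun φ hφ hc hs => ?_⟩
    rw [setIntegral_eq_integral_of_forall_compl_eq_zero]
    · have := integral_mul_fderiv_eq_neg_fderiv_mul_of_integrable (μ := volume) (v := stdVec j)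
        (f := fun _ : Coord n => (1 : ℝ)) (g := φ) (by simp) ?_ ?_ (by simp) ?_
      · rw [this]; simp
      · simpa using (contDiff_fderiv_apply hφ (stdVec j)).continuous.integrable_of_hasCompactSupport
          (hc.of_isClosed_subset (isClosed_tsupport _) (tsupport_fderiv_apply_subset _))
      · simpa using hφ.continuous.integrable_of_hasCompactSupport hc
      · exact fun x _ => hφ.differentiable (by simp) x
    · intro y hy
      rw [image_eq_zero_of_notMem_tsupport (f := fun z => fderiv ℝ φ z (stdVec j))
          fun h => hy (hs (tsupport_fderiv_apply_subset _ h)), mul_zero]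
  simpa using h1.smooth_mul hU hf

/-- The fundamental lemma of the calculus of variations, applied to the difference of the two
derivatives. -/
lemma unique (hU : IsOpen U) (hw : HasWeakPartial U j f h) (hw' : HasWeakPartial U j f h') :
    h =ᵐ[volume.restrict U] h' := by
  have : ∀ᵐ y, y ∈ U → h y - h' y = 0 := by
    refine hU.ae_eq_zero_of_integral_contDiff_smul_eq_zero (hw.2.1.sub hw'.2.1) ?_
    intro g hg hc hs
    have e1 := hw.2.2 g hg hc hs
    have e2 := hw'.2.2 g hg hc hs
    have i1 := (integrable_mul_of_tsupport_subset hw.2.1 hg.continuous.continuousOn hc hs)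
    have i2 := (integrable_mul_of_tsupport_subset hw'.2.1 hg.continuous.continuousOn hc hs)
    have e3 : ∀ y, g y • (h y - h' y) = h y * g y - h' y * g y := by
      intro y; simp; ring
    simp_rw [e3]
    rw [integral_sub i1 i2, sub_eq_zero,
      ← setIntegral_eq_integral_of_forall_compl_eq_zero (s := U),
      ← setIntegral_eq_integral_of_forall_compl_eq_zero (s := U) (f := fun y => h' y * g y)]
    · linarith
    all_goals
      intro y hy
      rw [image_eq_zero_of_notMem_tsupport fun h => hy (hs h), mul_zero]
  rw [Filter.EventuallyEq, ae_restrict_iff' hU.measurableSet]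
  filter_upwards [this] with y hy hyU using sub_eq_zero.1 (hy hyU)

end HasWeakPartial

end WeakDerivatives

/-! ### Interior regularity by Fourier transform -/

section InteriorRegularity

open scoped FourierTransform SchwartzMap

variable {n : ℕ} {U : Set (Coord n)}

lemma exists_smooth_cutoff {K : Set (Coord n)} (hK : IsCompact K) (hU : IsOpen U) (hKU : K ⊆ U) :
    ∃ χ : Coord n → ℝ, ContDiff ℝ ∞ χ ∧ HasCompactSupport χ ∧ tsupport χ ⊆ U ∧
      (∀ᶠ y in 𝓝ˢ K, χ y = 1) ∧ ∀ y, χ y ∈ Icc (0 : ℝ) 1 := by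
  obtain ⟨K', hK', hKK', hK'U⟩ := exists_compact_between hK hU hKU
  obtain ⟨K'', hK'', hKK'', hK''U⟩ := exists_compact_between hK' hU hK'U
  obtain ⟨χ, h1, h2, h3, h4⟩ := exists_contMDiff_support_eq_eq_one_iff (n := ⊤) 𝓘(ℝ, Coord n)
    (isOpen_interior (s := K'')) (hK'.isClosed) hKK''
  have hts : tsupport χ ⊆ K'' := by
    rw [tsupport, h3]
    exact closure_minimal interior_subset hK''.isClosed
  refine ⟨χ, h1.contDiff, hK''.of_isClosed_subset (isClosed_tsupport _) hts, hts.trans hK''U, ?_,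
    fun y => h2 (mem_range_self y)⟩
  filter_upwards [isOpen_interior.mem_nhdsSet.2 hKK'] with y hy
  exact (h4 y).1 (interior_subset hy)

/-- Multiplying `ψ` by a cutoff that is `1` near both supports changes neither side. This admits
test functions without compact support, in particular the trigonometric ones of the Fourier
transform. -/
lemma integral_weakPartial_of_hasCompactSupport {j : Fin n} {f h ψ : Coord n → ℝ}
    (hw : HasWeakPartial univ j f h) (hf : HasCompactSupport f) (hh : HasCompactSupport h)
    (hψ : ContDiff ℝ ∞ ψ) :
    ∫ y, f y * fderiv ℝ ψ y (stdVec j) = -∫ y, h y * ψ y := by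
  obtain ⟨χ, h1, h2, h3, h4, -⟩ := exists_smooth_cutoff (hf.union hh) isOpen_univ (subset_univ _)
  have h5 := hw.2.2 (fun y => χ y * ψ y) (h1.mul hψ)
    (h2.mul_right) (subset_univ _)
  simp only [Measure.restrict_univ] at h5
  convert h5 using 1
  · refine integral_congr_ae (Eventually.of_forall fun y => ?_)
    by_cases hy : y ∈ tsupport f
    · have : (fun z => χ z * ψ z) =ᶠ[𝓝 y] ψ := by
        filter_upwards [(eventually_nhdsSet_iff_forall.1 h4) y (Or.inl hy)] with z hz
        rw [hz, one_mul]
      simp only [this.fderiv_eq]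
    · simp [image_eq_zero_of_notMem_tsupport hy]
  · congr 1
    refine integral_congr_ae (Eventually.of_forall fun y => ?_)
    by_cases hy : y ∈ tsupport h
    · have := ((eventually_nhdsSet_iff_forall.1 h4) y (Or.inr hy)).self_of_nhds
      simp [this]
    · simp [image_eq_zero_of_notMem_tsupport hy]

/-- Weak derivatives are tested against real functions, so the exponential is split into cosine and
sine. -/
lemma fourier_ofReal_eq {f : Coord n → ℝ} (hf : Integrable f) (ξ : Coord n) :
    𝓕 (fun y => (f y : ℂ)) ξ =
      ((∫ y, f y * Real.cos (2 * Real.pi * inner ℝ y ξ) : ℝ) : ℂ) -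
        (∫ y, f y * Real.sin (2 * Real.pi * inner ℝ y ξ) : ℝ) * Complex.I := by
  have i1 : Integrable (fun y => f y * Real.cos (2 * Real.pi * inner ℝ y ξ)) :=
    hf.mul_bdd (c := 1) (by fun_prop) (Eventually.of_forall fun y => Real.abs_cos_le_one _)
  have i2 : Integrable (fun y => f y * Real.sin (2 * Real.pi * inner ℝ y ξ)) :=
    hf.mul_bdd (c := 1) (by fun_prop) (Eventually.of_forall fun y => Real.abs_sin_le_one _)
  rw [Real.fourier_eq', ← integral_complex_ofReal, ← integral_complex_ofReal,
    ← integral_mul_const, ← integral_sub i1.ofReal (i2.ofReal.mul_const _)]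
  refine integral_congr_ae (Eventually.of_forall fun y => ?_)
  have : ((-2 * Real.pi * inner ℝ y ξ : ℝ) : ℂ) = -((2 * Real.pi * inner ℝ y ξ : ℝ) : ℂ) := by
    push_cast; ring
  simp only [smul_eq_mul]
  rw [this, Complex.exp_mul_I, Complex.cos_neg, Complex.sin_neg]
  push_cast
  ring

lemma fourier_weakPartial {j : Fin n} {f h : Coord n → ℝ} (hw : HasWeakPartial univ j f h)
    (hf : HasCompactSupport f) (hh : HasCompactSupport h) (hfi : Integrable f)
    (hhi : Integrable h) (ξ : Coord n) :
    𝓕 (fun y => (h y : ℂ)) ξ = (2 * Real.pi * ξ j : ℝ) * Complex.I * 𝓕 (fun y => (f y : ℂ)) ξ := by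
  have hd : ∀ y : Coord n, HasFDerivAt (fun y : Coord n => 2 * Real.pi * inner ℝ y ξ)
      ((2 * Real.pi) • (innerSL ℝ ξ)) y := by
    intro y
    have := ((innerSL ℝ ξ).hasFDerivAt (x := y)).const_mul (2 * Real.pi)
    refine this.congr_of_eventuallyEq (Eventually.of_forall fun z => ?_)
    simp [real_inner_comm]
  have hj : inner ℝ ξ (stdVec j) = ξ j := by
    simp [stdVec, EuclideanSpace.inner_single_right]
  have e1 := integral_weakPartial_of_hasCompactSupport hw hf hh
    (ψ := fun y => Real.cos (2 * Real.pi * inner ℝ y ξ))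
    (Real.contDiff_cos.comp (contDiff_const.mul (contDiff_id.inner ℝ contDiff_const)))
  have e2 := integral_weakPartial_of_hasCompactSupport hw hf hh
    (ψ := fun y => Real.sin (2 * Real.pi * inner ℝ y ξ))
    (Real.contDiff_sin.comp (contDiff_const.mul (contDiff_id.inner ℝ contDiff_const)))
  have d1 : ∀ y, f y * fderiv ℝ (fun y => Real.cos (2 * Real.pi * inner ℝ y ξ)) y (stdVec j) =
      -(2 * Real.pi * ξ j) * (f y * Real.sin (2 * Real.pi * inner ℝ y ξ)) := by
    intro y
    rw [(hd y).cos.fderiv]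
    simp [hj]; ring
  have d2 : ∀ y, f y * fderiv ℝ (fun y => Real.sin (2 * Real.pi * inner ℝ y ξ)) y (stdVec j) =
      (2 * Real.pi * ξ j) * (f y * Real.cos (2 * Real.pi * inner ℝ y ξ)) := by
    intro y
    rw [(hd y).sin.fderiv]
    simp [hj]; ring
  simp_rw [d1] at e1
  simp_rw [d2] at e2
  rw [integral_const_mul] at e1 e2
  rw [fourier_ofReal_eq hfi, fourier_ofReal_eq hhi, ← neg_eq_iff_eq_neg.2 e1,
    ← neg_eq_iff_eq_neg.2 e2]
  push_cast
  linear_combination (2 * Real.pi * ξ j : ℂ) * (∫ y, f y * Real.sin (2 * Real.pi * inner ℝ y ξ) : ℝ) * (Complex.I_mul_I)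

lemma norm_fourier_le {f : Coord n → ℝ} (ξ : Coord n) :
    ‖𝓕 (fun y => (f y : ℂ)) ξ‖ ≤ ∫ y, ‖f y‖ := by
  refine (VectorFourier.norm_fourierIntegral_le_integral_norm _ _ _ _ _).trans_eq ?_
  simp

lemma norm_le_sum_abs (ξ : Coord n) : ‖ξ‖ ≤ ∑ j, |ξ j| := by
  have : ξ = ∑ j, ξ j • EuclideanSpace.single j (1 : ℝ) := by
    ext i; simp [Finset.sum_apply, Pi.single_apply]
  calc ‖ξ‖ = ‖∑ j, ξ j • EuclideanSpace.single j (1 : ℝ)‖ := by rw [← this]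
    _ ≤ ∑ j, ‖ξ j • EuclideanSpace.single j (1 : ℝ)‖ := norm_sum_le _ _
    _ = _ := by simp [norm_smul]

/-- A class of integrable functions of compact support that is closed under weak partial
derivatives has rapidly decreasing Fourier transforms. -/
lemma fourier_rapid_decay {𝒲 : Set (Coord n → ℝ)}
    (h1 : ∀ f ∈ 𝒲, Integrable f ∧ HasCompactSupport f)
    (h2 : ∀ f ∈ 𝒲, ∀ j, ∃ h ∈ 𝒲, HasWeakPartial univ j f h) (m : ℕ) :
    ∀ f ∈ 𝒲, ∃ C, ∀ ξ, (1 + ‖ξ‖) ^ m * ‖𝓕 (fun y => (f y : ℂ)) ξ‖ ≤ C := by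
  induction m with
  | zero => exact fun f _ => ⟨_, fun ξ => by simpa using norm_fourier_le ξ⟩
  | succ m ih =>
    intro f hf
    choose h hh hw using h2 f hf
    obtain ⟨C, hC⟩ := ih f hf
    choose D hD using fun j => ih (h j) (hh j)
    refine ⟨C + ∑ j, D j, fun ξ => ?_⟩
    have hp : (0 : ℝ) ≤ (1 + ‖ξ‖) ^ m := by positivity
    -- The transform of the `j`-th weak derivative carries the factor `2π ξ_j`, so each derivative
    -- available in the class gains one power of decay.
    have key : ∀ j, |ξ j| * ‖𝓕 (fun y => (f y : ℂ)) ξ‖ ≤ ‖𝓕 (fun y => (h j y : ℂ)) ξ‖ := by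
      intro j
      rw [fourier_weakPartial (hw j) (h1 f hf).2 (h1 _ (hh j)).2 (h1 f hf).1 (h1 _ (hh j)).1,
        norm_mul, norm_mul, Complex.norm_I, mul_one, Complex.norm_real, Real.norm_eq_abs, abs_mul]
      gcongr
      have := Real.pi_gt_three
      rw [abs_of_pos (a := 2 * Real.pi) (by linarith)]
      nlinarith [abs_nonneg (ξ j)]
    calc (1 + ‖ξ‖) ^ (m + 1) * ‖𝓕 (fun y => (f y : ℂ)) ξ‖
        = (1 + ‖ξ‖) ^ m * ‖𝓕 (fun y => (f y : ℂ)) ξ‖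
          + (1 + ‖ξ‖) ^ m * (‖ξ‖ * ‖𝓕 (fun y => (f y : ℂ)) ξ‖) := by ring
      _ ≤ C + (1 + ‖ξ‖) ^ m * ((∑ j, |ξ j|) * ‖𝓕 (fun y => (f y : ℂ)) ξ‖) := by
        gcongr
        · exact hC ξ
        · exact norm_le_sum_abs ξ
      _ ≤ C + (1 + ‖ξ‖) ^ m * ∑ j, ‖𝓕 (fun y => (h j y : ℂ)) ξ‖ := by
        rw [Finset.sum_mul]
        gcongr with j
        exact key j
      _ ≤ C + ∑ j, D j := by
        rw [Finset.mul_sum]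
        gcongr with j
        exact hD j ξ

lemma integrable_pow_mul_of_rapid_decay {F : Coord n → ℂ} (hF : Continuous F)
    (h : ∀ m : ℕ, ∃ C, ∀ ξ, (1 + ‖ξ‖) ^ m * ‖F ξ‖ ≤ C) (k : ℕ) :
    Integrable fun ξ => ‖ξ‖ ^ k * ‖F ξ‖ := by
  -- The additional `n + 1` powers are spent on the weight `(1 + ‖ξ‖) ^ (-(n + 1))`, which is
  -- integrable on `ℝⁿ`.
  obtain ⟨C, hC⟩ := h (k + (n + 1))
  have hi : Integrable (fun ξ : Coord n => C * (1 + ‖ξ‖) ^ (-((n + 1 : ℕ) : ℝ))) :=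
    (integrable_one_add_norm (by simp)).const_mul C
  refine hi.mono' (by fun_prop) (Eventually.of_forall fun ξ => ?_)
  rw [Real.norm_of_nonneg (by positivity), Real.rpow_neg (by positivity), Real.rpow_natCast,
    ← div_eq_mul_inv, le_div_iff₀ (by positivity)]
  refine le_trans ?_ (hC ξ)
  have : ‖ξ‖ ^ k ≤ (1 + ‖ξ‖) ^ k := by gcongr; linarith
  calc ‖ξ‖ ^ k * ‖F ξ‖ * (1 + ‖ξ‖) ^ (n + 1) ≤ (1 + ‖ξ‖) ^ k * ‖F ξ‖ * (1 + ‖ξ‖) ^ (n + 1) := by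
        gcongr
    _ = _ := by rw [pow_add]; ring

lemma continuous_innerₗ_uncurry :
    Continuous fun p : Coord n × Coord n => (innerₗ (Coord n)) p.1 p.2 :=
  continuous_fst.inner continuous_snd

/-- Pointwise inversion is not available because `f` need not be continuous. Tested against a smooth
function of compact support, both transforms are moved onto that function, where inversion holds in
the Schwartz space. -/
lemma ae_eq_fourierInv_fourier {f : Coord n → ℝ} (hf : Integrable f)
    (hF : Integrable (𝓕 fun y => (f y : ℂ))) :
    ∀ᵐ y, (f y : ℂ) = 𝓕⁻ (𝓕 fun y => (f y : ℂ)) y := by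
  set fc : Coord n → ℂ := fun y => (f y : ℂ) with hfc
  have hfi : Integrable fc := hf.ofReal
  have hcont : Continuous (𝓕⁻ (𝓕 fc)) :=
    VectorFourier.fourierIntegral_continuous Real.continuous_fourierChar
      continuous_innerₗ_uncurry.neg hF
  have key : ∀ᵐ y, fc y - 𝓕⁻ (𝓕 fc) y = 0 := by
    refine ae_eq_zero_of_integral_contDiff_smul_eq_zero
      (hfi.locallyIntegrable.sub hcont.locallyIntegrable) ?_
    intro g hg hc
    have hgc : ContDiff ℝ ∞ (fun y => (g y : ℂ)) := Complex.ofRealCLM.contDiff.comp hg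
    have hcc : HasCompactSupport (fun y => (g y : ℂ)) := hc.comp_left Complex.ofReal_zero
    set G : 𝓢(Coord n, ℂ) := hcc.toSchwartzMap hgc with hG
    have hGv : ∀ y, G y = (g y : ℂ) := fun y => rfl
    have inv : ∀ y, 𝓕 (𝓕⁻ G) y = G y := fun y => by simp
    have hcoe : ∀ H : 𝓢(Coord n, ℂ), (𝓕 H : 𝓢(Coord n, ℂ)) = 𝓕 (H : Coord n → ℂ) :=
      fun H => SchwartzMap.fourier_coe H
    have s1 : ∫ x, fc x * G x = ∫ x, 𝓕 fc x * (𝓕⁻ G) x := by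
      have := VectorFourier.integral_fourierIntegral_smul_eq_flip (e := Real.fourierChar)
        (L := innerₗ (Coord n)) (μ := volume) (ν := volume) (f := fc)
        (g := (𝓕⁻ G : 𝓢(Coord n, ℂ))) Real.continuous_fourierChar
        continuous_innerₗ_uncurry hfi (SchwartzMap.integrable _)
      rw [flip_innerₗ] at this
      refine Eq.trans ?_ this.symm
      refine integral_congr_ae (Eventually.of_forall fun x => ?_)
      simp only [smul_eq_mul]
      congr 1
      rw [← inv, hcoe]
      rfl
    have s2 : ∫ x, 𝓕 fc x * (𝓕⁻ G) x = ∫ x, 𝓕⁻ (𝓕 fc) x * G x := by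
      have := VectorFourier.integral_fourierIntegral_smul_eq_flip (e := Real.fourierChar)
        (L := -innerₗ (Coord n)) (μ := volume) (ν := volume) (f := 𝓕 fc)
        (g := G) Real.continuous_fourierChar
        continuous_innerₗ_uncurry.neg hF (SchwartzMap.integrable _)
      have hfl : (-innerₗ (Coord n)).flip = -innerₗ (Coord n) := by
        ext x y; simp [real_inner_comm]
      rw [hfl] at this
      refine Eq.trans ?_ this.symm
      refine integral_congr_ae (Eventually.of_forall fun x => ?_)
      simp only [smul_eq_mul]
      rw [SchwartzMap.fourierInv_coe]
      rfl
    have i1 : Integrable (fun y => fc y * G y) := by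
      obtain ⟨B, hB⟩ := hcc.exists_bound_of_continuous hgc.continuous
      exact hfi.mul_bdd (c := B) G.continuous.aestronglyMeasurable
        (Eventually.of_forall hB)
    have i2 : Integrable (fun y => 𝓕⁻ (𝓕 fc) y * G y) :=
      (hcont.mul G.continuous).integrable_of_hasCompactSupport hcc.mul_left
    have e : ∀ y, g y • (fc y - 𝓕⁻ (𝓕 fc) y) = fc y * G y - 𝓕⁻ (𝓕 fc) y * G y := by
      intro y
      rw [hGv, Complex.real_smul]; ring
    simp only [e]
    rw [integral_sub i1 i2, s1, s2, sub_self]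
  filter_upwards [key] with y hy using sub_eq_zero.1 hy

/-- Rapid decay makes every moment of the transform integrable, so its inverse transform may be
differentiated under the integral any number of times. Only `L¹` bounds enter. -/
lemma exists_smooth_ae_eq_of_weakPartial_closed {𝒲 : Set (Coord n → ℝ)}
    (h1 : ∀ f ∈ 𝒲, Integrable f ∧ HasCompactSupport f)
    (h2 : ∀ f ∈ 𝒲, ∀ j, ∃ h ∈ 𝒲, HasWeakPartial univ j f h) {f : Coord n → ℝ} (hf : f ∈ 𝒲) :
    ∃ V : Coord n → ℝ, ContDiff ℝ ∞ V ∧ ∀ᵐ y, f y = V y := by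
  have hfi := (h1 f hf).1
  have hcont : Continuous (𝓕 fun y => (f y : ℂ)) :=
    VectorFourier.fourierIntegral_continuous Real.continuous_fourierChar
      continuous_innerₗ_uncurry hfi.ofReal
  have hint := integrable_pow_mul_of_rapid_decay hcont fun m => fourier_rapid_decay h1 h2 m f hf
  have hF : Integrable (𝓕 fun y => (f y : ℂ)) := by
    have := hint 0
    simp only [pow_zero, one_mul] at this
    exact (integrable_norm_iff hcont.aestronglyMeasurable).1 this
  have hs : ContDiff ℝ ∞ (𝓕 (𝓕 fun y => (f y : ℂ))) :=
    Real.contDiff_fourier (N := ⊤) fun k _ => hint k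
  refine ⟨fun y => (𝓕⁻ (𝓕 fun y => (f y : ℂ)) y).re, ?_, ?_⟩
  -- The inverse transform is the transform evaluated at `-y`, so its smoothness follows from that
  -- of the iterated transform.
  · rw [Real.fourierInv_eq_fourier_comp_neg]
    simp_rw [← Real.fourierInv_eq_fourier_comp_neg, Real.fourierInv_eq_fourier_neg]
    exact Complex.reCLM.contDiff.comp (hs.comp contDiff_neg)
  · filter_upwards [ae_eq_fourierInv_fourier hfi hF] with y hy
    rw [← hy, Complex.ofReal_re]

end InteriorRegularity

/-! ### Closed first order systems: regularity up to the boundary and Grönwall's inequality -/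

section WeakSystem

variable {n : ℕ} {U : Set (Coord n)} {ι : Type*} [Fintype ι]

/-- Extension by zero creates no singular part on the boundary of `U`, because the functions vanish
off a compact subset: any test function may be cut off inside `U` without changing the integrals. -/
lemma HasWeakPartial.extend_univ {j : Fin n} {f h : Coord n → ℝ} {K : Set (Coord n)}
    (hw : HasWeakPartial U j f h) (hU : IsOpen U) (hK : IsCompact K) (hKU : K ⊆ U)
    (hf : ∀ y ∉ K, f y = 0) (hh : ∀ y ∉ K, h y = 0) : HasWeakPartial univ j f h := by
  have key : ∀ p : Coord n → ℝ, LocallyIntegrableOn p U → (∀ y ∉ K, p y = 0) →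
      LocallyIntegrableOn p univ := fun p hp h0 => by
    rw [locallyIntegrableOn_univ]
    exact Integrable.locallyIntegrable ((integrableOn_iff_integrable_of_support_subset
      fun y hy => by_contra fun hc => hy (h0 y hc)).1 (hp.integrableOn_compact_subset hKU hK))
  refine ⟨key f hw.1 hf, key h hw.2.1 hh, fun φ hφ hc _ => ?_⟩
  obtain ⟨χ, h1, h2, h3, h4, -⟩ := exists_smooth_cutoff hK hU hKU
  have h5 := hw.2.2 (fun y => χ y * φ y) (h1.mul hφ) h2.mul_right
    ((tsupport_mul_subset_left (f := χ) (g := φ)).trans h3)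
  rw [setIntegral_eq_integral_of_forall_compl_eq_zero
      fun y hy => by rw [hf y fun h => hy (hKU h), zero_mul],
    setIntegral_eq_integral_of_forall_compl_eq_zero
      fun y hy => by rw [hh y fun h => hy (hKU h), zero_mul]] at h5
  simp only [Measure.restrict_univ]
  convert h5 using 1
  · refine integral_congr_ae (Eventually.of_forall fun y => ?_)
    by_cases hy : y ∈ K
    · have : (fun z => χ z * φ z) =ᶠ[𝓝 y] φ := by
        filter_upwards [(eventually_nhdsSet_iff_forall.1 h4) y hy] with z hz
        rw [hz, one_mul]
      simp only [this.fderiv_eq]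
    · simp [hf y hy]
  · congr 1
    refine integral_congr_ae (Eventually.of_forall fun y => ?_)
    by_cases hy : y ∈ K
    · have := ((eventually_nhdsSet_iff_forall.1 h4) y hy).self_of_nhds
      simp [this]
    · simp [hh y hy]

/-- The linear combinations of the `W k` whose coefficients are smooth with compact support. -/
def testCombinations (U : Set (Coord n)) (W : ι → Coord n → ℝ) : Set (Coord n → ℝ) :=
  {f | ∃ a : ι → Coord n → ℝ, (∀ k, ContDiff ℝ ∞ (a k) ∧ HasCompactSupport (a k) ∧
    tsupport (a k) ⊆ U) ∧ f = fun y => ∑ k, a k y * W k y}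

/-- By the product rule the derivative falls on a coefficient, which stays a test function, or on
some `W k`, where the system replaces it by a combination of the unknowns. This is the closedness
required by the Fourier argument. -/
lemma testCombinations_weakPartial (hU : IsOpen U) {W : ι → Coord n → ℝ}
    {A : Fin n → ι → ι → Coord n → ℝ} (hA : ∀ j k l, ContDiffOn ℝ ∞ (A j k l) U)
    (hw : ∀ j k, HasWeakPartial U j (W k) (fun y => ∑ l, A j k l y * W l y))
    {f : Coord n → ℝ} (hf : f ∈ testCombinations U W) (j : Fin n) :
    ∃ h ∈ testCombinations U W, HasWeakPartial univ j f h := by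
  obtain ⟨a, ha, rfl⟩ := hf
  refine ⟨_, ⟨fun l y => fderiv ℝ (a l) y (stdVec j) + ∑ k, A j k l y * a k y, fun l => ?_, rfl⟩,
    ?_⟩
  · have hs : tsupport (fun y => fderiv ℝ (a l) y (stdVec j) + ∑ k, A j k l y * a k y) ⊆
        ⋃ k, tsupport (a k) := by
      refine closure_minimal ?_ (isClosed_iUnion_of_finite fun k => isClosed_tsupport _)
      intro y hy
      by_contra hc
      simp only [mem_iUnion, not_exists] at hc
      refine hy ?_
      simp only
      rw [image_eq_zero_of_notMem_tsupport (f := fun y => fderiv ℝ (a l) y (stdVec j))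
        fun h => hc l (tsupport_fderiv_apply_subset _ h)]
      simp [fun k => image_eq_zero_of_notMem_tsupport (hc k)]
    have hsU : (⋃ k, tsupport (a k)) ⊆ U := iUnion_subset fun k => (ha k).2.2
    refine ⟨(contDiff_fderiv_apply (ha l).1 _).add (ContDiff.sum fun k _ =>
        contDiff_mul_of_tsupport_subset hU (hA j k l) (ha k).1 (ha k).2.2), ?_, hs.trans hsU⟩
    exact (isCompact_iUnion fun k => (ha k).2.1).of_isClosed_subset (isClosed_tsupport _) hs
  · have hk : ∀ k, HasWeakPartial univ j (fun y => a k y * W k y)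
        (fun y => fderiv ℝ (a k) y (stdVec j) * W k y + a k y * ∑ l, A j k l y * W l y) := by
      intro k
      refine ((hw j k).smooth_mul hU (ha k).1.contDiffOn).extend_univ hU (ha k).2.1 (ha k).2.2
        (fun y hy => ?_) fun y hy => ?_
      · rw [image_eq_zero_of_notMem_tsupport hy, zero_mul]
      · rw [image_eq_zero_of_notMem_tsupport hy,
          image_eq_zero_of_notMem_tsupport (f := fun y => fderiv ℝ (a k) y (stdVec j))
            fun h => hy (tsupport_fderiv_apply_subset _ h), zero_mul, zero_mul, add_zero]
    refine (HasWeakPartial.sum Finset.univ fun k _ => hk k).congr_ae EventuallyEq.rfl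
      (Eventually.of_forall fun y => ?_)
    simp only [add_mul, Finset.sum_add_distrib, Finset.mul_sum, Finset.sum_mul]
    congr 1
    rw [Finset.sum_comm]
    exact Finset.sum_congr rfl fun k _ => Finset.sum_congr rfl fun l _ => by ring

/-- Continuous functions that agree almost everywhere on an open set agree there, so the local
representatives are compatible and the value at `y` may be read off from the one chosen at `y`. -/
lemma exists_contDiffOn_ae_eq_of_locally {f : Coord n → ℝ} (hU : IsOpen U)
    (h : ∀ y ∈ U, ∃ O, IsOpen O ∧ y ∈ O ∧ ∃ V : Coord n → ℝ, ContDiffOn ℝ ∞ V O ∧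
      f =ᵐ[volume.restrict O] V) :
    ∃ V : Coord n → ℝ, ContDiffOn ℝ ∞ V U ∧ f =ᵐ[volume.restrict U] V := by
  classical
  choose! O hO hyO V hV hfV using h
  have agree : ∀ y ∈ U, ∀ z ∈ U, z ∈ O y → V z z = V y z := by
    intro y hy z hz hzy
    have : V z =ᵐ[volume.restrict (O y ∩ O z)] V y := by
      filter_upwards [ae_mono (Measure.restrict_mono inter_subset_left le_rfl) (hfV y hy),
        ae_mono (Measure.restrict_mono inter_subset_right le_rfl) (hfV z hz)] with w h1 h2
      rw [← h1, ← h2]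
    exact Measure.eqOn_open_of_ae_eq this ((hO y hy).inter (hO z hz))
      ((hV z hz).continuousOn.mono inter_subset_right)
      ((hV y hy).continuousOn.mono inter_subset_left) ⟨hzy, hyO z hz⟩
  refine ⟨fun y => V y y, fun y hy => ?_, ?_⟩
  · have : (fun z => V z z) =ᶠ[𝓝 y] V y := by
      filter_upwards [hU.mem_nhds hy, (hO y hy).mem_nhds (hyO y hy)] with z hz hzy
      exact agree y hy z hz hzy
    exact (((hV y hy).contDiffAt ((hO y hy).mem_nhds (hyO y hy))).congr_of_eventuallyEq
      this).contDiffWithinAt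
  · rw [EventuallyEq, ae_restrict_iff' hU.measurableSet]
    refine measure_null_of_locally_null _ fun y hy => ?_
    have hyU : y ∈ U := by
      by_contra hc
      exact hy fun h => absurd h hc
    refine ⟨_, inter_mem (mem_nhdsWithin_of_mem_nhds ((hO y hyU).mem_nhds (hyO y hyU)))
      self_mem_nhdsWithin, ?_⟩
    have h1 := hfV y hyU
    rw [EventuallyEq, ae_restrict_iff' (hO y hyU).measurableSet, ae_iff] at h1
    refine measure_mono_null ?_ h1
    rintro z ⟨hz, hzc⟩ hzO
    refine hzc fun hzU => ?_
    rw [hzO hz]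
    exact (agree y hyU z hzU hz).symm

lemma exists_smooth_of_weakSystem (hU : IsOpen U) {W : ι → Coord n → ℝ}
    {A : Fin n → ι → ι → Coord n → ℝ} (hA : ∀ j k l, ContDiffOn ℝ ∞ (A j k l) U)
    (hW : ∀ k, LocallyIntegrableOn (W k) U)
    (hw : ∀ j k, HasWeakPartial U j (W k) (fun y => ∑ l, A j k l y * W l y)) (k : ι) :
    ∃ V : Coord n → ℝ, ContDiffOn ℝ ∞ V U ∧ W k =ᵐ[volume.restrict U] V := by
  classical
  refine exists_contDiffOn_ae_eq_of_locally hU fun y hy => ?_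
  obtain ⟨χ, h1, h2, h3, h4, -⟩ := exists_smooth_cutoff (isCompact_singleton (x := y)) hU
    (by simpa using hy)
  rw [nhdsSet_singleton] at h4
  obtain ⟨O, hO, hOo, hyO⟩ := eventually_nhds_iff.1 h4
  -- The coefficient family is the cutoff at index `k` and zero elsewhere; near `y` the combination
  -- is `W k` itself.
  have hmem : (fun y => χ y * W k y) ∈ testCombinations U W := by
    refine ⟨fun l => if l = k then χ else 0, fun l => ?_, ?_⟩
    · by_cases hl : l = k
      · simp [hl, h1, h2, h3]
      · simp only [hl, if_false]
        exact ⟨contDiff_const, HasCompactSupport.zero, by simp [tsupport]⟩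
    · ext z
      rw [Finset.sum_eq_single k]
      · simp
      · intro l _ hl; simp [hl]
      · simp
  have hint : ∀ f ∈ testCombinations U W, Integrable f ∧ HasCompactSupport f := by
    rintro f ⟨a, ha, rfl⟩
    refine ⟨integrable_finsetSum _ fun l _ => ?_, ?_⟩
    · simpa only [mul_comm] using integrable_mul_of_tsupport_subset (hW l)
        (ha l).1.continuous.continuousOn (ha l).2.1 (ha l).2.2
    · refine (isCompact_iUnion fun k => (ha k).2.1).of_isClosed_subset (isClosed_tsupport _)
        (closure_minimal ?_ (isClosed_iUnion_of_finite fun k => isClosed_tsupport _))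
      intro y hy
      by_contra hc
      simp only [mem_iUnion, not_exists] at hc
      exact hy (by simp [fun k => image_eq_zero_of_notMem_tsupport (hc k)])
  obtain ⟨V, hV, hfV⟩ := exists_smooth_ae_eq_of_weakPartial_closed hint
    (fun f hf j => testCombinations_weakPartial hU hA hw hf j) hmem
  refine ⟨O, hOo, hyO, V, hV.contDiffOn, ?_⟩
  rw [EventuallyEq, ae_restrict_iff' hOo.measurableSet]
  filter_upwards [hfV] with z hz hzO
  rw [← hz, hO z hzO, one_mul]

/-- The derivative prescribed by the first order system `∂ⱼ Wₖ = ∑ₗ Aⱼₖₗ Wₗ`. -/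
def sysDeriv (A : Fin n → ι → ι → Coord n → ℝ) (y : Coord n) (w : ι → ℝ) :
    Coord n →L[ℝ] (ι → ℝ) :=
  ContinuousLinearMap.pi fun k => ∑ j, (∑ l, A j k l y * w l) • (EuclideanSpace.proj j)

lemma sysDeriv_apply (A : Fin n → ι → ι → Coord n → ℝ) (y v : Coord n) (w : ι → ℝ) (k : ι) :
    sysDeriv A y w v k = ∑ j, (∑ l, A j k l y * w l) * v j := by
  simp [sysDeriv]

lemma contDiffOn_sysDeriv {m : WithTop ℕ∞} {D : Set (Coord n)} {A : Fin n → ι → ι → Coord n → ℝ}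
    (hA : ∀ j k l, ContDiffOn ℝ m (A j k l) D) {V : Coord n → ι → ℝ} (hV : ContDiffOn ℝ m V D) :
    ContDiffOn ℝ m (fun y => sysDeriv A y (V y)) D := by
  rw [contDiffOn_clm_apply]
  intro v
  rw [contDiffOn_pi]
  intro k
  simp_rw [sysDeriv_apply]
  refine ContDiffOn.sum fun j _ => (ContDiffOn.sum fun l _ => ?_).mul contDiffOn_const
  exact (hA j k l).mul (contDiffOn_pi.1 hV l)

lemma norm_sysDeriv_le {A : Fin n → ι → ι → Coord n → ℝ} {y : Coord n} {B : ℝ}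
    (hB0 : 0 ≤ B) (hB : ∀ j k l, |A j k l y| ≤ B) (w : ι → ℝ) :
    ‖sysDeriv A y w‖ ≤ n * (Fintype.card ι * B) * ‖w‖ := by
  refine ContinuousLinearMap.opNorm_le_bound _ (by positivity) fun v => ?_
  refine (pi_norm_le_iff_of_nonneg (by positivity)).2 fun k => ?_
  rw [sysDeriv_apply]
  calc ‖∑ j, (∑ l, A j k l y * w l) * v j‖ ≤ ∑ j : Fin n, ‖(∑ l, A j k l y * w l) * v j‖ :=
        norm_sum_le _ _
    _ ≤ ∑ j : Fin n, (∑ l : ι, B * ‖w‖) * ‖v‖ := by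
      gcongr with j
      rw [norm_mul]
      gcongr
      · refine (norm_sum_le _ _).trans ?_
        gcongr with l
        rw [norm_mul]
        gcongr
        · exact hB j k l
        · exact norm_le_pi_norm w l
      · exact PiLp.norm_apply_le v j
    _ = _ := by simp; ring

/-- Grönwall's inequality along the segments of a convex set. -/
lemma norm_le_exp_mul_norm_of_convex {F : Type*} [NormedAddCommGroup F] [NormedSpace ℝ F]
    {s : Set (Coord n)} (hs : Convex ℝ s) {V : Coord n → F} {D : Coord n → Coord n →L[ℝ] F} {C : ℝ}
    (hV : ∀ y ∈ s, HasFDerivWithinAt V (D y) s y) (hD : ∀ y ∈ s, ‖D y‖ ≤ C * ‖V y‖)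
    {x y : Coord n} (hx : x ∈ s) (hy : y ∈ s) :
    ‖V y‖ ≤ ‖V x‖ * Real.exp (C * ‖y - x‖) := by
  set γ : ℝ → Coord n := fun t => x + t • (y - x) with hγ
  have hm : ∀ t ∈ Icc (0 : ℝ) 1, γ t ∈ s := fun t ht => hs.add_smul_sub_mem hx hy ht
  have hγd : ∀ t, HasDerivAt γ (y - x) t := fun t => by
    simpa [hγ] using ((hasDerivAt_id t).smul_const (y - x)).const_add x
  have hd : ∀ t ∈ Icc (0 : ℝ) 1, HasDerivWithinAt (fun t => V (γ t)) (D (γ t) (y - x)) (Icc 0 1) t :=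
    fun t ht => (hV _ (hm t ht)).comp_hasDerivWithinAt t (hγd t).hasDerivWithinAt hm
  have := norm_le_gronwallBound_of_norm_deriv_right_le (f := fun t => V (γ t))
    (f' := fun t => D (γ t) (y - x)) (δ := ‖V x‖) (K := C * ‖y - x‖) (ε := 0) (a := 0) (b := 1)
    (fun t ht => (hd t ht).continuousWithinAt)
    (fun t ht => (hd t (Ico_subset_Icc_self ht)).mono_of_mem_nhdsWithin
      (mem_of_superset (Icc_mem_nhdsGE ht.2) (Icc_subset_Icc_left ht.1)))
    (by simp [hγ]) (fun t ht => by
      have h1 := (D (γ t)).le_opNorm (y - x)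
      have h2 := hD _ (hm t (Ico_subset_Icc_self ht))
      calc _ ≤ _ := h1
        _ ≤ C * ‖V (γ t)‖ * ‖y - x‖ := by gcongr
        _ = _ := by ring) 1 (by simp)
  simpa [hγ, gronwallBound_ε0] using this

/-- A solution of a first order system on the interior of a convex set extends smoothly up to the
boundary if the coefficients do. -/
lemma exists_smooth_extension {H O : Set (Coord n)} (hH : Convex ℝ H) (hHc : IsClosed H)
    (hHn : (interior H).Nonempty) (hO : IsOpen O) {A : Fin n → ι → ι → Coord n → ℝ}
    (hA : ∀ j k l, ContDiffOn ℝ ∞ (A j k l) (O ∩ H)) {V : Coord n → ι → ℝ}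
    (hV : ∀ y ∈ O ∩ interior H, HasFDerivAt V (sysDeriv A y (V y)) y) :
    ∃ V' : Coord n → ι → ℝ, ContDiffOn ℝ ∞ V' (O ∩ H) ∧ EqOn V' V (O ∩ interior H) := by
  have hcl : closure (interior H) = H := by
    rw [hH.closure_interior_eq_closure_of_nonempty_interior hHn, hHc.closure_eq]
  have hUo : IsOpen (O ∩ interior H) := hO.inter isOpen_interior
  have hud : UniqueDiffOn ℝ (O ∩ H) := by
    rw [inter_comm]; exact (uniqueDiffOn_convex hH hHn).inter hO
  -- Limits of `V` exist at every point of `O ∩ H`: on a small convex piece of the interior,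
  -- Grönwall bounds `V`, the system then bounds its derivative, and a Lipschitz function extends
  -- continuously.
  have loc : ∀ y ∈ O ∩ H, ∃ r > 0, Metric.ball y r ⊆ O ∧
      ∃ w, Tendsto V (𝓝[O ∩ interior H] y) (𝓝 w) := by
    intro y hy
    obtain ⟨r, hr, hrO⟩ := Metric.nhds_basis_closedBall.mem_iff.1 (hO.mem_nhds hy.1)
    refine ⟨r, hr, Metric.ball_subset_closedBall.trans hrO, ?_⟩
    have hK : IsCompact (Metric.closedBall y r ∩ H) := (isCompact_closedBall y r).inter_right hHc
    have hb : ∃ B : ℝ, 0 ≤ B ∧ ∀ z ∈ Metric.closedBall y r ∩ H, ∀ j k l, |A j k l z| ≤ B := by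
      have : ∀ j k l, ∃ B : ℝ, 0 ≤ B ∧ ∀ z ∈ Metric.closedBall y r ∩ H, |A j k l z| ≤ B := by
        intro j k l
        obtain ⟨B, hB⟩ := hK.exists_bound_of_continuousOn
          ((hA j k l).continuousOn.mono (inter_subset_inter_left _ hrO))
        exact ⟨|B|, abs_nonneg _, fun z hz => (hB z hz).trans (le_abs_self B)⟩
      choose B hB0 hB using this
      refine ⟨∑ j, ∑ k, ∑ l, B j k l, Finset.sum_nonneg fun j _ => Finset.sum_nonneg fun k _ =>
        Finset.sum_nonneg fun l _ => hB0 j k l, fun z hz j k l => (hB j k l z hz).trans ?_⟩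
      calc B j k l ≤ ∑ l, B j k l :=
            Finset.single_le_sum (fun l _ => hB0 j k l) (Finset.mem_univ l)
        _ ≤ ∑ k, ∑ l, B j k l := Finset.single_le_sum (f := fun k => ∑ l, B j k l)
            (fun k _ => Finset.sum_nonneg fun l _ => hB0 j k l) (Finset.mem_univ k)
        _ ≤ _ := Finset.single_le_sum (f := fun j => ∑ k, ∑ l, B j k l)
            (fun j _ => Finset.sum_nonneg fun k _ => Finset.sum_nonneg fun l _ => hB0 j k l)
            (Finset.mem_univ j)
    obtain ⟨B, hB0, hB⟩ := hb
    set s := Metric.ball y r ∩ interior H with hs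
    have hsc : Convex ℝ s := (convex_ball y r).inter hH.interior
    have hsU : s ⊆ O ∩ interior H :=
      inter_subset_inter_left _ (Metric.ball_subset_closedBall.trans hrO)
    set C : ℝ := n * (Fintype.card ι * B) with hC
    have hC0 : 0 ≤ C := by positivity
    have hder : ∀ z ∈ s, HasFDerivWithinAt V (sysDeriv A z (V z)) s z := fun z hz =>
      (hV z (hsU hz)).hasFDerivWithinAt
    have hbd : ∀ z ∈ s, ‖sysDeriv A z (V z)‖ ≤ C * ‖V z‖ := fun z hz =>
      norm_sysDeriv_le hB0 (hB z ⟨Metric.ball_subset_closedBall hz.1, interior_subset hz.2⟩) _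
    have hyc : y ∈ closure (interior H) := hcl.symm ▸ hy.2
    obtain ⟨x, hx1, hx2⟩ := mem_closure_iff.1 hyc _ Metric.isOpen_ball (Metric.mem_ball_self hr)
    have hx : x ∈ s := ⟨hx1, hx2⟩
    have hbV : ∀ z ∈ s, ‖V z‖ ≤ ‖V x‖ * Real.exp (C * (2 * r)) := by
      intro z hz
      refine (norm_le_exp_mul_norm_of_convex hsc hder hbd hx hz).trans ?_
      gcongr
      have h1 := Metric.mem_ball.1 hz.1
      have h2 := Metric.mem_ball'.1 hx.1
      rw [← dist_eq_norm]
      linarith [dist_triangle z y x]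
    have hlip : LipschitzOnWith (Real.toNNReal (C * (‖V x‖ * Real.exp (C * (2 * r))))) V s := by
      refine hsc.lipschitzOnWith_of_nnnorm_hasFDerivWithin_le hder fun z hz => ?_
      rw [← NNReal.coe_le_coe, coe_nnnorm, Real.coe_toNNReal _ (by positivity)]
      exact (hbd z hz).trans (by gcongr; exact hbV z hz)
    obtain ⟨g, hg, hgV⟩ := hlip.extend_pi
    refine ⟨g y, ?_⟩
    have hn : 𝓝[O ∩ interior H] y = 𝓝[s] y := by
      rw [hs, inter_comm O, inter_comm (Metric.ball y r), nhdsWithin_inter_of_mem',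
        nhdsWithin_inter_of_mem']
      · exact mem_nhdsWithin_of_mem_nhds (Metric.ball_mem_nhds y hr)
      · exact mem_nhdsWithin_of_mem_nhds (hO.mem_nhds hy.1)
    rw [hn]
    refine (hg.continuous.continuousAt.tendsto.mono_left nhdsWithin_le_nhds).congr' ?_
    filter_upwards [self_mem_nhdsWithin] with z hz using (hgV hz).symm
  set V' := extendFrom (O ∩ interior H) V with hV'
  have hsub : O ∩ H ⊆ closure (O ∩ interior H) := by
    nth_rw 1 [← hcl]; exact hO.inter_closure
  have hcont : ContinuousOn V' (O ∩ H) := continuousOn_extendFrom hsub fun y hy =>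
    (loc y hy).choose_spec.2.2
  have heq : EqOn V' V (O ∩ interior H) := fun y hy =>
    extendFrom_eq (subset_closure hy) ((hV y hy).continuousAt.tendsto.mono_left nhdsWithin_le_nhds)
  have hder' : ∀ y ∈ O ∩ interior H, HasFDerivAt V' (sysDeriv A y (V' y)) y := fun y hy => by
    rw [heq hy]
    exact (hV y hy).congr_of_eventuallyEq (heq.eventuallyEq_of_mem (hUo.mem_nhds hy))
  have hcontD : ContinuousOn (fun y => sysDeriv A y (V' y)) (O ∩ H) :=
    (contDiffOn_sysDeriv (m := 0) (fun j k l => (hA j k l).of_le (by simp))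
      (contDiffOn_zero.2 hcont)).continuousOn
  have hderiv : ∀ y ∈ O ∩ H, HasFDerivWithinAt V' (sysDeriv A y (V' y)) (O ∩ H) y := by
    intro y hy
    obtain ⟨r, hr, hrO⟩ := Metric.isOpen_iff.1 hO y hy.1
    set s := Metric.ball y (r / 2) ∩ interior H with hs
    have hcs : closure s ⊆ O ∩ H := by
      intro z hz
      refine ⟨hrO ?_, hHc.closure_subset_iff.2 (inter_subset_right.trans interior_subset) hz⟩
      have : z ∈ Metric.closedBall y (r / 2) := Metric.closure_ball_subset_closedBall
        (closure_mono inter_subset_left hz)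
      exact Metric.mem_ball.2 (lt_of_le_of_lt (Metric.mem_closedBall.1 this) (by linarith))
    have hsU : s ⊆ O ∩ interior H := fun z hz => ⟨(hcs (subset_closure hz)).1, hz.2⟩
    -- The derivative prescribed by the system is continuous up to the boundary, and a function on a
    -- convex set whose derivative converges at a closure point is differentiable there with that
    -- limit as derivative.
    have h1 : HasFDerivWithinAt V' (sysDeriv A y (V' y)) (closure s) y := by
      refine hasFDerivWithinAt_closure_of_tendsto_fderiv
        (fun z hz => (hder' z (hsU hz)).differentiableAt.differentiableWithinAt)
        ((convex_ball _ _).inter hH.interior) (Metric.isOpen_ball.inter isOpen_interior)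
        (fun z hz => (hcont z (hcs hz)).mono (hsU.trans (inter_subset_inter_right _ interior_subset))) ?_
      refine ((hcontD y hy).mono (hsU.trans (inter_subset_inter_right _ interior_subset))).tendsto.congr' ?_
      filter_upwards [self_mem_nhdsWithin] with z hz
      exact (hder' z (hsU hz)).fderiv.symm
    refine h1.mono_of_mem_nhdsWithin ?_
    refine mem_of_superset (inter_mem_nhdsWithin (O ∩ H) (Metric.ball_mem_nhds y (half_pos hr))) ?_
    rintro z ⟨hz1, hz2⟩
    have : z ∈ Metric.ball y (r / 2) ∩ closure (interior H) := ⟨hz2, hcl.symm ▸ hz1.2⟩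
    exact Metric.isOpen_ball.inter_closure this
  -- Bootstrap: if `V'` is of class `C^m`, so is the right-hand side of the system, which is the
  -- derivative of `V'`.
  refine ⟨V', contDiffOn_infty.2 fun m => ?_, heq⟩
  induction m with
  | zero => exact contDiffOn_zero.2 hcont
  | succ m ih =>
    push_cast
    rw [contDiffOn_succ_iff_fderivWithin hud]
    refine ⟨fun y hy => (hderiv y hy).differentiableWithinAt, by simp, ?_⟩
    refine (contDiffOn_sysDeriv (fun j k l => (hA j k l).of_le (by exact_mod_cast le_top)) ih).congr fun y hy => ?_
    exact (hderiv y hy).fderivWithin (hud y hy)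

/-- Interior and boundary regularity of weak solutions of first order systems. -/
theorem exists_smooth_of_weakSystem_upTo_boundary {H O : Set (Coord n)} (hH : Convex ℝ H)
    (hHc : IsClosed H) (hHn : (interior H).Nonempty) (hO : IsOpen O) {W : ι → Coord n → ℝ}
    {A : Fin n → ι → ι → Coord n → ℝ} (hA : ∀ j k l, ContDiffOn ℝ ∞ (A j k l) (O ∩ H))
    (hW : ∀ k, LocallyIntegrableOn (W k) (O ∩ interior H))
    (hw : ∀ j k, HasWeakPartial (O ∩ interior H) j (W k) (fun y => ∑ l, A j k l y * W l y)) :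
    ∃ V : ι → Coord n → ℝ, (∀ k, ContDiffOn ℝ ∞ (V k) (O ∩ H)) ∧
      ∀ k, W k =ᵐ[volume.restrict (O ∩ interior H)] V k := by
  have hU : IsOpen (O ∩ interior H) := hO.inter isOpen_interior
  have hUH : O ∩ interior H ⊆ O ∩ H := inter_subset_inter_right _ interior_subset
  choose V hV hWV using exists_smooth_of_weakSystem hU (fun j k l => (hA j k l).mono hUH) hW hw
  -- The smooth representatives solve the system classically: weak derivatives are unique almost
  -- everywhere, and both sides are continuous.
  have hpart : ∀ j k, EqOn (fun y => fderiv ℝ (V k) y (stdVec j)) (fun y => ∑ l, A j k l y * V l y)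
      (O ∩ interior H) := by
    intro j k
    have h1 := (hw j k).congr_ae (h' := fun y => ∑ l, A j k l y * V l y) (hWV k) (by
      have : ∀ᵐ y ∂volume.restrict (O ∩ interior H), ∀ l, W l y = V l y :=
        ae_all_iff.2 hWV
      filter_upwards [this] with y hy
      simp_rw [hy])
    refine Measure.eqOn_open_of_ae_eq ((HasWeakPartial.of_contDiffOn hU (hV k)).unique hU h1) hU
      (((hV k).fderiv_of_isOpen hU (m := 0) (by simp)).continuousOn.clm_apply continuousOn_const)
      (continuousOn_finsetSum _ fun l _ =>
        ((hA j k l).continuousOn.mono hUH).mul (hV l).continuousOn)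
  obtain ⟨V', hV', heq⟩ := exists_smooth_extension hH hHc hHn hO hA (V := fun y k => V k y) (by
    intro y hy
    rw [hasFDerivAt_pi']
    intro k
    have hd := ((hV k).contDiffAt (hU.mem_nhds hy)).differentiableAt (by simp)
    convert hd.hasFDerivAt using 1
    ext v
    have hv : v = ∑ j, v j • stdVec j := by
      ext i; simp [stdVec, Finset.sum_apply, Pi.single_apply]
    conv_rhs => rw [hv, map_sum]
    simp only [ContinuousLinearMap.comp_apply, ContinuousLinearMap.proj_apply, sysDeriv_apply,
      map_smul, smul_eq_mul]
    exact Finset.sum_congr rfl fun j _ => by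
      have hp := hpart j k hy
      simp only at hp
      rw [← hp, mul_comm])
  refine ⟨fun k y => V' y k, fun k => contDiffOn_pi.1 hV' k, fun k => (hWV k).trans ?_⟩
  rw [EventuallyEq, ae_restrict_iff' hU.measurableSet]
  exact Eventually.of_forall fun y hy => (congrFun (heq hy) k).symm

end WeakSystem

set_option linter.unusedSectionVars false

/-! ### Coordinate representations on a manifold with boundary -/

section Manifold

variable {n : ℕ} [NeZero n] {M : Type*} [TopologicalSpace M]
  [ChartedSpace (EuclideanHalfSpace n) M] [IsManifold (𝓡∂ n) ∞ M]

/-! ### Charts -/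

variable (n) in
/-- The model half-space as a subset of `ℝⁿ`. -/
abbrev HS : Set (Coord n) := range (𝓡∂ n)

lemma mem_HS {y : Coord n} : y ∈ HS n ↔ 0 ≤ y 0 := by
  rw [HS, range_modelWithCornersEuclideanHalfSpace]; rfl

lemma mem_interior_HS {y : Coord n} : y ∈ interior (HS n) ↔ 0 < y 0 := by
  rw [HS, interior_range_modelWithCornersEuclideanHalfSpace]; rfl

lemma convex_HS : Convex ℝ (HS n) := (𝓡∂ n).convex_range

lemma isClosed_HS : IsClosed (HS n) := (𝓡∂ n).isClosed_range

lemma nonempty_interior_HS : (interior (HS n)).Nonempty := (𝓡∂ n).nonempty_interior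

lemma closure_interior_HS : closure (interior (HS n)) = HS n := by
  rw [convex_HS.closure_interior_eq_closure_of_nonempty_interior nonempty_interior_HS,
    isClosed_HS.closure_eq]

lemma uniqueDiffOn_HS : UniqueDiffOn ℝ (HS n) := (𝓡∂ n).uniqueDiffOn

/-- The ambient open set whose intersection with the half-space is the chart domain. -/
def domO (c : M) : Set (Coord n) := (𝓡∂ n).symm ⁻¹' (chartAt (EuclideanHalfSpace n) c).target

lemma isOpen_domO (c : M) : IsOpen (domO c : Set (Coord n)) :=
  (chartAt (EuclideanHalfSpace n) c).open_target.preimage (𝓡∂ n).continuous_symm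

lemma dom_eq (c : M) : (dom c : Set (Coord n)) = domO c ∩ HS n := extChartAt_target _ _

lemma interior_dom (c : M) : interior (dom c : Set (Coord n)) = domO c ∩ interior (HS n) := by
  rw [dom_eq, interior_inter, (isOpen_domO c).interior_eq]

lemma dom_subset_HS (c : M) : (dom c : Set (Coord n)) ⊆ HS n := by
  rw [dom_eq]; exact inter_subset_right

lemma dom_subset_closure (c : M) : (dom c : Set (Coord n)) ⊆ closure (interior (dom c)) := by
  rw [interior_dom, dom_eq]
  nth_rw 1 [← closure_interior_HS]
  exact (isOpen_domO c).inter_closure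

lemma uniqueDiffOn_dom (c : M) : UniqueDiffOn ℝ (dom c : Set (Coord n)) :=
  uniqueDiffOn_extChartAt_target c

lemma measurableSet_dom (c : M) : MeasurableSet (dom c : Set (Coord n)) := by
  rw [dom_eq]
  exact (isOpen_domO c).measurableSet.inter isClosed_HS.measurableSet

lemma dom_mem_nhdsWithin {c : M} {y : Coord n} (hy : y ∈ dom c) : dom c ∈ 𝓝[HS n] y := by
  rw [dom_eq] at hy ⊢
  exact inter_mem (mem_nhdsWithin_of_mem_nhds ((isOpen_domO c).mem_nhds hy.1)) self_mem_nhdsWithin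

lemma nhdsWithin_dom_eq {c : M} {y : Coord n} (hy : y ∈ dom c) : 𝓝[dom c] y = 𝓝[HS n] y :=
  le_antisymm (nhdsWithin_mono _ (dom_subset_HS c)) (nhdsWithin_le_of_mem (dom_mem_nhdsWithin hy))

/-- `partialH` differentiates within the whole half-space, while smoothness is known on the chart
domain. The two notions agree because the domain is relatively open in the half-space. -/
lemma fderivWithin_dom {F : Type*} [NormedAddCommGroup F] [NormedSpace ℝ F] {c : M}
    {f : Coord n → F} {y : Coord n} (hy : y ∈ dom c) :
    fderivWithin ℝ f (dom c) y = fderivWithin ℝ f (HS n) y := by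
  refine fderivWithin_congr_set (nhdsWithin_eq_iff_eventuallyEq.1 (nhdsWithin_dom_eq hy))

lemma volume_dom_diff_interior (c : M) :
    volume ((dom c : Set (Coord n)) \ interior (dom c)) = 0 := by
  refine measure_mono_null ?_ ((convex_HS (n := n)).addHaar_frontier volume)
  rw [interior_dom, dom_eq]
  rintro y ⟨hy, hyi⟩
  exact ⟨subset_closure hy.2, fun h => hyi ⟨hy.1, h⟩⟩

/-- The boundary of the half-space is a null set. This links weak derivatives, tested on the
interior, with the volume, which lives on the whole chart domain. -/
lemma restrict_interior_dom (c : M) :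
    volume.restrict (interior (dom c : Set (Coord n))) = volume.restrict (dom c) := by
  refine Measure.restrict_congr_set ?_
  refine (interior_subset.eventuallyLE).antisymm (ae_le_set.2 (volume_dom_diff_interior c))

/-- The chart domain in `M`. -/
abbrev src (n : ℕ) [NeZero n] {M : Type*} [TopologicalSpace M]
    [ChartedSpace (EuclideanHalfSpace n) M] (c : M) : Set M :=
  (chartAt (EuclideanHalfSpace n) c).source

/-- The coordinate map of the chart around `c`. -/
abbrev crd (c : M) : M → Coord n := extChartAt (𝓡∂ n) c

lemma isOpen_src (c : M) : IsOpen (src n c) := (chartAt (EuclideanHalfSpace n) c).open_source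

lemma mem_src_self (c : M) : c ∈ src n c := mem_chart_source _ c

lemma pt_mem_src {c : M} {y : Coord n} (hy : y ∈ dom c) : (pt c y : M) ∈ src n c := by
  have := (extChartAt (𝓡∂ n) c).map_target hy
  rwa [extChartAt_source] at this

lemma crd_mem_dom {c p : M} (hp : p ∈ src n c) : (crd c p : Coord n) ∈ dom c :=
  (extChartAt (𝓡∂ n) c).map_source (by rwa [extChartAt_source])

lemma pt_crd {c p : M} (hp : p ∈ src n c) : pt c (crd c p : Coord n) = p :=
  (extChartAt (𝓡∂ n) c).left_inv (by rwa [extChartAt_source])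

lemma crd_pt {c : M} {y : Coord n} (hy : y ∈ dom c) : crd c (pt c y) = y :=
  (extChartAt (𝓡∂ n) c).right_inv hy

lemma continuousOn_pt (c : M) : ContinuousOn (pt c : Coord n → M) (dom c) :=
  continuousOn_extChartAt_symm c

lemma continuousOn_crd (c : M) : ContinuousOn (crd c : M → Coord n) (src n c) := by
  have := continuousOn_extChartAt (I := 𝓡∂ n) c
  rwa [extChartAt_source] at this

/-- The components of a tangent vector in the chart around `c`. -/
def coords (c p : M) : TangentSpace (𝓡∂ n) p →L[ℝ] Coord n :=
  (trivializationAt (Coord n) (TangentSpace (𝓡∂ n)) c).continuousLinearMapAt ℝ p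

/-- The tangent vector with given components in the chart around `c`. -/
def vec (c p : M) : Coord n →L[ℝ] TangentSpace (𝓡∂ n) p :=
  (trivializationAt (Coord n) (TangentSpace (𝓡∂ n)) c).symmL ℝ p

lemma coords_vec {c p : M} (hp : p ∈ src n c) (a : Coord n) : coords c p (vec c p a) = a :=
  Bundle.Trivialization.continuousLinearMapAt_symmL _ hp a

lemma vec_coords {c p : M} (hp : p ∈ src n c) (v : TangentSpace (𝓡∂ n) p) :
    vec c p (coords c p v) = v :=
  Bundle.Trivialization.symmL_continuousLinearMapAt _ hp v

lemma frame_eq (c : M) (i : Fin n) (p : M) : frame c i p = vec c p (stdVec i) := rfl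

lemma coframe_eq (c : M) (i : Fin n) (p : M) (v : TangentSpace (𝓡∂ n) p) :
    coframe c i p v = coords c p v i := rfl

lemma stdVec_apply (i j : Fin n) : (stdVec i : Coord n) j = if j = i then 1 else 0 := by
  simp [stdVec]

lemma eq_sum_stdVec (v : Coord n) : v = ∑ j, v j • stdVec j := by
  ext i; simp [stdVec, Finset.sum_apply, Pi.single_apply]

lemma vec_eq_sum (c p : M) (a : Coord n) : vec c p a = ∑ i, a i • frame c i p := by
  conv_lhs => rw [eq_sum_stdVec a, map_sum]
  simp [frame_eq]

lemma coords_ext {c p : M} (hp : p ∈ src n c) {v w : TangentSpace (𝓡∂ n) p}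
    (h : coords c p v = coords c p w) : v = w := by
  rw [← vec_coords hp v, h, vec_coords hp]

/-- The coordinate representation of a vector field. -/
def vrep (c : M) (u : VField n M) (y : Coord n) : Coord n := coords c (pt c y) (u (pt c y))

lemma vcomp_eq (c : M) (u : VField n M) (i : Fin n) (y : Coord n) :
    vcomp c u i y = vrep c u y i := rfl

/-! ### Coordinate changes -/

/-- The coordinates in the chart around `c` of the points that also belong to the chart around
`d`. -/
def overlap (c d : M) : Set (Coord n) := dom c ∩ pt c ⁻¹' src n d

/-- The coordinate change from the chart around `c` to the one around `d`. -/
def trans (c d : M) (y : Coord n) : Coord n := crd d (pt c y)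

lemma overlap_eq (c d : M) : (overlap c d : Set (Coord n)) =
    ((extChartAt (𝓡∂ n) c).symm ≫ extChartAt (𝓡∂ n) d).source := by
  rw [PartialEquiv.trans_source, extChartAt_source]; rfl

lemma overlap_mem_nhdsWithin {c d : M} {y : Coord n} (hy : y ∈ overlap c d) :
    overlap c d ∈ 𝓝[HS n] y := by
  refine inter_mem (dom_mem_nhdsWithin hy.1) ?_
  rw [← nhdsWithin_dom_eq hy.1]
  exact (continuousOn_pt c y hy.1).preimage_mem_nhdsWithin ((isOpen_src d).mem_nhds hy.2)

lemma nhdsWithin_overlap_eq {c d : M} {y : Coord n} (hy : y ∈ overlap c d) :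
    𝓝[overlap c d] y = 𝓝[HS n] y :=
  le_antisymm (nhdsWithin_mono _ (inter_subset_left.trans (dom_subset_HS c)))
    (nhdsWithin_le_of_mem (overlap_mem_nhdsWithin hy))

lemma fderivWithin_overlap {F : Type*} [NormedAddCommGroup F] [NormedSpace ℝ F] {c d : M}
    {f : Coord n → F} {y : Coord n} (hy : y ∈ overlap c d) :
    fderivWithin ℝ f (overlap c d) y = fderivWithin ℝ f (HS n) y :=
  fderivWithin_congr_set (nhdsWithin_eq_iff_eventuallyEq.1 (nhdsWithin_overlap_eq hy))

lemma uniqueDiffOn_overlap (c d : M) : UniqueDiffOn ℝ (overlap c d : Set (Coord n)) := by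
  intro y hy
  rw [uniqueDiffWithinAt_congr (nhdsWithin_overlap_eq hy)]
  exact uniqueDiffOn_HS y (dom_subset_HS c hy.1)

lemma contDiffOn_trans (c d : M) : ContDiffOn ℝ ∞ (trans c d : Coord n → Coord n) (overlap c d) := by
  rw [overlap_eq]
  exact contDiffOn_ext_coord_change d c

lemma trans_mem_overlap {c d : M} {y : Coord n} (hy : y ∈ overlap c d) :
    (trans c d y : Coord n) ∈ overlap d c := by
  refine ⟨crd_mem_dom hy.2, ?_⟩
  simp only [mem_preimage, trans]
  rw [pt_crd hy.2]
  exact pt_mem_src hy.1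

lemma pt_trans {c d : M} {y : Coord n} (hy : y ∈ overlap c d) : pt d (trans c d y) = (pt c y : M) :=
  pt_crd hy.2

lemma trans_trans {c d : M} {y : Coord n} (hy : y ∈ overlap c d) :
    trans d c (trans c d y) = y := by
  rw [trans, pt_trans hy, crd_pt hy.1]

lemma crd_mem_overlap {c d p : M} (hp : p ∈ src n c) (hp' : p ∈ src n d) :
    (crd c p : Coord n) ∈ overlap c d :=
  ⟨crd_mem_dom hp, by rwa [mem_preimage, pt_crd hp]⟩

/-- The Jacobian of the coordinate change. -/
def jac (c d : M) (y : Coord n) : Coord n →L[ℝ] Coord n := fderivWithin ℝ (trans c d) (HS n) y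

lemma hasFDerivWithinAt_trans {c d : M} {y : Coord n} (hy : y ∈ overlap c d) :
    HasFDerivWithinAt (trans c d) (jac c d y) (overlap c d) y := by
  rw [jac, ← fderivWithin_overlap hy]
  exact ((contDiffOn_trans c d).differentiableOn (by simp) y hy).hasFDerivWithinAt

lemma contDiffOn_jac (c d : M) :
    ContDiffOn ℝ ∞ (jac c d : Coord n → Coord n →L[ℝ] Coord n) (overlap c d) :=
  ((contDiffOn_trans c d).fderivWithin (uniqueDiffOn_overlap c d) (m := ∞) (by simp)).congr
    fun _ hy => (fderivWithin_overlap hy).symm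

lemma coords_change {c d p : M} (hc : p ∈ src n c) (hd : p ∈ src n d)
    (v : TangentSpace (𝓡∂ n) p) : coords d p v = jac c d (crd c p) (coords c p v) := by
  have h1 : coords d p v = tangentCoordChange (𝓡∂ n) p d p v := by
    rw [coords, TangentBundle.continuousLinearMapAt_trivializationAt_eq_core hd]; rfl
  have h2 : coords c p v = tangentCoordChange (𝓡∂ n) p c p v := by
    rw [coords, TangentBundle.continuousLinearMapAt_trivializationAt_eq_core hc]; rfl
  rw [h1, h2]
  -- The cocycle identity through the preferred chart at `p`, in which the fibre over `p` is
  -- modelled.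
  refine (tangentCoordChange_comp (I := 𝓡∂ n) (w := p) (x := c) (y := d) (z := p) (v := v) ?_).symm
  simp only [extChartAt_source]
  exact ⟨⟨mem_src_self p, hc⟩, hd⟩

lemma vrep_trans {c d : M} {y : Coord n} (hy : y ∈ overlap c d) (u : VField n M) :
    vrep d u (trans c d y) = jac c d y (vrep c u y) := by
  rw [vrep, pt_trans hy, coords_change (pt_mem_src hy.1) hy.2, crd_pt hy.1]; rfl

/-! ### Smoothness in coordinates -/

lemma contDiffOn_dom_of_contMDiffOn {F : Type*} [NormedAddCommGroup F] [NormedSpace ℝ F] {c : M}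
    {f : M → F} (hf : ContMDiffOn (𝓡∂ n) 𝓘(ℝ, F) ∞ f (src n c)) :
    ContDiffOn ℝ ∞ (fun y : Coord n => f (pt c y)) (dom c) := by
  rw [← contMDiffOn_iff_contDiffOn]
  exact hf.comp (contMDiffOn_extChartAt_symm (I := 𝓡∂ n) c) fun y hy => pt_mem_src hy

lemma contMDiffOn_src_of_contDiffOn {F : Type*} [NormedAddCommGroup F] [NormedSpace ℝ F] {c : M}
    {f : M → F} (hf : ContDiffOn ℝ ∞ (fun y : Coord n => f (pt c y)) (dom c)) :
    ContMDiffOn (𝓡∂ n) 𝓘(ℝ, F) ∞ f (src n c) := by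
  rw [← contMDiffOn_iff_contDiffOn] at hf
  refine (hf.comp (contMDiffOn_extChartAt (I := 𝓡∂ n) (x := c)) fun p hp => crd_mem_dom hp).congr
    fun p hp => ?_
  simp only [Function.comp]
  rw [show pt c (extChartAt (𝓡∂ n) c p) = p from pt_crd hp]

lemma contMDiffOn_section_iff {c : M} {u : VField n M} :
    ContMDiffOn (𝓡∂ n) (𝓡∂ n).tangent ∞ (fun x => (⟨x, u x⟩ : TangentBundle (𝓡∂ n) M)) (src n c) ↔
      ContMDiffOn (𝓡∂ n) 𝓘(ℝ, Coord n) ∞ (fun p => coords c p (u p)) (src n c) := by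
  have h := Bundle.Trivialization.contMDiffOn_section_baseSet_iff (n := ∞) (IB := 𝓡∂ n) (s := u)
    (trivializationAt (Coord n) (TangentSpace (𝓡∂ n)) c)
  refine h.trans (contMDiffOn_congr fun p hp => ?_)
  rw [coords, Bundle.Trivialization.continuousLinearMapAt_apply,
    Bundle.Trivialization.linearMapAt_apply, if_pos hp]

lemma IsSmooth.contDiffOn_vrep {u : VField n M} (hu : IsSmooth u) (c : M) :
    ContDiffOn ℝ ∞ (vrep c u) (dom c) :=
  contDiffOn_dom_of_contMDiffOn (f := fun p => coords c p (u p))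
    (contMDiffOn_section_iff.1 hu.contMDiffOn)

lemma contDiffOn_coord_iff {f : Coord n → Coord n} {m : WithTop ℕ∞} {s : Set (Coord n)} :
    ContDiffOn ℝ m f s ↔ ∀ i, ContDiffOn ℝ m (fun y => f y i) s :=
  contDiffOn_piLp _

lemma IsSmooth.contDiffOn_vcomp {u : VField n M} (hu : IsSmooth u) (c : M) (i : Fin n) :
    ContDiffOn ℝ ∞ (vcomp c u i) (dom c) := contDiffOn_coord_iff.1 (hu.contDiffOn_vrep c) i

lemma isSmooth_of_contDiffOn_vrep {u : VField n M}
    (hu : ∀ c : M, ContDiffOn ℝ ∞ (vrep c u) (dom c)) : IsSmooth u := fun x =>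
  (contMDiffOn_section_iff.2 (contMDiffOn_src_of_contDiffOn (c := x)
    (f := fun p => coords x p (u p)) (hu x))).contMDiffAt ((isOpen_src x).mem_nhds (mem_src_self x))

lemma contMDiffOn_frame (c : M) (i : Fin n) :
    ContMDiffOn (𝓡∂ n) (𝓡∂ n).tangent ∞
      (fun x => (⟨x, frame c i x⟩ : TangentBundle (𝓡∂ n) M)) (src n c) := by
  rw [contMDiffOn_section_iff]
  exact contMDiffOn_const.congr fun p hp => coords_vec hp (stdVec i)

lemma contDiffOn_gram (g : Metric n M) (c : M) (i j : Fin n) :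
    ContDiffOn ℝ ∞ (fun y => gram g c y i j) (dom c) := by
  refine contDiffOn_dom_of_contMDiffOn (f := fun p => g.inner p (frame c i p) (frame c j p)) ?_
  have h := ContMDiffOn.clm_bundle_apply₂ (s := src n c) (n := ∞) (IM := 𝓡∂ n) (F₁ := Coord n) (F₂ := Coord n)
    (F₃ := ℝ) (E₁ := fun x : M => TangentSpace (𝓡∂ n) x) (E₂ := fun x : M => TangentSpace (𝓡∂ n) x)
    (E₃ := Bundle.Trivial M ℝ) (b := fun x : M => x)
    (ψ := fun x => g.inner x) g.contMDiff.contMDiffOn (contMDiffOn_frame c i) (contMDiffOn_frame c j)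
  exact fun p hp => (Bundle.contMDiffWithinAt_section.1 (h p hp))

end Manifold

section Manifold

variable {n : ℕ} [NeZero n] {M : Type*} [TopologicalSpace M]
  [ChartedSpace (EuclideanHalfSpace n) M] [IsManifold (𝓡∂ n) ∞ M]

/-! ### The metric in coordinates -/

/-- The metric in the chart around `c`, as a bilinear form on `ℝⁿ`. -/
def gramForm (g : Metric n M) (c : M) (y : Coord n) : Coord n →L[ℝ] Coord n →L[ℝ] ℝ :=
  ∑ i, ∑ j, gram g c y i j •
    (EuclideanSpace.proj i : Coord n →L[ℝ] ℝ).smulRight (EuclideanSpace.proj j : Coord n →L[ℝ] ℝ)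

lemma gramForm_apply (g : Metric n M) (c : M) (y a b : Coord n) :
    gramForm g c y a b = ∑ i, ∑ j, gram g c y i j * a i * b j := by
  simp [gramForm, mul_assoc]

lemma gramForm_eq_inner (g : Metric n M) (c : M) (y a b : Coord n) :
    gramForm g c y a b = g.inner (pt c y) (vec c (pt c y) a) (vec c (pt c y) b) := by
  rw [gramForm_apply, vec_eq_sum, vec_eq_sum, map_sum]
  simp only [map_smul, _root_.sum_apply, _root_.smul_apply, map_sum, smul_eq_mul, Finset.mul_sum]
  rw [Finset.sum_comm]
  refine Finset.sum_congr rfl fun i _ => Finset.sum_congr rfl fun j _ => ?_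
  rw [gram, Matrix.of_apply]
  ring

lemma inner_eq_gramForm (g : Metric n M) {c p : M} (hp : p ∈ src n c)
    (v w : TangentSpace (𝓡∂ n) p) :
    g.inner p v w = gramForm g c (crd c p) (coords c p v) (coords c p w) := by
  rw [gramForm_eq_inner, pt_crd hp, vec_coords hp, vec_coords hp]

lemma gramForm_stdVec (g : Metric n M) (c : M) (y : Coord n) (i j : Fin n) :
    gramForm g c y (stdVec i) (stdVec j) = gram g c y i j := by
  rw [gramForm_eq_inner]; rfl

lemma gramForm_symm (g : Metric n M) (c : M) (y a b : Coord n) :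
    gramForm g c y a b = gramForm g c y b a := by
  rw [gramForm_eq_inner, gramForm_eq_inner, g.symm]

lemma gramForm_pos (g : Metric n M) {c : M} {y : Coord n} (hy : y ∈ dom c) {a : Coord n}
    (ha : a ≠ 0) : 0 < gramForm g c y a a := by
  rw [gramForm_eq_inner]
  refine g.pos _ _ fun h => ha ?_
  rw [← coords_vec (pt_mem_src hy) a, h, map_zero]

lemma gram_symm (g : Metric n M) (c : M) (y : Coord n) (i j : Fin n) :
    gram g c y i j = gram g c y j i := by
  rw [← gramForm_stdVec, gramForm_symm, gramForm_stdVec]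

lemma gram_posDef (g : Metric n M) {c : M} {y : Coord n} (hy : y ∈ dom c) :
    (gram g c y).PosDef := by
  refine Matrix.PosDef.of_dotProduct_mulVec_pos ?_ fun x hx => ?_
  · ext i j
    simp [Matrix.conjTranspose_apply, gram_symm g c y i j]
  · have h := gramForm_pos g hy (a := WithLp.toLp 2 x) (fun h => hx (by simpa using h))
    rw [gramForm_apply] at h
    refine h.trans_eq ?_
    simp only [dotProduct, Matrix.mulVec, Finset.mul_sum]
    refine Finset.sum_congr rfl fun i _ => Finset.sum_congr rfl fun j _ => by
      simp; ring

lemma gram_det_pos (g : Metric n M) {c : M} {y : Coord n} (hy : y ∈ dom c) :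
    0 < (gram g c y).det := (gram_posDef g hy).det_pos

lemma sum_gram_mul_inv (g : Metric n M) {c : M} {y : Coord n} (hy : y ∈ dom c) (i k : Fin n) :
    ∑ j, gram g c y i j * (gram g c y)⁻¹ j k = if i = k then 1 else 0 := by
  rw [← Matrix.mul_apply, Matrix.mul_nonsing_inv _ (gram_det_pos g hy).ne'.isUnit,
    Matrix.one_apply]

lemma sum_inv_mul_gram (g : Metric n M) {c : M} {y : Coord n} (hy : y ∈ dom c) (i k : Fin n) :
    ∑ j, (gram g c y)⁻¹ i j * gram g c y j k = if i = k then 1 else 0 := by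
  rw [← Matrix.mul_apply, Matrix.nonsing_inv_mul _ (gram_det_pos g hy).ne'.isUnit,
    Matrix.one_apply]

lemma contDiffOn_gramForm (g : Metric n M) (c : M) : ContDiffOn ℝ ∞ (gramForm g c) (dom c) := by
  refine contDiffOn_clm_apply.2 fun a => contDiffOn_clm_apply.2 fun b => ?_
  simp_rw [gramForm_apply]
  exact ContDiffOn.sum fun i _ => ContDiffOn.sum fun j _ =>
    ((contDiffOn_gram g c i j).mul contDiffOn_const).mul contDiffOn_const

lemma contDiffOn_gram_det (g : Metric n M) (c : M) :
    ContDiffOn ℝ ∞ (fun y => (gram g c y).det) (dom c) := by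
  simp_rw [Matrix.det_apply']
  exact ContDiffOn.sum fun σ _ => contDiffOn_const.mul
    (contDiffOn_prod fun i _ => contDiffOn_gram g c _ _)

/-- Cramer's rule: an entry of the inverse is a quotient of polynomials in the `gᵢⱼ`, with
nonvanishing denominator. -/
lemma contDiffOn_gram_inv (g : Metric n M) (c : M) (i j : Fin n) :
    ContDiffOn ℝ ∞ (fun y => (gram g c y)⁻¹ i j) (dom c) := by
  have h : ∀ y ∈ dom c, (gram g c y)⁻¹ i j =
      ((gram g c y).det)⁻¹ * ((gram g c y).updateRow j (Pi.single i 1)).det := by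
    intro y _
    rw [Matrix.inv_def, Matrix.smul_apply, Matrix.adjugate_apply, Ring.inverse_eq_inv', smul_eq_mul]
  refine ContDiffOn.congr (f := fun y => ((gram g c y).det)⁻¹ *
    ((gram g c y).updateRow j (Pi.single i 1)).det) ?_ h
  refine ((contDiffOn_gram_det g c).inv fun y hy => (gram_det_pos g hy).ne').mul ?_
  simp_rw [Matrix.det_apply']
  refine ContDiffOn.sum fun σ _ => contDiffOn_const.mul (contDiffOn_prod fun k _ => ?_)
  by_cases hk : σ k = j
  · simp only [hk, Matrix.updateRow_self]; exact contDiffOn_const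
  · simp only [Matrix.updateRow_ne hk]; exact contDiffOn_gram g c _ _

lemma contDiffOn_partialH {c : M} {f : Coord n → ℝ} (hf : ContDiffOn ℝ ∞ f (dom c)) (j : Fin n) :
    ContDiffOn ℝ ∞ (partialH j f) (dom c) := by
  refine ContDiffOn.congr (f := fun y => fderivWithin ℝ f (dom c) y (stdVec j))
    ((hf.fderivWithin (uniqueDiffOn_dom c) (by simp)).clm_apply contDiffOn_const) fun y hy => ?_
  rw [fderivWithin_dom hy]; rfl

lemma contDiffOn_christoffel (g : Metric n M) (c : M) (i j k : Fin n) :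
    ContDiffOn ℝ ∞ (christoffel g c i j k) (dom c) := by
  refine contDiffOn_const.mul (ContDiffOn.sum fun l _ => (contDiffOn_gram_inv g c i l).mul ?_)
  exact ((contDiffOn_partialH (contDiffOn_gram g c k l) j).add
    (contDiffOn_partialH (contDiffOn_gram g c j l) k)).sub
    (contDiffOn_partialH (contDiffOn_gram g c j k) l)

lemma partialH_eq_fderiv {f : Coord n → ℝ} {y : Coord n} (hy : y ∈ interior (HS n)) (j : Fin n) :
    partialH j f y = fderiv ℝ f y (stdVec j) := by
  rw [partialH, fderivWithin_of_mem_nhds (mem_interior_iff_mem_nhds.1 hy)]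

lemma jac_gramForm (g : Metric n M) {c d : M} {y : Coord n} (hy : y ∈ overlap c d) (a b : Coord n) :
    gramForm g d (trans c d y) (jac c d y a) (jac c d y b) = gramForm g c y a b := by
  have h1 : ∀ a, jac c d y a = coords d (pt c y) (vec c (pt c y) a) := fun a => by
    rw [coords_change (pt_mem_src hy.1) hy.2, coords_vec (pt_mem_src hy.1), crd_pt hy.1]
  rw [h1, h1, trans, ← inner_eq_gramForm g hy.2, gramForm_eq_inner]

/-! ### The Levi-Civita derivative in coordinates -/

lemma hasFDerivWithinAt_clm_comp {E F : Type*} [NormedAddCommGroup E] [NormedSpace ℝ E]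
    [NormedAddCommGroup F] [NormedSpace ℝ F] {S T : Set E} {y : E} {τ : E → E} {J : E →L[ℝ] E}
    (h : HasFDerivWithinAt τ J S y) (hST : MapsTo τ S T) {G : E → E →L[ℝ] F}
    {G' : E →L[ℝ] E →L[ℝ] F} (hG : HasFDerivWithinAt G G' T (τ y)) :
    HasFDerivWithinAt (fun z => G (τ z)) (G' ∘L J) S y :=
  hG.comp y h hST

/-- Twice the covariant derivative in terms of Koszul's formula. -/
def koszul {E : Type*} [NormedAddCommGroup E] [NormedSpace ℝ E] (G : E →L[ℝ] E →L[ℝ] ℝ)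
    (G' : E →L[ℝ] E →L[ℝ] E →L[ℝ] ℝ) (v : E) (v' : E →L[ℝ] E) (a b : E) : ℝ :=
  2 * G (v' a) b + G' a v b + G' v a b - G' b a v

/-- Differentiating the transformation laws of the field and of the metric produces terms with the
second derivative `J'` of the coordinate change. In the Koszul combination they cancel, by the
symmetry of `J'` and of `G₂`. Derivatives are taken within sets, so boundary points are included. -/
lemma koszul_transform {E : Type*} [NormedAddCommGroup E] [NormedSpace ℝ E] {S T : Set E} {y : E}
    (hy : y ∈ S) (hS : UniqueDiffWithinAt ℝ S y) {τ : E → E} (hST : MapsTo τ S T)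
    {J : E → E →L[ℝ] E} {J' : E →L[ℝ] E →L[ℝ] E} (hτ : HasFDerivWithinAt τ (J y) S y)
    (hJ : HasFDerivWithinAt J J' S y) (hsym : ∀ a b, J' a b = J' b a)
    {G₁ G₂ : E → E →L[ℝ] E →L[ℝ] ℝ} {G₁' G₂' : E →L[ℝ] E →L[ℝ] E →L[ℝ] ℝ}
    (hG₁ : HasFDerivWithinAt G₁ G₁' S y) (hG₂ : HasFDerivWithinAt G₂ G₂' T (τ y))
    (hGsym : ∀ a b, G₂ (τ y) a b = G₂ (τ y) b a)
    {v₁ v₂ : E → E} {v₁' v₂' : E →L[ℝ] E} (hv₁ : HasFDerivWithinAt v₁ v₁' S y)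
    (hv₂ : HasFDerivWithinAt v₂ v₂' T (τ y))
    (hv : ∀ z ∈ S, v₂ (τ z) = J z (v₁ z))
    (hG : ∀ z ∈ S, ∀ a b, G₁ z a b = G₂ (τ z) (J z a) (J z b)) (a b : E) :
    koszul (G₁ y) G₁' (v₁ y) v₁' a b =
      koszul (G₂ (τ y)) G₂' (v₂ (τ y)) v₂' (J y a) (J y b) := by
  -- The transformation law of the field, differentiated in the direction `h`.
  have e1 : ∀ h, v₂' (J y h) = J' h (v₁ y) + J y (v₁' h) := by
    have h1 := (hv₂.comp y hτ hST).congr (f₁ := fun z => J z (v₁ z))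
      (fun z hz => (hv z hz).symm) (hv y hy).symm
    have h2 := hJ.clm_apply hv₁
    intro h
    have h3 := DFunLike.congr_fun (hS.eq h1 h2) h
    simp at h3
    rw [h3]; abel
  -- The transformation law of the metric, differentiated in the direction `h` for fixed arguments.
  have e2 : ∀ h a b, G₁' h a b = G₂' (J y h) (J y a) (J y b) + G₂ (τ y) (J' h a) (J y b)
      + G₂ (τ y) (J y a) (J' h b) := by
    intro h a b
    have hc : ∀ c : E, HasFDerivWithinAt (fun z => J z c) (J'.flip c) S y := fun c => by
      simpa using hJ.clm_apply (hasFDerivWithinAt_const c y S)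
    have h0 : HasFDerivWithinAt (fun z => G₂ (τ z)) (G₂' ∘L J y) S y :=
      hasFDerivWithinAt_clm_comp hτ hST hG₂
    have h1 := (h0.clm_apply (hc a)).clm_apply (hc b)
    have h2 := (hG₁.clm_apply (hasFDerivWithinAt_const a y S)).clm_apply
      (hasFDerivWithinAt_const b y S)
    have h3 := DFunLike.congr_fun (hS.eq h2 (h1.congr (fun z hz => hG z hz a b) (hG y hy a b))) h
    simp at h3
    rw [h3]; ring
  have e3 : G₂ (τ y) (J y (v₁' a)) (J y b) = G₂ (τ y) (v₂' (J y a)) (J y b)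
      - G₂ (τ y) (J' a (v₁ y)) (J y b) := by
    rw [e1]; simp
  simp only [koszul]
  rw [hG y hy, e2, e2, e2, e3, hv y hy, hsym (v₁ y) a, hsym (v₁ y) b, hsym b a,
    hGsym (J y (v₁ y)) (J' a b), hGsym (J y a) (J' b (v₁ y))]
  ring

end Manifold

/-! ### The covariant derivative in coordinates and its independence of the chart -/

section Manifold

variable {n : ℕ} [NeZero n] {M : Type*} [TopologicalSpace M]
  [ChartedSpace (EuclideanHalfSpace n) M] [IsManifold (𝓡∂ n) ∞ M]

/-- Koszul's formula as a bilinear form. -/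
def koszulBilin {E : Type*} [NormedAddCommGroup E] [NormedSpace ℝ E] (G : E →L[ℝ] E →L[ℝ] ℝ)
    (G' : E →L[ℝ] E →L[ℝ] E →L[ℝ] ℝ) (v : E) (v' : E →L[ℝ] E) : E →ₗ[ℝ] E →ₗ[ℝ] ℝ :=
  LinearMap.mk₂ ℝ (koszul G G' v v')
    (fun _ _ _ => by simp [koszul]; ring) (fun _ _ _ => by simp [koszul]; ring)
    (fun _ _ _ => by simp [koszul]; ring) (fun _ _ _ => by simp [koszul]; ring)

lemma bilin_eq_sum (B : Coord n →ₗ[ℝ] Coord n →ₗ[ℝ] ℝ) (a b : Coord n) :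
    B a b = ∑ j, ∑ l, a j * b l * B (stdVec j) (stdVec l) := by
  conv_lhs => rw [eq_sum_stdVec a, eq_sum_stdVec b]
  simp only [map_sum, map_smul, LinearMap.sum_apply, LinearMap.smul_apply, smul_eq_mul,
    Finset.mul_sum]
  rw [Finset.sum_comm]
  exact Finset.sum_congr rfl fun j _ => Finset.sum_congr rfl fun l _ => by ring

/-- The components `∂ⱼ uⁱ + Γⁱⱼₖ uᵏ` of the covariant derivative in the chart around `c`. -/
def ncomp (g : Metric n M) (c : M) (u : VField n M) (i j : Fin n) (y : Coord n) : ℝ :=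
  partialH j (vcomp c u i) y + ∑ k, christoffel g c i j k y * vcomp c u k y

/-- The `(1,1)`-tensor at `p` with given components in the chart around `c`. -/
def tensorOf (c p : M) (N : Fin n → Fin n → ℝ) :
    TangentSpace (𝓡∂ n) p →ₗ[ℝ] TangentSpace (𝓡∂ n) p :=
  ∑ i, ∑ j, N i j • (coframe c j p).smulRight (frame c i p)

lemma coords_tensorOf {c p : M} (hp : p ∈ src n c) (N : Fin n → Fin n → ℝ)
    (w : TangentSpace (𝓡∂ n) p) (i : Fin n) :
    coords c p (tensorOf c p N w) i = ∑ j, N i j * coords c p w j := by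
  have h : tensorOf c p N w = vec c p (WithLp.toLp 2 fun i => ∑ j, N i j * coords c p w j) := by
    rw [vec_eq_sum, tensorOf]
    simp only [LinearMap.sum_apply, LinearMap.smul_apply, LinearMap.smulRight_apply, coframe_eq,
      smul_smul, Finset.sum_smul]
  rw [h, coords_vec hp]

lemma covDeriv_eq (g : Metric n M) (u : VField n M) (x : M) :
    covDeriv g u x = tensorOf x x fun i j => ncomp g x u i j (crd x x) := rfl

/-- Koszul's formula for the field `u` in the chart around `c`. -/
def koszulAt (g : Metric n M) (c : M) (u : VField n M) (y a b : Coord n) : ℝ :=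
  koszul (gramForm g c y) (fderivWithin ℝ (gramForm g c) (HS n) y) (vrep c u y)
    (fderivWithin ℝ (vrep c u) (HS n) y) a b

lemma hasFDerivWithinAt_dom {F : Type*} [NormedAddCommGroup F] [NormedSpace ℝ F] {c : M}
    {f : Coord n → F} (hf : ContDiffOn ℝ ∞ f (dom c)) {y : Coord n} (hy : y ∈ dom c) :
    HasFDerivWithinAt f (fderivWithin ℝ f (HS n) y) (dom c) y := by
  rw [← fderivWithin_dom hy]
  exact (hf.differentiableOn (by simp) y hy).hasFDerivWithinAt

lemma hasFDerivWithinAt_HS {F : Type*} [NormedAddCommGroup F] [NormedSpace ℝ F] {c : M}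
    {f : Coord n → F} (hf : ContDiffOn ℝ ∞ f (dom c)) {y : Coord n} (hy : y ∈ dom c) :
    HasFDerivWithinAt f (fderivWithin ℝ f (HS n) y) (HS n) y :=
  (hasFDerivWithinAt_dom hf hy).mono_of_mem_nhdsWithin (dom_mem_nhdsWithin hy)

lemma fderivWithin_vrep_apply {c : M} {u : VField n M} (hu : ContDiffOn ℝ ∞ (vrep c u) (dom c))
    {y : Coord n} (hy : y ∈ dom c) (h : Coord n) (i : Fin n) :
    fderivWithin ℝ (vrep c u) (HS n) y h i = fderivWithin ℝ (vcomp c u i) (HS n) y h := by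
  have h1 := ((EuclideanSpace.proj i : Coord n →L[ℝ] ℝ).hasFDerivAt).comp_hasFDerivWithinAt y
    (hasFDerivWithinAt_HS hu hy)
  have h2 := h1.fderivWithin (uniqueDiffOn_HS y (dom_subset_HS c hy))
  rw [show vcomp c u i = (EuclideanSpace.proj i : Coord n →L[ℝ] ℝ) ∘ vrep c u from rfl, h2]
  rfl

lemma fderivWithin_gramForm_apply (g : Metric n M) {c : M}
    {y : Coord n} (hy : y ∈ dom c) (h : Coord n) (i j : Fin n) :
    fderivWithin ℝ (gramForm g c) (HS n) y h (stdVec i) (stdVec j) =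
      fderivWithin ℝ (fun z => gram g c z i j) (HS n) y h := by
  have h1 := ((hasFDerivWithinAt_HS (contDiffOn_gramForm g c) hy).clm_apply
    (hasFDerivWithinAt_const (stdVec i) y (HS n))).clm_apply
    (hasFDerivWithinAt_const (stdVec j) y (HS n))
  have h2 := h1.fderivWithin (uniqueDiffOn_HS y (dom_subset_HS c hy))
  simp_rw [gramForm_stdVec] at h2
  rw [h2]
  simp

lemma partialH_def (j : Fin n) (f : Coord n → ℝ) (y : Coord n) :
    partialH j f y = fderivWithin ℝ f (HS n) y (stdVec j) := rfl

/-- Lowering the upper index of `∂ⱼ uⁱ + Γⁱⱼₖ uᵏ` cancels the inverse metric in the Christoffel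
symbols, which leaves exactly the three metric derivatives of Koszul's formula. -/
lemma koszulAt_stdVec (g : Metric n M) {c : M} {u : VField n M}
    (hu : ContDiffOn ℝ ∞ (vrep c u) (dom c)) {y : Coord n} (hy : y ∈ dom c) (j l : Fin n) :
    koszulAt g c u y (stdVec j) (stdVec l) = 2 * ∑ i, gram g c y l i * ncomp g c u i j y := by
  have e0 : ∀ a b : Coord n, ∀ B : Coord n →L[ℝ] Coord n →L[ℝ] ℝ, B a b =
      ∑ p, ∑ q, a p * b q * B (stdVec p) (stdVec q) := fun a b B =>
    bilin_eq_sum (LinearMap.mk₂ ℝ (fun a b => B a b) (by simp) (by simp) (by simp) (by simp)) a b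
  have e1 : gramForm g c y (fderivWithin ℝ (vrep c u) (HS n) y (stdVec j)) (stdVec l) =
      ∑ i, gram g c y l i * partialH j (vcomp c u i) y := by
    rw [gramForm_apply]
    refine Finset.sum_congr rfl fun i _ => ?_
    rw [fderivWithin_vrep_apply hu hy, gram_symm g c y l i]
    simp [stdVec_apply, ← partialH_def]
  have e2 : ∀ p q, fderivWithin ℝ (gramForm g c) (HS n) y (stdVec p) (vrep c u y) (stdVec q) =
      ∑ k, partialH p (fun z => gram g c z k q) y * vcomp c u k y := by
    intro p q
    rw [e0]
    refine Finset.sum_congr rfl fun k _ => ?_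
    simp only [stdVec_apply, fderivWithin_gramForm_apply g hy, ← partialH_def]
    simp [vcomp_eq, mul_comm]
  have e3 : fderivWithin ℝ (gramForm g c) (HS n) y (vrep c u y) (stdVec j) (stdVec l) =
      ∑ k, partialH k (fun z => gram g c z j l) y * vcomp c u k y := by
    rw [fderivWithin_gramForm_apply g hy]
    conv_lhs => rw [eq_sum_stdVec (vrep c u y), map_sum]
    refine Finset.sum_congr rfl fun k _ => ?_
    simp [← partialH_def, vcomp_eq, mul_comm]
  have e4 : fderivWithin ℝ (gramForm g c) (HS n) y (stdVec l) (stdVec j) (vrep c u y) =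
      ∑ k, partialH l (fun z => gram g c z j k) y * vcomp c u k y := by
    rw [e0, Finset.sum_comm]
    refine Finset.sum_congr rfl fun k _ => ?_
    simp only [stdVec_apply, fderivWithin_gramForm_apply g hy, ← partialH_def]
    simp [vcomp_eq, mul_comm]
  have e5 : ∀ k, 2 * ∑ i, gram g c y l i * christoffel g c i j k y =
      partialH j (fun z => gram g c z k l) y + partialH k (fun z => gram g c z j l) y
        - partialH l (fun z => gram g c z j k) y := by
    intro k
    set R : Fin n → ℝ := fun m => partialH j (fun z => gram g c z k m) y +
      partialH k (fun z => gram g c z j m) y - partialH m (fun z => gram g c z j k) y with hR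
    have : ∀ i, gram g c y l i * christoffel g c i j k y =
        ∑ m, (1 / 2) * (gram g c y l i * (gram g c y)⁻¹ i m) * R m := by
      intro i
      rw [christoffel, Finset.mul_sum, Finset.mul_sum]
      exact Finset.sum_congr rfl fun m _ => by ring
    simp_rw [this]
    rw [Finset.sum_comm]
    simp_rw [← Finset.sum_mul, ← Finset.mul_sum, sum_gram_mul_inv g hy]
    simp [hR]
  have e6 : ∑ i, gram g c y l i * ncomp g c u i j y =
      ∑ i, gram g c y l i * partialH j (vcomp c u i) y +
        ∑ k, (∑ i, gram g c y l i * christoffel g c i j k y) * vcomp c u k y := by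
    simp only [ncomp, mul_add, Finset.sum_add_distrib, Finset.mul_sum, Finset.sum_mul]
    congr 1
    rw [Finset.sum_comm]
    exact Finset.sum_congr rfl fun k _ => Finset.sum_congr rfl fun i _ => by ring
  have e7 : 2 * ∑ k, (∑ i, gram g c y l i * christoffel g c i j k y) * vcomp c u k y =
      ∑ k, partialH j (fun z => gram g c z k l) y * vcomp c u k y +
        ∑ k, partialH k (fun z => gram g c z j l) y * vcomp c u k y -
          ∑ k, partialH l (fun z => gram g c z j k) y * vcomp c u k y := by
    rw [Finset.mul_sum, ← Finset.sum_add_distrib, ← Finset.sum_sub_distrib]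
    refine Finset.sum_congr rfl fun k _ => ?_
    rw [← mul_assoc, e5]
    ring
  rw [koszulAt, koszul, e1, e2, e3, e4, e6, mul_add, e7]
  ring

lemma inner_tensorOf_ncomp (g : Metric n M) {c : M} {u : VField n M}
    (hu : ContDiffOn ℝ ∞ (vrep c u) (dom c)) {p : M} (hp : p ∈ src n c)
    (w z : TangentSpace (𝓡∂ n) p) :
    2 * g.inner p (tensorOf c p (fun i j => ncomp g c u i j (crd c p)) w) z =
      koszulAt g c u (crd c p) (coords c p w) (coords c p z) := by
  have hy : (crd c p : Coord n) ∈ dom c := crd_mem_dom hp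
  have h1 : koszulAt g c u (crd c p) (coords c p w) (coords c p z) = ∑ j, ∑ l,
      coords c p w j * coords c p z l * koszulAt g c u (crd c p) (stdVec j) (stdVec l) :=
    bilin_eq_sum (koszulBilin _ _ _ _) _ _
  rw [h1, inner_eq_gramForm g hp, gramForm_symm, gramForm_apply]
  simp_rw [koszulAt_stdVec g hu hy, coords_tensorOf hp]
  rw [Finset.sum_comm (f := fun j l => _ * (2 * _))]
  simp_rw [Finset.mul_sum]
  refine Finset.sum_congr rfl fun l _ => ?_
  rw [Finset.sum_comm]
  exact Finset.sum_congr rfl fun j _ => Finset.sum_congr rfl fun i _ => by ring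

/-- Boundary points of an overlap are limits of its interior points. This gives symmetry of second
derivatives of a coordinate change at the boundary, and lets identities valid almost everywhere pass
to all points by continuity. -/
lemma overlap_subset_closure (c d : M) :
    (overlap c d : Set (Coord n)) ⊆ closure (interior (overlap c d)) := by
  intro y hy
  obtain ⟨O, hO, hOe⟩ := mem_nhdsWithin.1 (overlap_mem_nhdsWithin hy)
  have h1 : O ∩ interior (HS n) ⊆ interior (overlap c d) :=
    interior_maximal (fun z hz => hOe.2 ⟨hz.1, interior_subset hz.2⟩) (hO.inter isOpen_interior)
  refine closure_mono h1 (hO.inter_closure ⟨hOe.1, ?_⟩)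
  rw [closure_interior_HS]
  exact dom_subset_HS c hy.1

lemma koszulAt_trans (g : Metric n M) {u : VField n M} (hu : IsSmooth u) {c d : M} {y : Coord n}
    (hy : y ∈ overlap c d) (a b : Coord n) :
    koszulAt g c u y a b = koszulAt g d u (trans c d y) (jac c d y a) (jac c d y b) := by
  have hτ := trans_mem_overlap hy
  refine koszul_transform (S := overlap c d) (T := dom d) hy (uniqueDiffOn_overlap c d y hy)
    (τ := trans c d) (fun z hz => (trans_mem_overlap hz).1) (J := jac c d)
    (J' := fderivWithin ℝ (jac c d) (overlap c d) y) (hasFDerivWithinAt_trans hy)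
    (((contDiffOn_jac c d).differentiableOn (by simp) y hy).hasFDerivWithinAt) ?_
    ((hasFDerivWithinAt_dom (contDiffOn_gramForm g c) hy.1).mono inter_subset_left)
    (hasFDerivWithinAt_dom (contDiffOn_gramForm g d) hτ.1)
    (gramForm_symm g d _)
    ((hasFDerivWithinAt_dom (hu.contDiffOn_vrep c) hy.1).mono inter_subset_left)
    (hasFDerivWithinAt_dom (hu.contDiffOn_vrep d) hτ.1)
    (fun z hz => vrep_trans hz u) (fun z hz a b => (jac_gramForm g hz a b).symm) a b
  intro a b
  have hcl := overlap_subset_closure c d hy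
  have := ((contDiffOn_infty.1 (contDiffOn_trans c d) 2).contDiffWithinAt hy).isSymmSndFDerivWithinAt
    (by simp) (uniqueDiffOn_overlap c d) hcl hy
  have hs := this a b
  rwa [fderivWithin_congr (f₁ := fderivWithin ℝ (trans c d) (overlap c d)) (f := jac c d)
    (fun z hz => fderivWithin_overlap hz) (fderivWithin_overlap hy)] at hs

/-- Both tensors have the same inner products with all vectors, since these are given by Koszul's
formula, which is invariant under coordinate changes; the metric is definite, so they coincide. This
permits working in one fixed chart although `covDeriv` changes the chart from point to point. -/
lemma covDeriv_eq_tensorOf (g : Metric n M) {u : VField n M} (hu : IsSmooth u) {c p : M}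
    (hp : p ∈ src n c) :
    covDeriv g u p = tensorOf c p fun i j => ncomp g c u i j (crd c p) := by
  ext w
  refine sub_eq_zero.1 ?_
  by_contra hne
  have hpos := g.pos p _ hne
  have h1 := inner_tensorOf_ncomp g (hu.contDiffOn_vrep c) hp w
  have h2 := inner_tensorOf_ncomp g (hu.contDiffOn_vrep p) (mem_src_self p) w
  have hov := crd_mem_overlap hp (mem_src_self p)
  have h3 : ∀ z, g.inner p (covDeriv g u p w - tensorOf c p (fun i j => ncomp g c u i j (crd c p)) w) z
      = 0 := by
    intro z
    have h4 := koszulAt_trans g hu hov (coords c p w) (coords c p z)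
    rw [← coords_change hp (mem_src_self p), ← coords_change hp (mem_src_self p), trans, pt_crd hp,
      ← h1, ← h2] at h4
    rw [map_sub, _root_.sub_apply, covDeriv_eq]
    linarith
  exact hpos.ne' (h3 _)

lemma tcomp_covDeriv (g : Metric n M) {u : VField n M} (hu : IsSmooth u) {c : M} {y : Coord n}
    (hy : y ∈ dom c) (i j : Fin n) : tcomp c (covDeriv g u) i j y = ncomp g c u i j y := by
  rw [tcomp, covDeriv_eq_tensorOf g hu (pt_mem_src hy), coframe_eq, coords_tensorOf (pt_mem_src hy)]
  simp [frame_eq, coords_vec (pt_mem_src hy), stdVec_apply, crd_pt hy]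

/-! ### Pointwise algebra of tensors -/

lemma inner_adj (g : Metric n M) (x : M)
    (S : TangentSpace (𝓡∂ n) x →ₗ[ℝ] TangentSpace (𝓡∂ n) x) (v w : TangentSpace (𝓡∂ n) x) :
    g.inner x (adj g x S v) w = g.inner x v (S w) :=
  (form g x).isAdjointPairLeftAdjointOfNondegenerate (form_nondegenerate g x) S v w

lemma symPart_eq_zero_iff (g : Metric n M) (x : M)
    (S : TangentSpace (𝓡∂ n) x →ₗ[ℝ] TangentSpace (𝓡∂ n) x) :
    symPart g x S = 0 ↔ ∀ v w, g.inner x (S v) w + g.inner x v (S w) = 0 := by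
  have h : ∀ v w, g.inner x (symPart g x S v) w =
      (1 / 2) * (g.inner x (S v) w + g.inner x v (S w)) := by
    intro v w
    rw [← inner_adj, symPart]
    simp
    ring
  constructor
  · intro h0 v w
    have := h v w
    rw [h0] at this
    simp at this
    linarith
  · intro h0
    ext v
    by_contra hne
    have h1 := g.pos x _ hne
    rw [h, h0] at h1
    simp at h1

/-- Vanishing of the symmetric part is skew-symmetry of the tensor after lowering its index, which
may be tested on the coordinate frame. -/
lemma symPart_eq_zero_iff_comp (g : Metric n M) {c p : M} (hp : p ∈ src n c)
    (S : TangentSpace (𝓡∂ n) p →ₗ[ℝ] TangentSpace (𝓡∂ n) p) :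
    symPart g p S = 0 ↔ ∀ i j, ∑ l, gram g c (crd c p) i l * coframe c l p (S (frame c j p)) +
      ∑ l, gram g c (crd c p) j l * coframe c l p (S (frame c i p)) = 0 := by
  rw [symPart_eq_zero_iff]
  have e1 : ∀ i w, ∑ l, gram g c (crd c p) i l * coframe c l p w = g.inner p (frame c i p) w := by
    intro i w
    rw [inner_eq_gramForm g hp, gramForm_apply, frame_eq, coords_vec hp]
    simp only [stdVec_apply]
    simp [coframe_eq]
  simp_rw [e1]
  constructor
  · intro h i j
    rw [add_comm, g.symm p (frame c j p)]
    exact h _ _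
  · intro h v w
    have h2 := bilin_eq_sum (LinearMap.mk₂ ℝ
      (fun a b => g.inner p (S (vec c p a)) (vec c p b) + g.inner p (vec c p a) (S (vec c p b)))
      (fun _ _ _ => by simp; ring) (fun _ _ _ => by simp; ring) (fun _ _ _ => by simp; ring)
      (fun _ _ _ => by simp; ring)) (coords c p v) (coords c p w)
    simp only [LinearMap.mk₂_apply, vec_coords hp] at h2
    rw [h2]
    refine Finset.sum_eq_zero fun i _ => Finset.sum_eq_zero fun j _ => ?_
    rw [← frame_eq, ← frame_eq, g.symm p (S _), add_comm, h i j, mul_zero]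

end Manifold

/-! ### Images of measures under maps with a measurable inverse -/

section Map

variable {α β : Type*} [MeasurableSpace α] [MeasurableSpace β] {μ : Measure α} {φ : α → β}
  {ψ : β → α} {s : Set β}

lemma ae_map_of_leftInverse (hφ : AEMeasurable φ μ) (hs : MeasurableSet s)
    (hφs : ∀ᵐ y ∂μ, φ y ∈ s) {p : β → Prop} (h : ∀ x ∈ s, p x) : ∀ᵐ x ∂μ.map φ, p x := by
  have : ∀ᵐ x ∂μ.map φ, x ∈ s := (ae_map_iff hφ hs).2 hφs
  filter_upwards [this] with x hx using h x hx

lemma map_map_of_leftInverse (hφ : AEMeasurable φ μ) (hψ : Measurable ψ)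
    (hl : ∀ᵐ y ∂μ, ψ (φ y) = y) : (μ.map φ).map ψ = μ := by
  rw [AEMeasurable.map_map_of_aemeasurable hψ.aemeasurable hφ]
  exact (Measure.map_congr hl).trans Measure.map_id

/-- No measurability of `f` is required: the inequality `lintegral_map_le`, valid for arbitrary
integrands, is applied to `φ` and to its measurable left inverse `ψ`. Vector fields here are
arbitrary functions, so this generality is needed. -/
lemma lintegral_map_of_leftInverse (hφ : AEMeasurable φ μ) (hψ : Measurable ψ)
    (hl : ∀ᵐ y ∂μ, ψ (φ y) = y) (hs : MeasurableSet s) (hφs : ∀ᵐ y ∂μ, φ y ∈ s)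
    (hr : ∀ x ∈ s, φ (ψ x) = x) (f : β → ℝ≥0∞) :
    ∫⁻ x, f x ∂(μ.map φ) = ∫⁻ y, f (φ y) ∂μ := by
  refine le_antisymm (lintegral_map_le f φ) ?_
  calc ∫⁻ y, f (φ y) ∂μ = ∫⁻ y, f (φ y) ∂((μ.map φ).map ψ) := by
        rw [map_map_of_leftInverse hφ hψ hl]
    _ ≤ ∫⁻ x, f (φ (ψ x)) ∂(μ.map φ) := lintegral_map_le (fun y => f (φ y)) ψ
    _ = ∫⁻ x, f x ∂(μ.map φ) := lintegral_congr_ae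
        (ae_map_of_leftInverse hφ hs hφs fun x hx => by simp only [hr x hx])

lemma ae_map_iff_of_leftInverse (hφ : AEMeasurable φ μ) (hψ : Measurable ψ)
    (hl : ∀ᵐ y ∂μ, ψ (φ y) = y) (hs : MeasurableSet s) (hφs : ∀ᵐ y ∂μ, φ y ∈ s)
    (hr : ∀ x ∈ s, φ (ψ x) = x) {p : β → Prop} :
    (∀ᵐ x ∂(μ.map φ), p x) ↔ ∀ᵐ y ∂μ, p (φ y) := by
  refine ⟨fun h => ae_of_ae_map hφ h, fun h => ?_⟩
  have h1 : ∀ᵐ x ∂(μ.map φ), p (φ (ψ x)) := by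
    rw [← map_map_of_leftInverse hφ hψ hl] at h
    exact ae_of_ae_map hψ.aemeasurable h
  filter_upwards [h1, ae_map_of_leftInverse hφ hs hφs hr] with x hx hx'
  rwa [hx'] at hx

lemma aestronglyMeasurable_map_of_leftInverse (hφ : AEMeasurable φ μ) (hψ : Measurable ψ)
    (hl : ∀ᵐ y ∂μ, ψ (φ y) = y) (hs : MeasurableSet s) (hφs : ∀ᵐ y ∂μ, φ y ∈ s)
    (hr : ∀ x ∈ s, φ (ψ x) = x) {f : β → ℝ} (hf : AEStronglyMeasurable (fun y => f (φ y)) μ) :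
    AEStronglyMeasurable f (μ.map φ) := by
  rw [← map_map_of_leftInverse hφ hψ hl] at hf
  refine (hf.comp_aemeasurable hψ.aemeasurable).congr ?_
  exact ae_map_of_leftInverse hφ hs hφs fun x hx => by simp [hr x hx]

end Map

section Manifold

variable {n : ℕ} [NeZero n] {M : Type*} [TopologicalSpace M]
  [ChartedSpace (EuclideanHalfSpace n) M] [IsManifold (𝓡∂ n) ∞ M]
  [MeasurableSpace M] [BorelSpace M]

/-! ### The Riemannian volume in coordinates -/

open scoped Classical in
/-- A globally measurable version of the coordinate map. -/
def mcrd (c : M) : M → Coord n := (src n c).piecewise (crd c) fun _ => 0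

lemma measurableSet_src (c : M) : MeasurableSet (src n c) := (isOpen_src c).measurableSet

lemma mcrd_of_mem {c p : M} (hp : p ∈ src n c) : mcrd c p = (crd c p : Coord n) := by
  simp [mcrd, hp]

open scoped Classical in
lemma measurable_mcrd (c : M) : Measurable (mcrd c : M → Coord n) := by
  exact (continuousOn_crd c).measurable_piecewise continuousOn_const (measurableSet_src c)

/-- The density of the Riemannian volume in the chart around `c`. -/
def cden (g : Metric n M) (c : M) (y : Coord n) : ℝ≥0∞ := ENNReal.ofReal √(gram g c y).det

/-- The Riemannian volume in the coordinates around `c`. -/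
def cvol (g : Metric n M) (c : M) : Measure (Coord n) :=
  (volume.restrict (dom c)).withDensity (cden g c)

lemma chartVol_eq (g : Metric n M) (c : M) : chartVol g c = (cvol g c).map (pt c) := rfl

lemma continuousOn_sqrt_gram_det (g : Metric n M) (c : M) :
    ContinuousOn (fun y => √(gram g c y).det) (dom c) :=
  Real.continuous_sqrt.comp_continuousOn (contDiffOn_gram_det g c).continuousOn

lemma aemeasurable_cden (g : Metric n M) (c : M) :
    AEMeasurable (cden g c) (volume.restrict (dom c)) :=
  ENNReal.measurable_ofReal.comp_aemeasurable
    ((continuousOn_sqrt_gram_det g c).aemeasurable (measurableSet_dom c))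

lemma cden_pos (g : Metric n M) {c : M} {y : Coord n} (hy : y ∈ dom c) : 0 < cden g c y :=
  ENNReal.ofReal_pos.2 (Real.sqrt_pos.2 (gram_det_pos g hy))

lemma cvol_ac (g : Metric n M) (c : M) : cvol g c ≪ volume.restrict (dom c) :=
  withDensity_absolutelyContinuous _ _

lemma ac_cvol (g : Metric n M) (c : M) : volume.restrict (dom c) ≪ cvol g c := by
  refine withDensity_absolutelyContinuous' (aemeasurable_cden g c) ?_
  filter_upwards [ae_restrict_mem (measurableSet_dom c)] with y hy using (cden_pos g hy).ne'

lemma ae_cvol_mem (g : Metric n M) (c : M) : ∀ᵐ y ∂(cvol g c), y ∈ dom c :=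
  (cvol_ac g c).ae_le (ae_restrict_mem (measurableSet_dom c))

lemma aemeasurable_pt (g : Metric n M) (c : M) : AEMeasurable (pt c) (cvol g c) :=
  ((continuousOn_pt c).aemeasurable (measurableSet_dom c)).mono_ac (cvol_ac g c)

lemma ae_cvol_mcrd (g : Metric n M) (c : M) : ∀ᵐ y ∂(cvol g c), mcrd c (pt c y) = y := by
  filter_upwards [ae_cvol_mem g c] with y hy
  rw [mcrd_of_mem (pt_mem_src hy), crd_pt hy]

lemma ae_cvol_src (g : Metric n M) (c : M) : ∀ᵐ y ∂(cvol g c), pt c y ∈ src n c := by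
  filter_upwards [ae_cvol_mem g c] with y hy using pt_mem_src hy

lemma pt_mcrd {c p : M} (hp : p ∈ src n c) : pt c (mcrd c p : Coord n) = p := by
  rw [mcrd_of_mem hp, pt_crd hp]

lemma lintegral_chartVol (g : Metric n M) (c : M) (f : M → ℝ≥0∞) :
    ∫⁻ x, f x ∂(chartVol g c) = ∫⁻ y in dom c, cden g c y * f (pt c y) := by
  rw [chartVol_eq, lintegral_map_of_leftInverse (aemeasurable_pt g c) (measurable_mcrd c)
    (ae_cvol_mcrd g c) (measurableSet_src c) (ae_cvol_src g c) (fun _ hx => pt_mcrd hx), cvol,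
    lintegral_withDensity_eq_lintegral_mul_non_measurable₀ _ (aemeasurable_cden g c)
      (Eventually.of_forall fun _ => ENNReal.ofReal_lt_top)]
  rfl

lemma ae_chartVol_iff (g : Metric n M) (c : M) {p : M → Prop} :
    (∀ᵐ x ∂(chartVol g c), p x) ↔ ∀ᵐ y ∂(volume.restrict (dom c : Set (Coord n))), p (pt c y) := by
  rw [chartVol_eq, ae_map_iff_of_leftInverse (aemeasurable_pt g c) (measurable_mcrd c)
    (ae_cvol_mcrd g c) (measurableSet_src c) (ae_cvol_src g c) (fun _ hx => pt_mcrd hx)]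
  exact ⟨fun h => (ac_cvol g c).ae_le h, fun h => (cvol_ac g c).ae_le h⟩

lemma aestronglyMeasurable_chartVol (g : Metric n M) (c : M) {f : M → ℝ}
    (hf : AEStronglyMeasurable (fun y : Coord n => f (pt c y)) (volume.restrict (dom c))) :
    AEStronglyMeasurable f (chartVol g c) :=
  aestronglyMeasurable_map_of_leftInverse (aemeasurable_pt g c) (measurable_mcrd c)
    (ae_cvol_mcrd g c) (measurableSet_src c) (ae_cvol_src g c) (fun _ hx => pt_mcrd hx)
    (hf.mono_ac (cvol_ac g c))

lemma measurableSet_dom_inter_preimage {c : M} {s : Set M} (hs : MeasurableSet s) :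
    MeasurableSet (dom c ∩ pt c ⁻¹' s : Set (Coord n)) := by
  obtain ⟨f, hf, hfe⟩ : ∃ f : Coord n → M, Measurable f ∧ ∀ y ∈ dom c, f y = pt c y := by
    classical
    refine ⟨(dom c).piecewise (pt c) fun _ => c, ?_, fun y hy => by simp [hy]⟩
    exact (continuousOn_pt c).measurable_piecewise continuousOn_const (measurableSet_dom c)
  have : (dom c ∩ pt c ⁻¹' s : Set (Coord n)) = dom c ∩ f ⁻¹' s := by
    ext y
    simp only [mem_inter_iff, mem_preimage]
    exact and_congr_right fun hy => by rw [hfe y hy]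
  rw [this]
  exact (measurableSet_dom c).inter (hf hs)

lemma chartVol_apply (g : Metric n M) (c : M) {s : Set M} (hs : MeasurableSet s) :
    chartVol g c s = ∫⁻ y in dom c ∩ pt c ⁻¹' s, cden g c y := by
  classical
  have hA := measurableSet_dom_inter_preimage (n := n) (c := c) hs
  rw [← lintegral_indicator_one hs, lintegral_chartVol,
    ← inter_eq_left.2 (inter_subset_left : (dom c ∩ pt c ⁻¹' s : Set (Coord n)) ⊆ dom c),
    ← Measure.restrict_restrict hA, ← lintegral_indicator hA]
  refine setLIntegral_congr_fun (measurableSet_dom c) fun y hy => ?_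
  by_cases h : pt c y ∈ s
  · simp [indicator, h, hy]
  · simp [indicator, h]

lemma det_jac (g : Metric n M) {c d : M} {y : Coord n} (hy : y ∈ overlap c d) :
    (gram g c y).det = (jac c d y).det ^ 2 * (gram g d (trans c d y)).det := by
  set b := (EuclideanSpace.basisFun (Fin n) ℝ).toBasis with hb
  set J := LinearMap.toMatrix b b (jac c d y : Coord n →ₗ[ℝ] Coord n) with hJ
  have hJe : ∀ i j, J i j = jac c d y (stdVec j) i := by
    intro i j
    simp [hJ, hb, LinearMap.toMatrix_apply, stdVec]
  have hdet : J.det = (jac c d y).det := LinearMap.det_toMatrix b _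
  have : gram g c y = Jᵀ * gram g d (trans c d y) * J := by
    ext i j
    rw [← gramForm_stdVec, ← jac_gramForm g hy, gramForm_apply]
    simp only [Matrix.mul_apply, Matrix.transpose_apply, hJe, Finset.sum_mul]
    rw [Finset.sum_comm]
    exact Finset.sum_congr rfl fun p _ => Finset.sum_congr rfl fun q _ => by ring
  rw [this, Matrix.det_mul, Matrix.det_mul, Matrix.det_transpose, hdet]
  ring

lemma cden_trans (g : Metric n M) {c d : M} {y : Coord n} (hy : y ∈ overlap c d) :
    ENNReal.ofReal |(jac c d y).det| * cden g d (trans c d y) = cden g c y := by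
  rw [cden, cden, ← ENNReal.ofReal_mul (abs_nonneg _), det_jac g hy,
    Real.sqrt_mul (sq_nonneg _), Real.sqrt_sq_eq_abs]

/-- Change of variables: the Jacobian determinant of the coordinate change is absorbed by the
transformation of `√(det gᵢⱼ)`. -/
lemma chartVol_eq_of_subset (g : Metric n M) (c d : M) {s : Set M} (hs : MeasurableSet s)
    (hc : s ⊆ src n c) (hd : s ⊆ src n d) : chartVol g c s = chartVol g d s := by
  rw [chartVol_apply g c hs, chartVol_apply g d hs]
  have hsub : ∀ {c d : M}, s ⊆ src n d → (dom c ∩ pt c ⁻¹' s : Set (Coord n)) ⊆ overlap c d :=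
    fun hd => inter_subset_inter_right _ (preimage_mono hd)
  have himg : trans c d '' (dom c ∩ pt c ⁻¹' s : Set (Coord n)) = dom d ∩ pt d ⁻¹' s := by
    ext z
    constructor
    · rintro ⟨y, hy, rfl⟩
      refine ⟨(trans_mem_overlap (hsub hd hy)).1, ?_⟩
      rw [mem_preimage, pt_trans (hsub hd hy)]
      exact hy.2
    · intro hz
      have hz' : z ∈ overlap d c := hsub hc hz
      refine ⟨trans d c z, ⟨(trans_mem_overlap hz').1, ?_⟩, trans_trans hz'⟩
      rw [mem_preimage, pt_trans hz']
      exact hz.2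
  rw [← himg, lintegral_image_eq_lintegral_abs_det_fderiv_mul volume
    (measurableSet_dom_inter_preimage hs)
    (fun y hy => (hasFDerivWithinAt_trans (hsub hd hy)).mono (hsub hd))
    (fun y hy z hz h => by
      rw [← trans_trans (hsub hd hy), h, trans_trans (hsub hd hz)])]
  exact setLIntegral_congr_fun (measurableSet_dom_inter_preimage hs)
    fun y hy => (cden_trans g (hsub hd hy)).symm

lemma chartVol_compl_src (g : Metric n M) (c : M) : chartVol g c (src n c)ᶜ = 0 := by
  have := (ae_chartVol_iff g c (p := fun x => x ∈ src n c)).2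
    ((ae_restrict_mem (measurableSet_dom c)).mono fun y hy => pt_mem_src hy)
  exact this

/-- A supremum of measures is not computed set by set, so an upper bound must be a measure
dominating every chart volume. -/
lemma vol_restrict_src (g : Metric n M) (c : M) :
    (vol g).restrict (src n c) = chartVol g c := by
  -- The dominating measure is the volume of the chart at `c` plus the top measure on the complement
  -- of its domain; the latter disappears on restriction.
  have hle : vol g ≤ chartVol g c + (⊤ : Measure M).restrict (src n c)ᶜ := by
    refine iSup_le fun d => Measure.le_iff.2 fun s hs => ?_
    have h1 : chartVol g d (s ∩ src n c) ≤ chartVol g c s := by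
      have hm : MeasurableSet (s ∩ src n c ∩ src n d) :=
        (hs.inter (measurableSet_src c)).inter (measurableSet_src d)
      calc chartVol g d (s ∩ src n c)
          ≤ chartVol g d (s ∩ src n c ∩ src n d) + chartVol g d (src n d)ᶜ := by
            refine (measure_mono ?_).trans (measure_union_le _ _)
            intro x hx
            by_cases h : x ∈ src n d
            · exact Or.inl ⟨hx, h⟩
            · exact Or.inr h
        _ = chartVol g c (s ∩ src n c ∩ src n d) := by
            rw [chartVol_compl_src, add_zero,
              chartVol_eq_of_subset g d c hm inter_subset_right
                (inter_subset_left.trans inter_subset_right)]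
        _ ≤ chartVol g c s := measure_mono (inter_subset_left.trans inter_subset_left)
    rw [Measure.add_apply, Measure.restrict_apply hs, ← inter_union_compl s (src n c)]
    refine (measure_union_le _ _).trans ?_
    rw [inter_union_compl]
    gcongr
    exact le_top
  refine le_antisymm (Measure.le_iff.2 fun s hs => ?_) (Measure.le_iff.2 fun s hs => ?_)
  · rw [Measure.restrict_apply hs]
    refine (hle _).trans ?_
    rw [Measure.add_apply, Measure.restrict_apply (hs.inter (measurableSet_src c))]
    simp only [inter_assoc, inter_compl_self, inter_empty, measure_empty, add_zero]
    exact measure_mono inter_subset_left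
  · have h1 : chartVol g c ≤ vol g := le_iSup (chartVol g) c
    rw [Measure.restrict_apply hs]
    calc chartVol g c s ≤ chartVol g c (s ∩ src n c) + chartVol g c (src n c)ᶜ := by
          refine (measure_mono ?_).trans (measure_union_le _ _)
          intro x hx
          by_cases h : x ∈ src n c
          · exact Or.inl ⟨hx, h⟩
          · exact Or.inr h
      _ = chartVol g c (s ∩ src n c) := by rw [chartVol_compl_src, add_zero]
      _ ≤ vol g (s ∩ src n c) := h1 _

lemma exists_finset_src [CompactSpace M] : ∃ t : Finset M, (⋃ c ∈ t, src n c) = univ := by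
  obtain ⟨t, ht⟩ := isCompact_univ.elim_finite_subcover (fun c : M => src n c) (fun c => isOpen_src c)
    fun x _ => mem_iUnion.2 ⟨x, mem_src_self x⟩
  exact ⟨t, univ_subset_iff.1 ht⟩

/-- Compactness reduces the uncountable family of charts to a finite one, so the exceptional sets
can be united. -/
lemma ae_vol_iff_chartVol [CompactSpace M] (g : Metric n M) {p : M → Prop} :
    (∀ᵐ x ∂(vol g), p x) ↔ ∀ c : M, ∀ᵐ x ∂(chartVol g c), p x := by
  refine ⟨fun h c => ?_, fun h => ?_⟩
  · rw [← vol_restrict_src]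
    exact ae_restrict_of_ae h
  · obtain ⟨t, ht⟩ := exists_finset_src (n := n) (M := M)
    rw [← Measure.restrict_univ (μ := vol g), ← ht,
      ae_restrict_biUnion_finset_iff (fun c => src n c) t]
    intro c _
    rw [vol_restrict_src]
    exact h c

lemma ae_vol_iff [CompactSpace M] (g : Metric n M) {p : M → Prop} :
    (∀ᵐ x ∂(vol g), p x) ↔ ∀ c : M, ∀ᵐ y ∂(volume.restrict (dom c : Set (Coord n))), p (pt c y) := by
  simp_rw [ae_vol_iff_chartVol, ae_chartVol_iff]

lemma aestronglyMeasurable_vol [CompactSpace M] (g : Metric n M) {f : M → ℝ}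
    (hf : ∀ c : M, AEStronglyMeasurable (fun y : Coord n => f (pt c y)) (volume.restrict (dom c))) :
    AEStronglyMeasurable f (vol g) := by
  obtain ⟨t, ht⟩ := exists_finset_src (n := n) (M := M)
  have : ∀ t : Finset M, AEStronglyMeasurable f ((vol g).restrict (⋃ c ∈ t, src n c)) := by
    intro t
    classical
    induction t using Finset.induction_on with
    | empty => simp
    | insert c t _ ih =>
      rw [Finset.set_biUnion_insert, aestronglyMeasurable_union_iff, vol_restrict_src]
      exact ⟨aestronglyMeasurable_chartVol g c (hf c), ih⟩
  simpa [ht] using this t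

lemma setLIntegral_src (g : Metric n M) (c : M) (f : M → ℝ≥0∞) :
    ∫⁻ x in src n c, f x ∂(vol g) = ∫⁻ y in dom c, cden g c y * f (pt c y) := by
  rw [vol_restrict_src, lintegral_chartVol]

lemma exists_closedBall_inter_subset {c : M} {y : Coord n} (hy : y ∈ dom c) :
    ∃ r > 0, Metric.closedBall y r ∩ HS n ⊆ dom c := by
  rw [dom_eq] at hy ⊢
  obtain ⟨r, hr, h⟩ := Metric.nhds_basis_closedBall.mem_iff.1 ((isOpen_domO c).mem_nhds hy.1)
  exact ⟨r, hr, inter_subset_inter_left _ h⟩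

lemma isCompact_closedBall_inter (y : Coord n) (r : ℝ) :
    IsCompact (Metric.closedBall y r ∩ HS n) :=
  (isCompact_closedBall y r).inter_right isClosed_HS

/-- The density is bounded on compact half-balls, so the volume is locally finite, and hence finite
by compactness. -/
instance [CompactSpace M] (g : Metric n M) : IsFiniteMeasure (vol g) := by
  have : IsLocallyFiniteMeasure (vol g) := by
    refine ⟨fun c => ?_⟩
    obtain ⟨r, hr, hrd⟩ := exists_closedBall_inter_subset (crd_mem_dom (mem_src_self (n := n) c))
    set N : Set M := src n c ∩ crd c ⁻¹' Metric.ball (crd c c : Coord n) r with hN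
    have hNo : IsOpen N := (continuousOn_crd c).isOpen_inter_preimage (isOpen_src c) Metric.isOpen_ball
    refine ⟨N, hNo.mem_nhds ⟨mem_src_self c, Metric.mem_ball_self hr⟩, ?_⟩
    have h1 : vol g N = chartVol g c N := by
      rw [← vol_restrict_src, Measure.restrict_apply hNo.measurableSet,
        inter_eq_left.2 inter_subset_left]
    rw [h1, chartVol_apply g c hNo.measurableSet]
    obtain ⟨B, hB⟩ := (isCompact_closedBall_inter (crd c c : Coord n) r).exists_bound_of_continuousOn
      ((continuousOn_sqrt_gram_det g c).mono hrd)
    have hsub : (dom c ∩ pt c ⁻¹' N : Set (Coord n)) ⊆ Metric.closedBall (crd c c) r ∩ HS n := by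
      rintro y ⟨hy, hyN⟩
      refine ⟨?_, dom_subset_HS c hy⟩
      have := hyN.2
      rw [mem_preimage, crd_pt hy] at this
      exact Metric.ball_subset_closedBall this
    calc ∫⁻ y in dom c ∩ pt c ⁻¹' N, cden g c y
        ≤ ∫⁻ y in Metric.closedBall (crd c c) r ∩ HS n, cden g c y := lintegral_mono_set hsub
      _ ≤ ∫⁻ y in Metric.closedBall (crd c c) r ∩ HS n, ENNReal.ofReal B := by
          refine setLIntegral_mono measurable_const fun y hy => ENNReal.ofReal_le_ofReal ?_
          exact (le_abs_self _).trans (hB y hy)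
      _ < ⊤ := by
          rw [setLIntegral_const]
          exact ENNReal.mul_lt_top ENNReal.ofReal_lt_top
            (isCompact_closedBall_inter _ r).measure_lt_top
  infer_instance

end Manifold

/-! ### The closed system of a Killing field -/

section System

variable {n : ℕ} {U : Set (Coord n)}

lemma fderiv_fderiv_apply_comm {φ : Coord n → ℝ} (hφ : ContDiff ℝ ∞ φ) (y a b : Coord n) :
    fderiv ℝ (fun z => fderiv ℝ φ z a) y b = fderiv ℝ (fun z => fderiv ℝ φ z b) y a := by
  have hd : DifferentiableAt ℝ (fderiv ℝ φ) y :=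
    (hφ.fderiv_right (m := ∞) (by simp)).differentiable (by simp) y
  have h : ∀ a b, fderiv ℝ (fun z => fderiv ℝ φ z a) y b = fderiv ℝ (fderiv ℝ φ) y b a := by
    intro a b
    have := (hd.hasFDerivAt.clm_apply (hasFDerivAt_const a y)).fderiv
    rw [this]; simp
  rw [h, h]
  exact ((contDiff_infty.1 hφ 2).contDiffAt.isSymmSndFDerivAt (by simp)) b a

/-- Second weak derivatives in terms of the weak derivatives of the symmetrized gradient. -/
lemma hasWeakPartial_of_symmetrized {lo : Fin n → Coord n → ℝ} {P : Fin n → Fin n → Coord n → ℝ}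
    {Q : Fin n → Fin n → Fin n → Coord n → ℝ} (h : ∀ i j, HasWeakPartial U j (lo i) (P i j))
    (hQ : ∀ k i j, HasWeakPartial U k (fun y => P i j y + P j i y) (Q k i j)) (i j k : Fin n) :
    HasWeakPartial U k (P i j)
      (fun y => (1 / 2) * (Q k i j y + Q j i k y + (-1) * Q i j k y)) := by
  have hQL : ∀ k i j, LocallyIntegrableOn (Q k i j) U := fun k i j => (hQ k i j).2.1
  refine ⟨(h i j).2.1, ?_, fun φ hφ hc hs => ?_⟩
  · exact (((hQL k i j).add (hQL j i k)).add ((hQL i j k).smul (-1 : ℝ))).smul (1 / 2 : ℝ)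
  have hsd : ∀ v, tsupport (fun y => fderiv ℝ φ y v) ⊆ U := fun v =>
    (tsupport_fderiv_apply_subset v).trans hs
  have hcd : ∀ v, HasCompactSupport fun y => fderiv ℝ φ y v := fun v =>
    hc.of_isClosed_subset (isClosed_tsupport _) (tsupport_fderiv_apply_subset _)
  -- The remaining derivative is moved onto `φ` as well, so only derivatives of the test function
  -- have to commute.
  have hP : ∀ i j k, ∫ y in U, P i j y * fderiv ℝ φ y (stdVec k) =
      -∫ y in U, lo i y * fderiv ℝ (fun z => fderiv ℝ φ z (stdVec k)) y (stdVec j) := by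
    intro i j k
    have := (h i j).2.2 _ (contDiff_fderiv_apply hφ (stdVec k)) (hcd _) (hsd _)
    rw [this, neg_neg]
  have hiP : ∀ i j k, IntegrableOn (fun y => P i j y * fderiv ℝ φ y (stdVec k)) U := fun i j k =>
    (integrable_mul_of_tsupport_subset (h i j).2.1
      (contDiff_fderiv_apply hφ (stdVec k)).continuous.continuousOn (hcd _) (hsd _)).integrableOn
  have hiQ : ∀ k i j, IntegrableOn (fun y => Q k i j y * φ y) U := fun k i j =>
    (integrable_mul_of_tsupport_subset (hQL k i j) hφ.continuous.continuousOn hc hs).integrableOn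
  -- The weak derivative of the symmetrized gradient, tested with `φ`; the claim follows by
  -- combining three such identities with `hsym`.
  have hE : ∀ k i j, ∫ y in U, Q k i j y * φ y = -(∫ y in U, P i j y * fderiv ℝ φ y (stdVec k)) -
      ∫ y in U, P j i y * fderiv ℝ φ y (stdVec k) := by
    intro k i j
    have := (hQ k i j).2.2 φ hφ hc hs
    simp_rw [add_mul] at this
    rw [integral_add (hiP i j k) (hiP j i k)] at this
    linarith
  have hsym : ∀ i j k, ∫ y in U, P i j y * fderiv ℝ φ y (stdVec k) =
      ∫ y in U, P i k y * fderiv ℝ φ y (stdVec j) := by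
    intro i j k
    rw [hP, hP]
    simp_rw [fderiv_fderiv_apply_comm hφ _ (stdVec k) (stdVec j)]
  have e : ∀ y, 1 / 2 * (Q k i j y + Q j i k y + (-1) * Q i j k y) * φ y =
      (1 / 2) * ((Q k i j y * φ y + Q j i k y * φ y) - Q i j k y * φ y) := by intro y; ring
  simp_rw [e]
  have i1 : IntegrableOn (fun y => Q k i j y * φ y + Q j i k y * φ y) U :=
    (hiQ k i j).add (hiQ j i k)
  rw [integral_const_mul, integral_sub i1 (hiQ i j k),
    integral_add (hiQ k i j) (hiQ j i k), hE, hE, hE, hsym i k j, hsym j k i, hsym k i j]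
  ring

variable [NeZero n]

/-- The coefficients of the first order system satisfied by a one-form `w` with
`∂ⱼ wᵢ + ∂ᵢ wⱼ = ∑ₘ Cᵢⱼₘ wₘ` and its first derivatives. -/
def sysCoeff (C : Fin n → Fin n → Fin n → Coord n → ℝ) (k : Fin n) :
    Fin n ⊕ Fin n × Fin n → Fin n ⊕ Fin n × Fin n → Coord n → ℝ
  | .inl _, .inl _ => fun _ => 0
  | .inl i, .inr (p, q) => fun _ => if p = i ∧ q = k then 1 else 0
  | .inr (i, j), .inl m => fun y => (1 / 2) *
      (partialH k (C i j m) y + partialH j (C i k m) y + (-1) * partialH i (C j k m) y)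
  | .inr (i, j), .inr (m, q) => fun y => (1 / 2) *
      ((if q = k then C i j m y else 0) + (if q = j then C i k m y else 0) +
        (-1) * (if q = i then C j k m y else 0))

/-- A one-form together with its first derivatives. -/
def sysVar (lo : Fin n → Coord n → ℝ) (P : Fin n → Fin n → Coord n → ℝ) :
    Fin n ⊕ Fin n × Fin n → Coord n → ℝ
  | .inl i => lo i
  | .inr (i, j) => P i j

/-- Prolongation. The equations for `lo` merely say that `P` is its derivative. For `P`, the
symmetrized gradient is algebraic in `lo` with smooth coefficients, so its derivatives involve only
`lo` and `P`, and `hasWeakPartial_of_symmetrized` expresses all derivatives of `P` through them. -/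
lemma weakSystem_of_symmetrized {H : Set (Coord n)} (hU : IsOpen U) (hUH : U ⊆ interior (HS n))
    (hH : U ⊆ H)
    {C : Fin n → Fin n → Fin n → Coord n → ℝ} (hC : ∀ i j m, ContDiffOn ℝ ∞ (C i j m) H)
    {lo : Fin n → Coord n → ℝ} {P : Fin n → Fin n → Coord n → ℝ}
    (h : ∀ i j, HasWeakPartial U j (lo i) (P i j))
    (hE : ∀ i j, ∀ᵐ y ∂volume.restrict U, P i j y + P j i y = ∑ m, C i j m y * lo m y)
    (k : Fin n) (s : Fin n ⊕ Fin n × Fin n) :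
    HasWeakPartial U k (sysVar lo P s) (fun y => ∑ t, sysCoeff C k s t y * sysVar lo P t y) := by
  rcases s with i | ⟨i, j⟩
  · refine (h i k).congr_ae EventuallyEq.rfl (Eventually.of_forall fun y => ?_)
    simp only [Fintype.sum_sum_type, sysCoeff, sysVar, zero_mul, Finset.sum_const_zero, zero_add,
      Fintype.sum_prod_type]
    rw [Finset.sum_eq_single i, Finset.sum_eq_single k]
    · simp
    · intro b _ hb; simp [hb]
    · simp
    · intro b _ hb; simp [hb]
    · simp
  · have hQ : ∀ k i j, HasWeakPartial U k (fun y => P i j y + P j i y)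
        (fun y => ∑ m, (partialH k (C i j m) y * lo m y + C i j m y * P m k y)) := by
      intro k i j
      have h1 := HasWeakPartial.sum Finset.univ fun m _ =>
        (h m k).smooth_mul hU ((hC i j m).mono hH)
      refine h1.congr_ae ?_ ?_
      · filter_upwards [hE i j] with y hy using hy.symm
      · filter_upwards [ae_restrict_mem hU.measurableSet] with y hy
        exact Finset.sum_congr rfl fun m _ => by
          rw [partialH, fderivWithin_of_mem_nhds (mem_interior_iff_mem_nhds.1 (hUH hy))]
    refine (hasWeakPartial_of_symmetrized h hQ i j k).congr_ae EventuallyEq.rfl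
      (Eventually.of_forall fun y => ?_)
    simp only [Fintype.sum_sum_type, sysCoeff, sysVar, Fintype.sum_prod_type]
    rw [← Finset.sum_add_distrib, ← Finset.sum_add_distrib, Finset.mul_sum, ← Finset.sum_add_distrib,
      Finset.mul_sum]
    refine Finset.sum_congr rfl fun m _ => ?_
    have : ∀ q, 1 / 2 * ((if q = k then C i j m y else 0) + (if q = j then C i k m y else 0) +
        (-1) * (if q = i then C j k m y else 0)) * P m q y =
        (if q = k then 1 / 2 * C i j m y * P m q y else 0) +
        (if q = j then 1 / 2 * C i k m y * P m q y else 0) +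
        (if q = i then -(1 / 2) * C j k m y * P m q y else 0) := by
      intro q; split_ifs <;> ring
    simp_rw [this, Finset.sum_add_distrib]
    simp
    ring

end System

/-! ### Weak Killing fields are smooth -/

section Manifold

variable {n : ℕ} [NeZero n] {M : Type*} [TopologicalSpace M]
  [ChartedSpace (EuclideanHalfSpace n) M] [IsManifold (𝓡∂ n) ∞ M]
  [MeasurableSpace M] [BorelSpace M]

lemma contDiffOn_sysCoeff {c : M} {C : Fin n → Fin n → Fin n → Coord n → ℝ}
    (hC : ∀ i j m, ContDiffOn ℝ ∞ (C i j m) (dom c)) (k : Fin n)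
    (s t : Fin n ⊕ Fin n × Fin n) : ContDiffOn ℝ ∞ (sysCoeff C k s t) (dom c) := by
  have hif : ∀ (p : Prop) [Decidable p] (f : Coord n → ℝ), ContDiffOn ℝ ∞ f (dom c) →
      ContDiffOn ℝ ∞ (fun y => if p then f y else 0) (dom c) := by
    intro p _ f hf
    by_cases hp : p
    · simpa [hp] using hf
    · simpa [hp] using contDiffOn_const
  rcases s with i | ⟨i, j⟩ <;> rcases t with m | ⟨m, q⟩
  · exact contDiffOn_const
  · exact contDiffOn_const
  · exact contDiffOn_const.mul (((contDiffOn_partialH (hC i j m) k).add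
      (contDiffOn_partialH (hC i k m) j)).add (contDiffOn_const.mul
      (contDiffOn_partialH (hC j k m) i)))
  · exact contDiffOn_const.mul (((hif _ _ (hC i j m)).add (hif _ _ (hC i k m))).add
      (contDiffOn_const.mul (hif _ _ (hC j k m))))

/-- The covariant components of a vector field. -/
def lower (g : Metric n M) (c : M) (u : VField n M) (i : Fin n) (y : Coord n) : ℝ :=
  ∑ l, gram g c y i l * vcomp c u l y

/-- The derivatives of the covariant components of `u`, when `T = ∇u`. -/
def lowerDeriv (g : Metric n M) (c : M) (u : VField n M) (T : TField n M) (i j : Fin n)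
    (y : Coord n) : ℝ :=
  ∑ l, (partialH j (fun z => gram g c z i l) y * vcomp c u l y +
    gram g c y i l * (tcomp c T l j y - ∑ k, christoffel g c l j k y * vcomp c u k y))

/-- The coefficients of the symmetrized gradient of the covariant components of a Killing field. -/
def killingCoeff (g : Metric n M) (c : M) (i j m : Fin n) (y : Coord n) : ℝ :=
  ∑ l, (partialH j (fun z => gram g c z i l) y + partialH i (fun z => gram g c z j l) y -
    ∑ p, (gram g c y i p * christoffel g c p j l y + gram g c y j p * christoffel g c p i l y)) *
      (gram g c y)⁻¹ l m

lemma contDiffOn_killingCoeff (g : Metric n M) (c : M) (i j m : Fin n) :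
    ContDiffOn ℝ ∞ (killingCoeff g c i j m) (dom c) := by
  refine ContDiffOn.sum fun l _ => ContDiffOn.mul ?_ (contDiffOn_gram_inv g c l m)
  refine ((contDiffOn_partialH (contDiffOn_gram g c i l) j).add
    (contDiffOn_partialH (contDiffOn_gram g c j l) i)).sub (ContDiffOn.sum fun p _ => ?_)
  exact ((contDiffOn_gram g c i p).mul (contDiffOn_christoffel g c p j l)).add
    ((contDiffOn_gram g c j p).mul (contDiffOn_christoffel g c p i l))

lemma raise_lower (g : Metric n M) {c : M} {y : Coord n} (hy : y ∈ dom c) (u : VField n M)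
    (l : Fin n) : ∑ m, (gram g c y)⁻¹ l m * lower g c u m y = vcomp c u l y := by
  simp_rw [lower, Finset.mul_sum, ← mul_assoc]
  rw [Finset.sum_comm]
  simp_rw [← Finset.sum_mul, sum_inv_mul_gram g hy]
  simp

/-- In the symmetrized sum the contribution of `T` cancels because its symmetric part vanishes. What
remains, derivatives of the metric and Christoffel terms, is linear in `u`, and the inverse metric
rewrites it in covariant components. -/
lemma lowerDeriv_add (g : Metric n M) {c : M} {y : Coord n} (hy : y ∈ dom c) (u : VField n M)
    (T : TField n M) (hT : symPart g (pt c y) (T (pt c y)) = 0) (i j : Fin n) :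
    lowerDeriv g c u T i j y + lowerDeriv g c u T j i y =
      ∑ m, killingCoeff g c i j m y * lower g c u m y := by
  have h0 := (symPart_eq_zero_iff_comp g (pt_mem_src hy) _).1 hT i j
  rw [crd_pt hy] at h0
  change ∑ l, gram g c y i l * tcomp c T l j y + ∑ l, gram g c y j l * tcomp c T l i y = 0 at h0
  have hR : ∑ m, killingCoeff g c i j m y * lower g c u m y = ∑ l,
      (partialH j (fun z => gram g c z i l) y + partialH i (fun z => gram g c z j l) y -
      ∑ p, (gram g c y i p * christoffel g c p j l y + gram g c y j p * christoffel g c p i l y)) *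
        vcomp c u l y := by
    simp_rw [killingCoeff, Finset.sum_mul, mul_assoc]
    rw [Finset.sum_comm]
    simp_rw [← Finset.mul_sum, raise_lower g hy]
  have hL : ∀ i j, lowerDeriv g c u T i j y =
      ∑ l, partialH j (fun z => gram g c z i l) y * vcomp c u l y +
        ∑ l, gram g c y i l * tcomp c T l j y -
        ∑ l, (∑ p, gram g c y i p * christoffel g c p j l y) * vcomp c u l y := by
    intro i j
    simp_rw [lowerDeriv, mul_sub, Finset.sum_add_distrib, Finset.sum_sub_distrib]
    have : ∑ l, gram g c y i l * ∑ k, christoffel g c l j k y * vcomp c u k y =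
        ∑ l, (∑ p, gram g c y i p * christoffel g c p j l y) * vcomp c u l y := by
      simp_rw [Finset.mul_sum, Finset.sum_mul]
      rw [Finset.sum_comm]
      exact Finset.sum_congr rfl fun p _ => Finset.sum_congr rfl fun l _ => by ring
    rw [this]
    ring
  rw [hR, hL, hL]
  simp_rw [sub_mul, add_mul, Finset.sum_sub_distrib, Finset.sum_add_distrib, add_mul,
    Finset.sum_add_distrib]
  linarith

lemma hasWeakPartial_lower {g : Metric n M} {u : VField n M} {T : TField n M}
    (c : M)
    (hT : ∀ i j, HasWeakPartial (interior (dom c)) j (vcomp c u i)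
      (fun y => tcomp c T i j y - ∑ k, christoffel g c i j k y * vcomp c u k y)) (i j : Fin n) :
    HasWeakPartial (interior (dom c)) j (lower g c u i) (lowerDeriv g c u T i j) := by
  have h1 := HasWeakPartial.sum Finset.univ fun l _ => (hT l j).smooth_mul isOpen_interior
    ((contDiffOn_gram g c i l).mono interior_subset)
  refine h1.congr_ae EventuallyEq.rfl ?_
  filter_upwards [ae_restrict_mem isOpen_interior.measurableSet] with y hy
  refine Finset.sum_congr rfl fun l _ => ?_
  rw [partialH_eq_fderiv (interior_mono (dom_subset_HS c) hy)]

lemma weakSystem_killing {g : Metric n M} {u : VField n M} {T : TField n M} (c : M)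
    (hT : ∀ i j, HasWeakPartial (interior (dom c)) j (vcomp c u i)
      (fun y => tcomp c T i j y - ∑ k, christoffel g c i j k y * vcomp c u k y))
    (h0 : ∀ᵐ y ∂(volume.restrict (dom c : Set (Coord n))), symPart g (pt c y) (T (pt c y)) = 0)
    (k : Fin n) (s : Fin n ⊕ Fin n × Fin n) :
    HasWeakPartial (interior (dom c)) k (sysVar (lower g c u) (lowerDeriv g c u T) s)
      (fun y => ∑ t, sysCoeff (killingCoeff g c) k s t y *
        sysVar (lower g c u) (lowerDeriv g c u T) t y) := by
  refine weakSystem_of_symmetrized isOpen_interior (interior_mono (dom_subset_HS c))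
    interior_subset (contDiffOn_killingCoeff g c) (hasWeakPartial_lower c hT) (fun i j => ?_) k s
  rw [restrict_interior_dom]
  filter_upwards [h0, ae_restrict_mem (measurableSet_dom c)] with y hy hyd
  exact lowerDeriv_add g hyd u T hy i j

/-- The regularity theorem provides smooth versions of the covariant components; the smooth inverse
metric raises the index. -/
lemma exists_smooth_vrep [CompactSpace M] {g : Metric n M} {u : VField n M} {T : TField n M}
    (hT : IsWeakCovDeriv g u T) (h0 : ∀ᵐ x ∂(vol g), symPart g x (T x) = 0) (c : M) :
    ∃ w : Coord n → Coord n, ContDiffOn ℝ ∞ w (dom c) ∧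
      ∀ᵐ y ∂(volume.restrict (dom c : Set (Coord n))), vrep c u y = w y := by
  have hU : interior (dom c : Set (Coord n)) = domO c ∩ interior (HS n) := interior_dom c
  obtain ⟨V, hV, hWV⟩ := exists_smooth_of_weakSystem_upTo_boundary convex_HS isClosed_HS
    nonempty_interior_HS (isOpen_domO c) (W := sysVar (lower g c u) (lowerDeriv g c u T))
    (A := sysCoeff (killingCoeff g c))
    (fun j k l => by
      rw [← dom_eq]; exact contDiffOn_sysCoeff (contDiffOn_killingCoeff g c) j k l)
    (fun s => by rw [← hU]; exact (weakSystem_killing c (hT.2 c) ((ae_vol_iff g).1 h0 c) 0 s).1)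
    (fun k s => by rw [← hU]; exact weakSystem_killing c (hT.2 c) ((ae_vol_iff g).1 h0 c) k s)
  rw [← dom_eq] at hV
  rw [← hU, restrict_interior_dom] at hWV
  refine ⟨fun y => WithLp.toLp 2 fun l => ∑ m, (gram g c y)⁻¹ l m * V (.inl m) y, ?_, ?_⟩
  · rw [contDiffOn_coord_iff]
    intro l
    change ContDiffOn ℝ ∞ (fun y => ∑ m, (gram g c y)⁻¹ l m * V (.inl m) y) (dom c)
    exact ContDiffOn.sum fun m _ => (contDiffOn_gram_inv g c l m).mul (hV (.inl m))
  · filter_upwards [ae_all_iff.2 fun m : Fin n => hWV (.inl m),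
      ae_restrict_mem (measurableSet_dom c)] with y hy hyd
    ext l
    rw [← vcomp_eq, ← raise_lower g hyd]
    exact Finset.sum_congr rfl fun m _ => by rw [← hy m]; rfl

/-! ### Comparison of weak and classical derivatives -/

lemma tensor_ext {c p : M} (hp : p ∈ src n c)
    {S S' : TangentSpace (𝓡∂ n) p →ₗ[ℝ] TangentSpace (𝓡∂ n) p}
    (h : ∀ i j, coframe c i p (S (frame c j p)) = coframe c i p (S' (frame c j p))) : S = S' := by
  ext w
  refine coords_ext hp ?_
  ext i
  rw [← vec_coords hp w, vec_eq_sum]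
  simp only [map_sum, map_smul]
  simp only [PiLp.smul_apply, WithLp.ofLp_sum, Finset.sum_apply, smul_eq_mul]
  exact Finset.sum_congr rfl fun j _ => by
    have := h i j
    rw [coframe_eq, coframe_eq] at this
    rw [this]

lemma ae_vcomp_eq [CompactSpace M] {g : Metric n M} {u v : VField n M}
    (huv : ∀ᵐ x ∂(vol g), u x = v x) (c : M) :
    ∀ᵐ y ∂(volume.restrict (dom c : Set (Coord n))), ∀ i, vcomp c u i y = vcomp c v i y := by
  filter_upwards [(ae_vol_iff g).1 huv c] with y hy i
  rw [vcomp, vcomp, hy]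

lemma hasWeakPartial_vcomp {g : Metric n M} {v : VField n M} (hv : IsSmooth v) (c : M)
    (i j : Fin n) : HasWeakPartial (interior (dom c)) j (vcomp c v i)
      (fun y => ncomp g c v i j y - ∑ k, christoffel g c i j k y * vcomp c v k y) := by
  refine (HasWeakPartial.of_contDiffOn isOpen_interior
    ((hv.contDiffOn_vcomp c i).mono interior_subset)).congr_ae EventuallyEq.rfl ?_
  filter_upwards [ae_restrict_mem isOpen_interior.measurableSet] with y hy
  rw [ncomp, partialH_eq_fderiv (interior_mono (dom_subset_HS c) hy)]
  ring

lemma IsWeakCovDeriv.ae_tcomp_eq [CompactSpace M] {g : Metric n M} {u v : VField n M}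
    {T : TField n M} (hT : IsWeakCovDeriv g u T) (hv : IsSmooth v)
    (huv : ∀ᵐ x ∂(vol g), u x = v x) (c : M) :
    ∀ᵐ y ∂(volume.restrict (dom c : Set (Coord n))), ∀ i j,
      tcomp c T i j y = ncomp g c v i j y := by
  have hc := ae_vcomp_eq huv c
  have h1 : ∀ i j, ∀ᵐ y ∂(volume.restrict (dom c : Set (Coord n))),
      tcomp c T i j y = ncomp g c v i j y := by
    intro i j
    have h2 := (hT.2 c i j).congr_ae (f' := vcomp c v i) (h' := fun y => tcomp c T i j y -
      ∑ k, christoffel g c i j k y * vcomp c v k y)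
      (by rw [restrict_interior_dom]; filter_upwards [hc] with y hy using hy i)
      (by
        rw [restrict_interior_dom]
        filter_upwards [hc] with y hy
        simp_rw [hy])
    have h3 := h2.unique isOpen_interior (hasWeakPartial_vcomp (g := g) hv c i j)
    rw [restrict_interior_dom] at h3
    filter_upwards [h3] with y hy
    simpa using hy
  exact ae_all_iff.2 fun i => ae_all_iff.2 fun j => h1 i j

lemma IsWeakCovDeriv.ae_eq_covDeriv [CompactSpace M] {g : Metric n M} {u v : VField n M}
    {T : TField n M} (hT : IsWeakCovDeriv g u T) (hv : IsSmooth v)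
    (huv : ∀ᵐ x ∂(vol g), u x = v x) : ∀ᵐ x ∂(vol g), T x = covDeriv g v x := by
  rw [ae_vol_iff]
  intro c
  filter_upwards [hT.ae_tcomp_eq hv huv c, ae_restrict_mem (measurableSet_dom c)] with y hy hyd
  refine tensor_ext (pt_mem_src hyd) fun i j => ?_
  have h1 := tcomp_covDeriv g hv hyd i j
  rw [tcomp] at h1
  rw [h1, ← hy i j, tcomp]

lemma contDiffOn_ncomp (g : Metric n M) {v : VField n M} (hv : IsSmooth v) (c : M) (i j : Fin n) :
    ContDiffOn ℝ ∞ (ncomp g c v i j) (dom c) :=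
  (contDiffOn_partialH (hv.contDiffOn_vcomp c i) j).add (ContDiffOn.sum fun k _ =>
    (contDiffOn_christoffel g c i j k).mul (hv.contDiffOn_vcomp c k))

lemma deformation_eq_zero_iff (g : Metric n M) {v : VField n M} (hv : IsSmooth v) {c : M}
    {y : Coord n} (hy : y ∈ dom c) : deformation g v (pt c y) = 0 ↔
      ∀ i j, ∑ l, gram g c y i l * ncomp g c v l j y + ∑ l, gram g c y j l * ncomp g c v l i y = 0 := by
  rw [deformation, symPart_eq_zero_iff_comp g (pt_mem_src hy), crd_pt hy]
  have h : ∀ l j, coframe c l (pt c y) (covDeriv g v (pt c y) (frame c j (pt c y))) =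
      ncomp g c v l j y := fun l j => tcomp_covDeriv g hv hy l j
  simp_rw [h]

/-- In a chart the equation is an identity between continuous functions, and each point of the chart
domain is a limit of interior points. This covers boundary points too. -/
lemma deformation_eq_zero_of_ae [CompactSpace M] (g : Metric n M) {v : VField n M}
    (hv : IsSmooth v) (h : ∀ᵐ x ∂(vol g), deformation g v x = 0) (x : M) :
    deformation g v x = 0 := by
  rw [← pt_crd (mem_src_self (n := n) x), deformation_eq_zero_iff g hv (crd_mem_dom (mem_src_self x))]
  intro i j
  have hcont : ContinuousOn (fun y => ∑ l, gram g x y i l * ncomp g x v l j y +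
      ∑ l, gram g x y j l * ncomp g x v l i y) (dom x) :=
    (continuousOn_finsetSum _ fun l _ => (contDiffOn_gram g x i l).continuousOn.mul
      (contDiffOn_ncomp g hv x l j).continuousOn).add
    (continuousOn_finsetSum _ fun l _ => (contDiffOn_gram g x j l).continuousOn.mul
      (contDiffOn_ncomp g hv x l i).continuousOn)
  refine Measure.eqOn_of_ae_eq (μ := volume) ?_ hcont continuousOn_const (dom_subset_closure x)
    (crd_mem_dom (mem_src_self x))
  filter_upwards [(ae_vol_iff g).1 h x, ae_restrict_mem (measurableSet_dom x)] with y hy hyd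
  exact (deformation_eq_zero_iff g hv hyd).1 hy i j

/-- Weak Killing fields are smooth. -/
theorem exists_smooth_of_weakDeformationZero [CompactSpace M] {g : Metric n M} {u : VField n M}
    (hu : WeakDeformationZero g u) :
    ∃ v : VField n M, IsSmooth v ∧ (∀ x, deformation g v x = 0) ∧ ∀ᵐ x ∂(vol g), u x = v x := by
  obtain ⟨T, hT, h0⟩ := hu
  choose w hw hwu using exists_smooth_vrep hT h0
  -- The value at `p` is taken from the representative in the preferred chart of `p`; compatibility
  -- of the representatives then makes this choice immaterial.
  set v : VField n M := fun p => vec p p (w p (crd p p)) with hv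
  have hae : ∀ c : M, ∀ᵐ x ∂(vol g), x ∈ src n c → coords c x (u x) = w c (crd c x) := by
    intro c
    rw [← ae_restrict_iff' (measurableSet_src c), vol_restrict_src, ae_chartVol_iff]
    filter_upwards [hwu c, ae_restrict_mem (measurableSet_dom c)] with y hy hyd
    rw [crd_pt hyd]
    exact hy
  -- Both sides represent `u` almost everywhere on the overlap and are continuous there, so they
  -- agree at every point.
  have hcomp : ∀ c p : M, EqOn (fun y => w c (trans p c y)) (fun y => jac p c y (w p y))
      (overlap p c) := by
    intro c p
    refine Measure.eqOn_of_ae_eq (μ := volume) ?_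
      ((hw c).continuousOn.comp (contDiffOn_trans p c).continuousOn
        fun y hy => (trans_mem_overlap hy).1)
      ((contDiffOn_jac p c).continuousOn.clm_apply ((hw p).continuousOn.mono inter_subset_left))
      (overlap_subset_closure p c)
    have h1 := ae_mono (Measure.restrict_mono (inter_subset_left : overlap p c ⊆ dom p) le_rfl)
      ((ae_vol_iff g).1 ((hae c).and (hae p)) p)
    have hm : MeasurableSet (overlap p c : Set (Coord n)) :=
      measurableSet_dom_inter_preimage (measurableSet_src c)
    filter_upwards [h1, ae_restrict_mem hm] with y hy hyo
    have e1 := hy.1 hyo.2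
    have e2 := hy.2 (pt_mem_src hyo.1)
    rw [coords_change (pt_mem_src hyo.1) hyo.2, e2, crd_pt hyo.1] at e1
    exact e1.symm
  have hrep : ∀ c : M, EqOn (vrep c v) (w c) (dom c) := by
    intro c y hy
    have hp := pt_mem_src hy
    rw [vrep, coords_change (mem_src_self _) hp, hv]
    simp only
    rw [coords_vec (mem_src_self _)]
    have := hcomp c (pt c y) (crd_mem_overlap (mem_src_self _) hp)
    simp only at this
    rw [← this, trans, pt_crd (mem_src_self _), crd_pt hy]
  have hsm : IsSmooth v := isSmooth_of_contDiffOn_vrep fun c => (hw c).congr (hrep c)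
  have huv : ∀ᵐ x ∂(vol g), u x = v x := by
    rw [ae_vol_iff]
    intro c
    filter_upwards [hwu c, ae_restrict_mem (measurableSet_dom c)] with y hy hyd
    exact coords_ext (pt_mem_src hyd) (hy.trans (hrep c hyd).symm)
  refine ⟨v, hsm, deformation_eq_zero_of_ae g hsm ?_, huv⟩
  filter_upwards [h0, hT.ae_eq_covDeriv hsm huv] with x hx hx'
  rw [deformation, ← hx', hx]

end Manifold

/-! ### Uniqueness of Killing fields with vanishing boundary values -/

section Manifold

variable {n : ℕ} [NeZero n] {M : Type*} [TopologicalSpace M]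
  [ChartedSpace (EuclideanHalfSpace n) M] [IsManifold (𝓡∂ n) ∞ M]
  [MeasurableSpace M] [BorelSpace M]

/-! ### Boundary points -/

/-- Whether a point is interior may be decided in any chart of the atlas, so the boundary is `{y 0 =
0}` in every chart, not only in the preferred one of the point. -/
lemma pt_mem_boundary_iff {c : M} {y : Coord n} (hy : y ∈ dom c) :
    pt c y ∈ (𝓡∂ n).boundary M ↔ y 0 = 0 := by
  have h := (𝓡∂ n).isInteriorPoint_iff_of_mem_atlas (n := ∞) (by simp)
    (chart_mem_atlas (EuclideanHalfSpace n) c) (pt_mem_src hy)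
  have e : (chartAt (EuclideanHalfSpace n) c).extend (𝓡∂ n) = extChartAt (𝓡∂ n) c := rfl
  rw [e, show extChartAt (𝓡∂ n) c (pt c y) = y from crd_pt hy] at h
  have h2 : y ∈ interior (extChartAt (𝓡∂ n) c).target ↔ 0 < y 0 := by
    change y ∈ interior (dom c) ↔ _
    rw [interior_dom, mem_inter_iff, mem_interior_HS]
    rw [dom_eq] at hy
    exact and_iff_right hy.1
  have h3 : pt c y ∈ (𝓡∂ n).boundary M ↔ ¬ (𝓡∂ n).IsInteriorPoint (pt c y) :=
    (𝓡∂ n).isBoundaryPoint_iff_not_isInteriorPoint (pt c y)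
  rw [h3, h, h2, not_lt]
  exact ⟨fun h' => le_antisymm h' (mem_HS.1 (dom_subset_HS c hy)), fun h' => h'.le⟩

lemma crd_zero_eq_zero {c p : M} (hp : p ∈ src n c) (hb : p ∈ (𝓡∂ n).boundary M) :
    (crd c p : Coord n) 0 = 0 := by
  rw [← pt_mem_boundary_iff (crd_mem_dom hp), pt_crd hp]
  exact hb

/-- At a boundary point, the tangential derivatives of a function vanishing on the boundary are
zero. -/
lemma hasFDerivWithinAt_stdVec_eq_zero {f : Coord n → ℝ} {f' : Coord n →L[ℝ] ℝ} {y : Coord n}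
    (hf : HasFDerivWithinAt f f' (HS n) y) (h0 : ∀ᶠ z in 𝓝[HS n] y, z 0 = 0 → f z = 0)
    (hy0 : y 0 = 0) {j : Fin n} (hj : j ≠ 0) : f' (stdVec j) = 0 := by
  have hγ : HasDerivAt (fun t : ℝ => y + t • (stdVec j : Coord n)) (stdVec j) 0 := by
    simpa using ((hasDerivAt_id (0 : ℝ)).smul_const (stdVec j : Coord n)).const_add y
  have hz : ∀ t : ℝ, (y + t • (stdVec j : Coord n)) 0 = 0 := fun t => by
    simp [hy0, stdVec_apply, hj.symm]
  have hH : ∀ t : ℝ, y + t • (stdVec j : Coord n) ∈ HS n := fun t => mem_HS.2 (hz t).ge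
  have e0 : y + (0 : ℝ) • (stdVec j : Coord n) = y := by simp
  rw [← e0] at hf
  have h2 := hf.comp_hasDerivAt (0 : ℝ) hγ (Eventually.of_forall hH)
  have h3 : f ∘ (fun t : ℝ => y + t • (stdVec j : Coord n)) =ᶠ[𝓝 0] fun _ => 0 := by
    have h4 : Tendsto (fun t : ℝ => y + t • (stdVec j : Coord n)) (𝓝 0) (𝓝[HS n] y) :=
      tendsto_nhdsWithin_iff.2 ⟨by simpa using hγ.continuousAt.tendsto, Eventually.of_forall hH⟩
    filter_upwards [h4.eventually h0] with t ht
    exact ht (hz t)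
  exact h2.unique ((hasDerivAt_const (0 : ℝ) (0 : ℝ)).congr_of_eventuallyEq h3)

lemma partialH_eq_zero_of_boundary {c : M} {f : Coord n → ℝ} (hf : ContDiffOn ℝ ∞ f (dom c))
    (h0 : ∀ y ∈ (dom c : Set (Coord n)), y 0 = 0 → f y = 0) {y : Coord n} (hy : y ∈ dom c)
    (hy0 : y 0 = 0) {j : Fin n} (hj : j ≠ 0) : partialH j f y = 0 :=
  hasFDerivWithinAt_stdVec_eq_zero (hasFDerivWithinAt_HS hf hy)
    (mem_of_superset (dom_mem_nhdsWithin hy) h0) hy0 hj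

/-! ### Unique continuation for Killing fields -/

/-- The covariant components of a vector field and their derivatives, in the chart around `c`. -/
def jet (g : Metric n M) (c : M) (v : VField n M) (y : Coord n) : Fin n ⊕ Fin n × Fin n → ℝ :=
  fun s => sysVar (lower g c v) (lowerDeriv g c v (covDeriv g v)) s y

lemma contDiffOn_lower (g : Metric n M) {v : VField n M} (hv : IsSmooth v) (c : M) (i : Fin n) :
    ContDiffOn ℝ ∞ (lower g c v i) (dom c) :=
  ContDiffOn.sum fun l _ => (contDiffOn_gram g c i l).mul (hv.contDiffOn_vcomp c l)

lemma lowerDeriv_covDeriv (g : Metric n M) {v : VField n M} (hv : IsSmooth v) {c : M}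
    {y : Coord n} (hy : y ∈ dom c) (i j : Fin n) : lowerDeriv g c v (covDeriv g v) i j y =
      ∑ l, (partialH j (fun z => gram g c z i l) y * vcomp c v l y +
        gram g c y i l * partialH j (vcomp c v l) y) := by
  refine Finset.sum_congr rfl fun l _ => ?_
  rw [tcomp_covDeriv g hv hy, ncomp]
  ring

lemma contDiffOn_jet (g : Metric n M) {v : VField n M} (hv : IsSmooth v) (c : M)
    (s : Fin n ⊕ Fin n × Fin n) : ContDiffOn ℝ ∞ (fun y => jet g c v y s) (dom c) := by
  rcases s with i | ⟨i, j⟩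
  · exact contDiffOn_lower g hv c i
  · refine ContDiffOn.congr (f := fun y => ∑ l, (partialH j (fun z => gram g c z i l) y *
      vcomp c v l y + gram g c y i l * partialH j (vcomp c v l) y)) ?_
      fun y hy => lowerDeriv_covDeriv g hv hy i j
    exact ContDiffOn.sum fun l _ => ((contDiffOn_partialH (contDiffOn_gram g c i l) j).mul
      (hv.contDiffOn_vcomp c l)).add ((contDiffOn_gram g c i l).mul
      (contDiffOn_partialH (hv.contDiffOn_vcomp c l) j))

/-- The weak system holds on the interior of the chart domain, where the weak derivatives of the
smooth jet are the classical ones; continuity extends the identity to the boundary. -/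
lemma partialH_jet (g : Metric n M) {v : VField n M} (hv : IsSmooth v)
    (h0 : ∀ x, deformation g v x = 0) (c : M) (k : Fin n) (s : Fin n ⊕ Fin n × Fin n) :
    EqOn (partialH k fun y => jet g c v y s)
      (fun y => ∑ t, sysCoeff (killingCoeff g c) k s t y * jet g c v y t) (dom c) := by
  refine Measure.eqOn_of_ae_eq (μ := volume) ?_
    (contDiffOn_partialH (contDiffOn_jet g hv c s) k).continuousOn
    (continuousOn_finsetSum _ fun t _ =>
      (contDiffOn_sysCoeff (contDiffOn_killingCoeff g c) k s t).continuousOn.mul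
        (contDiffOn_jet g hv c t).continuousOn) (dom_subset_closure c)
  have h1 := weakSystem_killing (g := g) (u := v) (T := covDeriv g v) c (fun i j => by
    refine (hasWeakPartial_vcomp (g := g) hv c i j).congr_ae EventuallyEq.rfl ?_
    filter_upwards [ae_restrict_mem isOpen_interior.measurableSet] with y hy
    rw [tcomp_covDeriv g hv (interior_subset hy)])
    (Eventually.of_forall fun y => h0 _) k s
  have h2 := h1.unique isOpen_interior (HasWeakPartial.of_contDiffOn isOpen_interior
    ((contDiffOn_jet g hv c s).mono interior_subset))
  rw [← restrict_interior_dom]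
  filter_upwards [h2, ae_restrict_mem isOpen_interior.measurableSet] with y hy hyi
  rw [partialH_eq_fderiv (interior_mono (dom_subset_HS c) hyi)]
  exact hy.symm

lemma hasFDerivWithinAt_jet (g : Metric n M) {v : VField n M} (hv : IsSmooth v)
    (h0 : ∀ x, deformation g v x = 0) {c : M} {y : Coord n} (hy : y ∈ dom c) :
    HasFDerivWithinAt (jet g c v) (sysDeriv (sysCoeff (killingCoeff g c)) y (jet g c v y))
      (dom c) y := by
  rw [hasFDerivWithinAt_pi']
  intro s
  have h1 := hasFDerivWithinAt_dom (contDiffOn_jet g hv c s) hy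
  have e : (ContinuousLinearMap.proj s).comp
      (sysDeriv (sysCoeff (killingCoeff g c)) y (jet g c v y)) =
      fderivWithin ℝ (fun y => jet g c v y s) (HS n) y := by
    ext a
    change sysDeriv (sysCoeff (killingCoeff g c)) y (jet g c v y) a s = _
    rw [sysDeriv_apply]
    conv_rhs => rw [eq_sum_stdVec a, map_sum]
    refine Finset.sum_congr rfl fun j _ => ?_
    rw [map_smul, smul_eq_mul, mul_comm, ← partialH_def, partialH_jet g hv h0 c j s hy]
  rw [e]
  exact h1

/-- Grönwall's inequality along segments of the convex half-ball, with zero initial value. The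
coefficients are bounded there by compactness. -/
lemma jet_eq_zero (g : Metric n M) {v : VField n M} (hv : IsSmooth v)
    (h0 : ∀ x, deformation g v x = 0) {c : M} {r : ℝ} {y₀ x y : Coord n}
    (hr : Metric.closedBall y₀ r ∩ HS n ⊆ dom c) (hx : x ∈ Metric.closedBall y₀ r ∩ HS n)
    (hxj : jet g c v x = 0) (hy : y ∈ Metric.closedBall y₀ r ∩ HS n) : jet g c v y = 0 := by
  have hK := isCompact_closedBall_inter (n := n) y₀ r
  have hb : ∀ j s t, ∃ B, ∀ z ∈ Metric.closedBall y₀ r ∩ HS n,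
      ‖sysCoeff (killingCoeff g c) j s t z‖ ≤ B := fun j s t =>
    hK.exists_bound_of_continuousOn
      ((contDiffOn_sysCoeff (contDiffOn_killingCoeff g c) j s t).continuousOn.mono hr)
  choose B hB using hb
  set B' := ∑ j, ∑ s, ∑ t, |B j s t| with hB'
  have hle : ∀ j s t, |B j s t| ≤ B' := fun j s t => by
    refine (Finset.single_le_sum (f := fun t => |B j s t|) (fun _ _ => abs_nonneg _)
      (Finset.mem_univ t)).trans ?_
    refine (Finset.single_le_sum (f := fun s => ∑ t, |B j s t|)
      (fun _ _ => Finset.sum_nonneg fun _ _ => abs_nonneg _) (Finset.mem_univ s)).trans ?_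
    exact Finset.single_le_sum (f := fun j => ∑ s, ∑ t, |B j s t|)
      (fun _ _ => Finset.sum_nonneg fun _ _ => Finset.sum_nonneg fun _ _ => abs_nonneg _)
      (Finset.mem_univ j)
  have h1 := norm_le_exp_mul_norm_of_convex ((convex_closedBall y₀ r).inter convex_HS)
    (V := jet g c v) (fun z hz => (hasFDerivWithinAt_jet g hv h0 (hr hz)).mono hr)
    (fun z hz => norm_sysDeriv_le (B := B')
      (Finset.sum_nonneg fun _ _ => Finset.sum_nonneg fun _ _ => Finset.sum_nonneg
        fun _ _ => abs_nonneg _)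
      (fun j s t => (hB j s t z hz).trans ((le_abs_self _).trans (hle j s t))) _) hx hy
  rw [hxj, norm_zero, zero_mul] at h1
  exact norm_le_zero_iff.1 h1

lemma eq_zero_of_jet_eq_zero (g : Metric n M) {v : VField n M} {c : M} {y : Coord n}
    (hy : y ∈ dom c) (h : jet g c v y = 0) : v (pt c y) = 0 := by
  refine coords_ext (pt_mem_src hy) ?_
  ext l
  have h1 := raise_lower g hy v l
  have h2 : ∀ m, lower g c v m y = 0 := fun m => congrFun h (.inl m)
  simp only [h2, mul_zero, Finset.sum_const_zero] at h1
  rw [map_zero]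
  exact h1.symm

lemma jet_eq_zero_of_eventually (g : Metric n M) {v : VField n M} (hv : IsSmooth v) {c : M}
    {y : Coord n} (hy : y ∈ dom c) (h : ∀ᶠ x in 𝓝 (pt c y), v x = 0) : jet g c v y = 0 := by
  have hev : ∀ᶠ z in 𝓝[HS n] y, ∀ l, vcomp c v l z = 0 := by
    rw [← nhdsWithin_dom_eq hy]
    filter_upwards [(continuousOn_pt c y hy).eventually h] with z hz l
    rw [vcomp, hz, map_zero]
  have h1 : ∀ l, vcomp c v l y = 0 := hev.self_of_nhdsWithin (dom_subset_HS c hy)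
  have h2 : ∀ l j, partialH j (vcomp c v l) y = 0 := fun l j => by
    have h3 : vcomp c v l =ᶠ[𝓝[HS n] y] fun _ => 0 := hev.mono fun z hz => hz l
    rw [partialH_def, h3.fderivWithin_eq (h1 l)]
    simp
  funext s
  rcases s with i | ⟨i, j⟩
  · change lower g c v i y = 0
    simp [lower, h1]
  · change lowerDeriv g c v (covDeriv g v) i j y = 0
    simp [lowerDeriv_covDeriv g hv hy, h1, h2]

/-- Where `v` vanishes, the Killing equation says that the matrix of derivatives of the covariant
components is skew. Vanishing along the boundary removes all columns with `j ≠ 0`; skewness then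
removes the entries `(i, 0)` with `i ≠ 0`, and the entry `(0, 0)` is its own negative. -/
lemma jet_eq_zero_of_boundary (g : Metric n M) {v : VField n M} (hv : IsSmooth v)
    (h0 : ∀ x, deformation g v x = 0) (hb : ∀ x ∈ (𝓡∂ n).boundary M, v x = 0) {c : M}
    {y : Coord n} (hy : y ∈ dom c) (hy0 : y 0 = 0) : jet g c v y = 0 := by
  have h1 : ∀ z ∈ (dom c : Set (Coord n)), z 0 = 0 → ∀ l, vcomp c v l z = 0 := fun z hz hz0 l => by
    rw [vcomp, hb _ ((pt_mem_boundary_iff hz).2 hz0), map_zero]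
  have h2 : ∀ l j, j ≠ 0 → partialH j (vcomp c v l) y = 0 := fun l j hj =>
    partialH_eq_zero_of_boundary (hv.contDiffOn_vcomp c l) (fun z hz hz0 => h1 z hz hz0 l) hy hy0 hj
  have hlow : ∀ i, lower g c v i y = 0 := fun i => by simp [lower, h1 y hy hy0]
  have hP : ∀ i j, j ≠ 0 → lowerDeriv g c v (covDeriv g v) i j y = 0 := fun i j hj => by
    rw [lowerDeriv_covDeriv g hv hy]
    simp [h1 y hy hy0, h2 _ j hj]
  have hS : ∀ i j, lowerDeriv g c v (covDeriv g v) i j y +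
      lowerDeriv g c v (covDeriv g v) j i y = 0 := fun i j => by
    rw [lowerDeriv_add g hy v (covDeriv g v) (h0 _)]
    simp [hlow]
  funext s
  rcases s with i | ⟨i, j⟩
  · exact hlow i
  · change lowerDeriv g c v (covDeriv g v) i j y = 0
    by_cases hj : j = 0
    · by_cases hi : i = 0
      · have := hS i j
        subst hi; subst hj
        linarith
      · have := hS i j
        rw [hP j i hi] at this
        linarith
    · exact hP i j hj

/-- A Killing field that vanishes on the nonempty boundary vanishes identically. -/
theorem eq_zero_of_killing_of_boundary [ConnectedSpace M] (hbd : ((𝓡∂ n).boundary M).Nonempty)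
    (g : Metric n M) {v : VField n M} (hv : IsSmooth v) (h0 : ∀ x, deformation g v x = 0)
    (hb : ∀ x ∈ (𝓡∂ n).boundary M, v x = 0) (x : M) : v x = 0 := by
  -- Every point has a neighbourhood, the preimage of a half-ball, on which a zero of the jet at any
  -- single point forces `v = 0` throughout.
  have key : ∀ c : M, ∃ N ∈ 𝓝 c, ∀ p ∈ N, p ∈ src n c ∧
      (jet g c v (crd c p) = 0 → ∀ q ∈ N, v q = 0) := by
    intro c
    obtain ⟨r, hr, hrd⟩ := exists_closedBall_inter_subset (crd_mem_dom (mem_src_self (n := n) c))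
    set N : Set M := src n c ∩ crd c ⁻¹' Metric.ball (crd c c : Coord n) r with hN
    have hNo : IsOpen N := (continuousOn_crd c).isOpen_inter_preimage (isOpen_src c) Metric.isOpen_ball
    refine ⟨N, hNo.mem_nhds ⟨mem_src_self c, Metric.mem_ball_self hr⟩, fun p hp => ⟨hp.1, ?_⟩⟩
    intro hj q hq
    have hm : ∀ q ∈ N, (crd c q : Coord n) ∈ Metric.closedBall (crd c c : Coord n) r ∩ HS n :=
      fun q hq => ⟨Metric.ball_subset_closedBall hq.2, dom_subset_HS c (crd_mem_dom hq.1)⟩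
    have := eq_zero_of_jet_eq_zero g (crd_mem_dom hq.1)
      (jet_eq_zero g hv h0 hrd (hm p hp) hj (hm q hq))
    rwa [pt_crd hq.1] at this
  -- The interior of the zero set is open by definition. It is closed because `key` applies at a
  -- limit point, and nonempty because the jet vanishes at the boundary.
  set Z : Set M := {x | ∀ᶠ x' in 𝓝 x, v x' = 0} with hZ
  have hZo : IsOpen Z := isOpen_setOfPred_eventually_nhds
  have hZc : IsClosed Z := by
    refine isClosed_of_closure_subset fun c hc => ?_
    obtain ⟨N, hN, h⟩ := key c
    obtain ⟨p, hpN, hpZ⟩ := mem_closure_iff_nhds.1 hc N hN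
    obtain ⟨hps, h'⟩ := h p hpN
    refine mem_of_superset hN (h' ?_)
    refine jet_eq_zero_of_eventually g hv (crd_mem_dom hps) ?_
    rw [pt_crd hps]
    exact hpZ
  have hZn : Z.Nonempty := by
    obtain ⟨p, hp⟩ := hbd
    obtain ⟨N, hN, h⟩ := key p
    refine ⟨p, mem_of_superset hN ((h p (mem_of_mem_nhds hN)).2 ?_)⟩
    exact jet_eq_zero_of_boundary g hv h0 hb (crd_mem_dom (mem_src_self p))
      (crd_zero_eq_zero (mem_src_self p) hp)
  have hu : Z = univ := IsClopen.eq_univ ⟨hZc, hZo⟩ hZn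
  exact (show x ∈ Z by rw [hu]; trivial).self_of_nhds

end Manifold

/-- Uniform positivity of a continuous family of positive definite matrices on a compact set. -/
lemma exists_pos_mul_sum_sq_le {X ι : Type*} [TopologicalSpace X] [Fintype ι] {K : Set X}
    (hK : IsCompact K) {H : X → Matrix ι ι ℝ} (hH : ∀ i j, ContinuousOn (fun y => H y i j) K)
    (hpos : ∀ y ∈ K, (H y).PosDef) :
    ∃ m > 0, ∀ y ∈ K, ∀ a : ι → ℝ, m * ∑ i, a i ^ 2 ≤ ∑ i, ∑ j, H y i j * a i * a j := by
  have hF : ContinuousOn (fun p : X × EuclideanSpace ℝ ι => ∑ i, ∑ j, H p.1 i j * p.2 i * p.2 j)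
      (K ×ˢ Metric.sphere 0 1) := by
    refine continuousOn_finsetSum _ fun i _ => continuousOn_finsetSum _ fun j _ => ?_
    have h1 : ContinuousOn (fun p : X × EuclideanSpace ℝ ι => H p.1 i j)
        (K ×ˢ Metric.sphere 0 1) := (hH i j).comp continuousOn_fst fun p hp => hp.1
    exact (h1.mul (by fun_prop)).mul (by fun_prop)
  -- The minimum over the compact product of `K` with the unit sphere is positive; homogeneity of
  -- degree two handles all other vectors.
  obtain ⟨m, hm, h⟩ := (hK.prod (isCompact_sphere (0 : EuclideanSpace ℝ ι) 1)).exists_forall_le'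
    hF (a := 0) (by
      rintro ⟨y, a⟩ ⟨hy, ha⟩
      have ha0 : (a : ι → ℝ) ≠ 0 := fun h0 => by
        have : a = 0 := by ext i; exact congrFun h0 i
        simp [this] at ha
      refine ((hpos y hy).dotProduct_mulVec_pos ha0).trans_eq ?_
      simp only [dotProduct, Matrix.mulVec, Finset.mul_sum, Pi.star_apply, star_trivial]
      exact Finset.sum_congr rfl fun i _ => Finset.sum_congr rfl fun j _ => by ring)
  refine ⟨m, hm, fun y hy a => ?_⟩
  set b : EuclideanSpace ℝ ι := WithLp.toLp 2 a with hb
  by_cases h0 : b = 0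
  · have : ∀ i, a i = 0 := fun i => congrArg (fun z : EuclideanSpace ℝ ι => z i) h0
    simp [this]
  have hn : 0 < ‖b‖ := norm_pos_iff.2 h0
  have h1 := h (y, ‖b‖⁻¹ • b) ⟨hy, by simp [norm_smul, hn.ne']⟩
  have h2 : ∑ i, a i ^ 2 = ‖b‖ ^ 2 := (EuclideanSpace.real_norm_sq_eq b).symm
  have h3 : ∑ i, ∑ j, H y i j * (‖b‖⁻¹ • b) i * (‖b‖⁻¹ • b) j =
      (‖b‖ ^ 2)⁻¹ * ∑ i, ∑ j, H y i j * a i * a j := by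
    simp only [Finset.mul_sum]
    refine Finset.sum_congr rfl fun i _ => Finset.sum_congr rfl fun j _ => ?_
    simp only [PiLp.smul_apply, smul_eq_mul, hb]
    ring
  simp only at h1
  rw [h3] at h1
  rw [h2]
  have h4 := mul_le_mul_of_nonneg_right h1 (sq_nonneg ‖b‖)
  rwa [mul_comm (_⁻¹), mul_assoc, inv_mul_cancel₀ (by positivity), mul_one] at h4

section Manifold

variable {n : ℕ} [NeZero n] {M : Type*} [TopologicalSpace M]
  [ChartedSpace (EuclideanHalfSpace n) M] [IsManifold (𝓡∂ n) ∞ M]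
  [MeasurableSpace M] [BorelSpace M]

/-! ### Norms in coordinates -/

lemma normSqV_eq (g : Metric n M) {c p : M} (hp : p ∈ src n c) (v : TangentSpace (𝓡∂ n) p) :
    normSqV g p v = ∑ i, ∑ j, gram g c (crd c p) i j * coframe c i p v * coframe c j p v := by
  rw [normSqV, inner_eq_gramForm g hp, gramForm_apply]; rfl

lemma normSqV_nonneg (g : Metric n M) (p : M) (v : TangentSpace (𝓡∂ n) p) : 0 ≤ normSqV g p v := by
  by_cases h : v = 0
  · simp [h, normSqV]
  · exact (g.pos p v h).le

/-- The coordinates of the chart around `c` identify `ℝⁿ` with the tangent space at `p`. -/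
def vecEquiv {c p : M} (hp : p ∈ src n c) : Coord n ≃ₗ[ℝ] TangentSpace (𝓡∂ n) p where
  toFun := vec c p
  map_add' := map_add _
  map_smul' := map_smul _
  invFun := coords c p
  left_inv := coords_vec hp
  right_inv := vec_coords hp

lemma trace_eq_sum_coframe {c p : M} (hp : p ∈ src n c)
    (S : TangentSpace (𝓡∂ n) p →ₗ[ℝ] TangentSpace (𝓡∂ n) p) :
    LinearMap.trace ℝ (TangentSpace (𝓡∂ n) p) S = ∑ j, coframe c j p (S (frame c j p)) := by
  rw [LinearMap.trace_eq_matrix_trace ℝ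
    ((EuclideanSpace.basisFun (Fin n) ℝ).toBasis.map (vecEquiv hp)), Matrix.trace]
  refine Finset.sum_congr rfl fun j _ => ?_
  rw [Matrix.diag_apply, LinearMap.toMatrix_apply]
  simp only [Module.Basis.map_apply, Module.Basis.map_repr, LinearEquiv.trans_apply]
  rw [OrthonormalBasis.coe_toBasis, EuclideanSpace.basisFun_apply,
    OrthonormalBasis.coe_toBasis_repr_apply, EuclideanSpace.basisFun_repr]
  rfl

lemma coframe_eq_sum_inv (g : Metric n M) {c p : M} (hp : p ∈ src n c)
    (w : TangentSpace (𝓡∂ n) p) (j : Fin n) :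
    coframe c j p w = ∑ l, (gram g c (crd c p))⁻¹ j l * g.inner p w (frame c l p) := by
  have h1 : ∀ l, g.inner p w (frame c l p) = ∑ i, gram g c (crd c p) l i * coframe c i p w := by
    intro l
    rw [g.symm, inner_eq_gramForm g hp, gramForm_apply, frame_eq, coords_vec hp]
    simp only [stdVec_apply]
    simp [coframe_eq]
  simp_rw [h1, Finset.mul_sum, ← mul_assoc]
  rw [Finset.sum_comm]
  simp_rw [← Finset.sum_mul, sum_inv_mul_gram g (crd_mem_dom hp)]
  simp

/-- The squared norm of a `(1,1)`-tensor is the quadratic form of the Kronecker product of the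
metric and its inverse. That product is positive definite, which gives uniform comparison with the
sum of squared components on compact sets. -/
lemma normSqT_eq (g : Metric n M) {c p : M} (hp : p ∈ src n c)
    (S : TangentSpace (𝓡∂ n) p →ₗ[ℝ] TangentSpace (𝓡∂ n) p) :
    normSqT g p S = ∑ s : Fin n × Fin n, ∑ t : Fin n × Fin n,
      (gram g c (crd c p)).kronecker (gram g c (crd c p))⁻¹ s t *
        coframe c s.1 p (S (frame c s.2 p)) * coframe c t.1 p (S (frame c t.2 p)) := by
  rw [normSqT, trace_eq_sum_coframe hp]
  simp_rw [LinearMap.comp_apply, coframe_eq_sum_inv g hp (adj g p S _), inner_adj,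
    inner_eq_gramForm g hp, gramForm_apply, Finset.mul_sum, Fintype.sum_prod_type,
    Matrix.kronecker, Matrix.kroneckerMap_apply]
  have key : ∀ F : Fin n → Fin n → Fin n → Fin n → ℝ,
      ∑ i, ∑ j, ∑ k, ∑ l, F i j k l = ∑ j, ∑ l, ∑ i, ∑ k, F i j k l := fun F =>
    Finset.sum_comm.trans (Finset.sum_congr rfl fun j _ =>
      (Finset.sum_congr rfl fun i _ => Finset.sum_comm).trans Finset.sum_comm)
  conv_rhs => rw [key]
  refine Finset.sum_congr rfl fun j _ => Finset.sum_congr rfl fun l _ =>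
    Finset.sum_congr rfl fun i _ => Finset.sum_congr rfl fun k _ => ?_
  simp only [coframe_eq]
  ring

lemma posDef_kronecker_gram (g : Metric n M) {c : M} {y : Coord n} (hy : y ∈ dom c) :
    ((gram g c y).kronecker (gram g c y)⁻¹).PosDef :=
  (gram_posDef g hy).kronecker (gram_posDef g hy).inv

lemma normSqT_nonneg (g : Metric n M) (p : M)
    (S : TangentSpace (𝓡∂ n) p →ₗ[ℝ] TangentSpace (𝓡∂ n) p) : 0 ≤ normSqT g p S := by
  have h := (posDef_kronecker_gram g (crd_mem_dom (mem_src_self (n := n) p))).posSemidef.dotProduct_mulVec_nonneg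
    fun s => coframe p s.1 p (S (frame p s.2 p))
  rw [normSqT_eq g (mem_src_self p)]
  refine h.trans_eq ?_
  simp only [dotProduct, Matrix.mulVec, Finset.mul_sum, Pi.star_apply, star_trivial]
  exact Finset.sum_congr rfl fun i _ => Finset.sum_congr rfl fun j _ => by ring

lemma exists_mul_sum_sq_le_normSqV (g : Metric n M) {c : M} {K : Set (Coord n)}
    (hK : IsCompact K) (hKd : K ⊆ dom c) : ∃ m > 0, ∀ y ∈ K, ∀ v : VField n M,
      m * ∑ i, vcomp c v i y ^ 2 ≤ normSqV g (pt c y) (v (pt c y)) := by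
  obtain ⟨m, hm, h⟩ := exists_pos_mul_sum_sq_le hK (H := gram g c)
    (fun i j => (contDiffOn_gram g c i j).continuousOn.mono hKd) fun y hy => gram_posDef g (hKd hy)
  refine ⟨m, hm, fun y hy v => ?_⟩
  rw [normSqV_eq g (pt_mem_src (hKd hy)), crd_pt (hKd hy)]
  exact h y hy _

lemma exists_mul_sum_sq_le_normSqT (g : Metric n M) {c : M} {K : Set (Coord n)}
    (hK : IsCompact K) (hKd : K ⊆ dom c) : ∃ m > 0, ∀ y ∈ K, ∀ T : TField n M,
      m * ∑ i, ∑ j, tcomp c T i j y ^ 2 ≤ normSqT g (pt c y) (T (pt c y)) := by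
  obtain ⟨m, hm, h⟩ := exists_pos_mul_sum_sq_le hK
    (H := fun y => (gram g c y).kronecker (gram g c y)⁻¹)
    (fun s t => ((contDiffOn_gram g c s.1 t.1).continuousOn.mul
      (contDiffOn_gram_inv g c s.2 t.2).continuousOn).mono hKd)
    fun y hy => posDef_kronecker_gram g (hKd hy)
  refine ⟨m, hm, fun y hy T => ?_⟩
  rw [normSqT_eq g (pt_mem_src (hKd hy)), crd_pt (hKd hy)]
  have := h y hy fun s => tcomp c T s.1 s.2 y
  rwa [Fintype.sum_prod_type] at this

lemma continuousOn_normSqV (g : Metric n M) {v : VField n M} (hv : IsSmooth v) (c : M) :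
    ContinuousOn (fun y : Coord n => normSqV g (pt c y) (v (pt c y))) (dom c : Set (Coord n)) := by
  refine ContinuousOn.congr (f := fun y => ∑ i, ∑ j, gram g c y i j * vcomp c v i y *
    vcomp c v j y) (continuousOn_finsetSum _ fun i _ => continuousOn_finsetSum _ fun j _ =>
      ((contDiffOn_gram g c i j).continuousOn.mul (hv.contDiffOn_vcomp c i).continuousOn).mul
        (hv.contDiffOn_vcomp c j).continuousOn) fun y hy => ?_
  simp only
  rw [normSqV_eq g (pt_mem_src hy), crd_pt hy]
  rfl

lemma continuousOn_normSqT_covDeriv (g : Metric n M) {v : VField n M} (hv : IsSmooth v) (c : M) :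
    ContinuousOn (fun y : Coord n => normSqT g (pt c y) (covDeriv g v (pt c y))) (dom c : Set (Coord n)) := by
  refine ContinuousOn.congr (f := fun y => ∑ s : Fin n × Fin n, ∑ t : Fin n × Fin n,
      gram g c y s.1 t.1 * (gram g c y)⁻¹ s.2 t.2 * ncomp g c v s.1 s.2 y * ncomp g c v t.1 t.2 y)
    (continuousOn_finsetSum _ fun s _ => continuousOn_finsetSum _ fun t _ =>
      (((contDiffOn_gram g c _ _).continuousOn.mul (contDiffOn_gram_inv g c _ _).continuousOn).mul
        (contDiffOn_ncomp g hv c _ _).continuousOn).mul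
        (contDiffOn_ncomp g hv c _ _).continuousOn) fun y hy => ?_
  simp only
  rw [normSqT_eq g (pt_mem_src hy), crd_pt hy]
  refine Finset.sum_congr rfl fun s _ => Finset.sum_congr rfl fun t _ => ?_
  rw [← tcomp_covDeriv g hv hy, ← tcomp_covDeriv g hv hy]
  rfl

/-- A function that is continuous in all charts is continuous. -/
lemma continuous_of_continuousOn_pt {f : M → ℝ}
    (hf : ∀ c : M, ContinuousOn (fun y : Coord n => f (pt c y)) (dom c)) : Continuous f := by
  refine continuous_iff_continuousAt.2 fun c => ?_
  have h : ContinuousOn f (src n c) :=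
    ((hf c).comp (continuousOn_crd c) fun p hp => crd_mem_dom hp).congr fun p hp => by
      simp only [Function.comp]
      rw [pt_crd hp]
  exact h.continuousAt ((isOpen_src c).mem_nhds (mem_src_self c))

lemma lintegral_ofReal_lt_top [CompactSpace M] (g : Metric n M) {f : M → ℝ} (hf : Continuous f) :
    ∫⁻ x, ENNReal.ofReal (f x) ∂(vol g) < ⊤ := by
  obtain ⟨B, hB⟩ := isCompact_univ.exists_bound_of_continuousOn hf.continuousOn
  refine (lintegral_mono fun x => ENNReal.ofReal_le_ofReal
    ((le_abs_self _).trans (hB x (mem_univ x)))).trans_lt ?_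
  rw [lintegral_const]
  exact ENNReal.mul_lt_top ENNReal.ofReal_lt_top (measure_lt_top _ _)

/-! ### Smooth fields belong to the function spaces -/

lemma IsSmooth.memL2 [CompactSpace M] (g : Metric n M) {v : VField n M} (hv : IsSmooth v) :
    MemL2 g v :=
  ⟨fun c i => (hv.contDiffOn_vcomp c i).continuousOn.aestronglyMeasurable (measurableSet_dom c),
    lintegral_ofReal_lt_top g (continuous_of_continuousOn_pt (continuousOn_normSqV g hv))⟩

lemma MemL2.congr_ae [CompactSpace M] {g : Metric n M} {u v : VField n M} (hv : MemL2 g v)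
    (huv : ∀ᵐ x ∂(vol g), u x = v x) : MemL2 g u := by
  refine ⟨fun c i => (hv.1 c i).congr ?_, ?_⟩
  · filter_upwards [ae_vcomp_eq huv c] with y hy using (hy i).symm
  · refine (lintegral_congr_ae ?_).trans_lt hv.2
    filter_upwards [huv] with x hx
    rw [hx]

lemma IsSmooth.isWeakCovDeriv [CompactSpace M] {g : Metric n M} {u v : VField n M}
    (hv : IsSmooth v) (huv : ∀ᵐ x ∂(vol g), u x = v x) : IsWeakCovDeriv g u (covDeriv g v) := by
  refine ⟨⟨fun c i j => ?_, lintegral_ofReal_lt_top g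
    (continuous_of_continuousOn_pt (continuousOn_normSqT_covDeriv g hv))⟩, fun c i j => ?_⟩
  · exact ((contDiffOn_ncomp g hv c i j).congr fun y hy =>
      tcomp_covDeriv g hv hy i j).continuousOn.aestronglyMeasurable (measurableSet_dom c)
  · refine (hasWeakPartial_vcomp (g := g) hv c i j).congr_ae ?_ ?_
    · rw [restrict_interior_dom]
      filter_upwards [ae_vcomp_eq huv c] with y hy using (hy i).symm
    · rw [restrict_interior_dom]
      filter_upwards [ae_vcomp_eq huv c, ae_restrict_mem (measurableSet_dom c)] with y hy hyd
      simp_rw [hy, tcomp_covDeriv g hv hyd]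

lemma weakDeformationZero_of_killing [CompactSpace M] {g : Metric n M} {u v : VField n M}
    (hv : IsSmooth v) (h0 : ∀ x, deformation g v x = 0) (huv : ∀ᵐ x ∂(vol g), u x = v x) :
    WeakDeformationZero g u :=
  ⟨covDeriv g v, hv.isWeakCovDeriv huv, Eventually.of_forall h0⟩

lemma IsSmooth.memH1 [CompactSpace M] {g : Metric n M} {u v : VField n M}
    (hv : IsSmooth v) (huv : ∀ᵐ x ∂(vol g), u x = v x) : MemH1 g u :=
  ⟨(hv.memL2 g).congr_ae huv, _, hv.isWeakCovDeriv huv⟩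

end Manifold

/-! ### Collar coordinates and the one-dimensional trace inequality -/

section HalfSpace

variable {n : ℕ} [NeZero n]

/-- The point of the half-space above the boundary point `z` at height `t`. -/
def glue (z : BCoord n) (t : ℝ) : Coord n := bincl z + t • stdVec 0

lemma bincl_zero (z : BCoord n) : bincl z 0 = 0 := by simp [bincl]

lemma bincl_apply (z : BCoord n) {i : Fin n} (hi : i ≠ 0) : bincl z i = z ⟨i, hi⟩ := by
  simp [bincl, hi]

lemma glue_zero_apply (z : BCoord n) (t : ℝ) : glue z t 0 = t := by
  simp [glue, bincl_zero, stdVec_apply]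

lemma glue_apply (z : BCoord n) (t : ℝ) {i : Fin n} (hi : i ≠ 0) : glue z t i = z ⟨i, hi⟩ := by
  simp [glue, bincl_apply, stdVec_apply, hi]

lemma glue_zero (z : BCoord n) : glue z 0 = bincl z := by simp [glue]

/-- The tangential coordinates. -/
def bproj (y : Coord n) : BCoord n := WithLp.toLp 2 fun i => y i

lemma bincl_bproj {y : Coord n} (hy : y 0 = 0) : bincl (bproj y) = y := by
  ext i
  by_cases hi : i = 0
  · subst hi; rw [bincl_zero, hy]
  · rw [bincl_apply _ hi]; rfl

lemma bproj_bincl (z : BCoord n) : bproj (bincl z) = z := by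
  ext i
  exact bincl_apply z i.2

lemma continuous_bincl : Continuous (bincl : BCoord n → Coord n) := by
  refine (PiLp.continuous_toLp 2 _).comp (continuous_pi fun i => ?_)
  by_cases hi : i = 0
  · simpa [hi] using continuous_const
  · simp only [ne_eq, hi, not_false_eq_true, dite_true]
    fun_prop

lemma continuous_bproj : Continuous (bproj : Coord n → BCoord n) :=
  (PiLp.continuous_toLp 2 _).comp (continuous_pi fun i => by fun_prop)

lemma continuous_glue : Continuous fun p : BCoord n × ℝ => glue p.1 p.2 :=
  (continuous_bincl.comp continuous_fst).add (continuous_snd.smul continuous_const)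

lemma measurePreserving_glue :
    MeasurePreserving (fun p : BCoord n × ℝ => (glue p.1 p.2 : Coord n)) := by
  -- Only the index `0` is left once the tangential indices are split off, so the second factor of
  -- the product is the line.
  let _ : Unique {i : Fin n // ¬ i ≠ 0} :=
    ⟨⟨⟨0, by simp⟩⟩, fun i => Subtype.ext (not_not.1 i.2)⟩
  set e1 := (MeasurableEquiv.toLp 2 (Fin n → ℝ)).symm with he1
  set e2 := MeasurableEquiv.piEquivPiSubtypeProd (fun _ : Fin n => ℝ) (fun i => i ≠ 0) with he2
  set e3 := MeasurableEquiv.prodCongr (MeasurableEquiv.toLp 2 ({i : Fin n // i ≠ 0} → ℝ))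
    (MeasurableEquiv.funUnique {i : Fin n // ¬ i ≠ 0} ℝ) with he3
  have h1 : MeasurePreserving e1 := EuclideanSpace.volume_preserving_symm_measurableEquiv_toLp _
  have h2 : MeasurePreserving e2 := volume_preserving_piEquivPiSubtypeProd _ _
  have h3 : MeasurePreserving e3 :=
    ((EuclideanSpace.volume_preserving_symm_measurableEquiv_toLp _).symm).prod (by
      convert! volume_preserving_funUnique {i : Fin n // ¬ i ≠ 0} ℝ)
  have h : MeasurePreserving (e1.trans (e2.trans e3)) := h1.trans (h2.trans h3)
  have e : (fun p : BCoord n × ℝ => (glue p.1 p.2 : Coord n)) = (e1.trans (e2.trans e3)).symm := by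
    funext p
    refine ((MeasurableEquiv.symm_apply_eq _).2 (Prod.ext ?_ ?_)).symm
    · ext i
      exact (glue_apply p.1 p.2 i.2).symm
    · exact (glue_zero_apply p.1 p.2).symm
  rw [e]
  exact h.symm _

/-- A one-dimensional trace inequality. -/
lemma mul_sq_le_integral {f f' : ℝ → ℝ} {δ : ℝ} (hδ : 0 < δ) (hf : ContinuousOn f (Icc 0 δ))
    (hf' : ContinuousOn f' (Icc 0 δ)) (h : ∀ t ∈ Ioo 0 δ, HasDerivAt f (f' t) t) :
    δ * f 0 ^ 2 ≤ (1 + δ) * ∫ t in (0 : ℝ)..δ, (f t ^ 2 + f' t ^ 2) := by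
  have hI : ContinuousOn (fun t => f t ^ 2 + f' t ^ 2) (Icc 0 δ) := (hf.pow 2).add (hf'.pow 2)
  have hu : ∀ t ∈ Icc 0 δ, uIcc 0 t ⊆ Icc 0 δ := fun t ht => by
    rw [uIcc_of_le ht.1]; exact Icc_subset_Icc_right ht.2
  have hii : ∀ t ∈ Icc 0 δ, IntervalIntegrable (fun t => f t ^ 2 + f' t ^ 2) volume 0 t :=
    fun t ht => (hI.mono (hu t ht)).intervalIntegrable
  set I := ∫ t in (0 : ℝ)..δ, (f t ^ 2 + f' t ^ 2) with hIdef
  -- By the fundamental theorem `f(0)² = f(t)² - ∫ 2 f f'`, and `-2 f f' ≤ f² + f'²`.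
  have hle : ∀ t ∈ Icc 0 δ, f 0 ^ 2 ≤ f t ^ 2 + I := by
    intro t ht
    have h1 : ∫ s in (0 : ℝ)..t, 2 * f s * f' s = f t ^ 2 - f 0 ^ 2 := by
      refine intervalIntegral.integral_eq_sub_of_hasDerivAt_of_le (f := fun s => f s ^ 2) ht.1
        ((hf.mono (Icc_subset_Icc_right ht.2)).pow 2) (fun s hs => ?_) ?_
      · have := (h s ⟨hs.1, hs.2.trans_le ht.2⟩).fun_pow 2
        simpa using this
      · exact ((continuousOn_const.mul hf).mul hf' |>.mono (hu t ht)).intervalIntegrable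
    have h2 : -(∫ s in (0 : ℝ)..t, 2 * f s * f' s) ≤ ∫ s in (0 : ℝ)..t, (f s ^ 2 + f' s ^ 2) := by
      rw [← intervalIntegral.integral_neg]
      refine intervalIntegral.integral_mono_on ht.1
        ((continuousOn_const.mul hf).mul hf' |>.mono (hu t ht)).intervalIntegrable.neg
        (hii t ht) fun s _ => ?_
      nlinarith [sq_nonneg (f s + f' s)]
    have h3 : ∫ s in (0 : ℝ)..t, (f s ^ 2 + f' s ^ 2) ≤ I :=
      intervalIntegral.integral_mono_interval le_rfl ht.1 ht.2
        (Eventually.of_forall fun s => by positivity) (hii δ ⟨hδ.le, le_rfl⟩)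
    linarith
  -- Integrating over `t` gives `δ f(0)² ≤ I + δ I`.
  have h4 : ∫ _ in (0 : ℝ)..δ, f 0 ^ 2 ≤ ∫ t in (0 : ℝ)..δ, ((f t ^ 2 + f' t ^ 2) + I) := by
    refine intervalIntegral.integral_mono_on hδ.le (by simp)
      ((hii δ ⟨hδ.le, le_rfl⟩).add (by simp)) fun t ht => ?_
    nlinarith [hle t ht, sq_nonneg (f' t)]
  rw [intervalIntegral.integral_add (hii δ ⟨hδ.le, le_rfl⟩) (by simp)] at h4
  simp only [intervalIntegral.integral_const, sub_zero, smul_eq_mul] at h4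
  linarith

/-- Tonelli's theorem in collar coordinates, applied to `F` extended by zero so that the integrand
is measurable on the whole space. -/
lemma lintegral_glue_le {b : Set (BCoord n)} (hb : MeasurableSet b) {K : Set (Coord n)}
    (hK : MeasurableSet K) {δ : ℝ} (hbK : ∀ z ∈ b, ∀ t ∈ Icc 0 δ, glue z t ∈ K)
    {F : Coord n → ℝ} (hF : ContinuousOn F K) :
    ∫⁻ z in b, ∫⁻ t in Icc 0 δ, ENNReal.ofReal (F (glue z t)) ≤ ∫⁻ y in K, ENNReal.ofReal (F y) := by
  classical
  set G : Coord n → ℝ≥0∞ := fun y => ENNReal.ofReal (K.piecewise F (fun _ => 0) y) with hG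
  have hGm : Measurable G :=
    ENNReal.measurable_ofReal.comp (hF.measurable_piecewise continuousOn_const hK)
  calc ∫⁻ z in b, ∫⁻ t in Icc 0 δ, ENNReal.ofReal (F (glue z t))
      = ∫⁻ z in b, ∫⁻ t in Icc 0 δ, G (glue z t) := by
        refine setLIntegral_congr_fun hb fun z hz => setLIntegral_congr_fun measurableSet_Icc
          fun t ht => ?_
        simp [hG, hbK z hz t ht]
    _ ≤ ∫⁻ z : BCoord n, ∫⁻ t : ℝ, G (glue z t) :=
        (setLIntegral_le_lintegral _ _).trans (lintegral_mono fun z => setLIntegral_le_lintegral _ _)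
    _ = ∫⁻ p : BCoord n × ℝ, G (glue p.1 p.2) := by
        rw [← lintegral_prod (μ := (volume : Measure (BCoord n))) (ν := (volume : Measure ℝ))
          (fun p => G (glue p.1 p.2)) (hGm.comp continuous_glue.measurable).aemeasurable]
        rfl
    _ = ∫⁻ y, G y := measurePreserving_glue.lintegral_comp hGm
    _ = ∫⁻ y in K, ENNReal.ofReal (F y) := by
        rw [← lintegral_indicator hK]
        refine lintegral_congr fun y => ?_
        by_cases hy : y ∈ K <;> simp [hG, hy]

end HalfSpace

section Manifold

variable {n : ℕ} [NeZero n] {M : Type*} [TopologicalSpace M]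
  [ChartedSpace (EuclideanHalfSpace n) M] [IsManifold (𝓡∂ n) ∞ M]
  [MeasurableSpace M] [BorelSpace M]

/-! ### The trace inequality -/

lemma hasDerivAt_glue {c : M} {f : Coord n → ℝ} (hf : ContDiffOn ℝ ∞ f (dom c)) {z : BCoord n}
    {t : ℝ} (ht : 0 < t) (hz : glue z t ∈ dom c) :
    HasDerivAt (fun s => f (glue z s)) (partialH 0 f (glue z t)) t := by
  have hγ : HasDerivAt (fun s : ℝ => glue z s) (stdVec 0) t := by
    simpa [glue] using ((hasDerivAt_id t).smul_const (stdVec 0 : Coord n)).const_add (bincl z)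
  rw [partialH_def]
  refine (hasFDerivWithinAt_HS hf hz).comp_hasDerivAt t hγ ?_
  filter_upwards [lt_mem_nhds ht] with s hs
  exact mem_HS.2 (by rw [glue_zero_apply]; exact hs.le)

/-- The one-dimensional inequality on each normal segment of length `δ`, integrated over the
tangential variables. -/
lemma lintegral_boundary_le {c : M} {K : Set (Coord n)} (hK : MeasurableSet K) (hKd : K ⊆ dom c)
    {b : Set (BCoord n)} (hb : MeasurableSet b) {δ : ℝ} (hδ : 0 < δ)
    (hbK : ∀ z ∈ b, ∀ t ∈ Icc 0 δ, glue z t ∈ K) {v : VField n M} (hv : IsSmooth v) :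
    ∫⁻ z in b, ENNReal.ofReal (∑ i, vcomp c v i (bincl z) ^ 2) ≤
      ENNReal.ofReal (δ⁻¹ * (1 + δ)) * ∫⁻ y in K,
        ENNReal.ofReal (∑ i, (vcomp c v i y ^ 2 + partialH 0 (vcomp c v i) y ^ 2)) := by
  set F : Coord n → ℝ := fun y => ∑ i, (vcomp c v i y ^ 2 + partialH 0 (vcomp c v i) y ^ 2) with hF
  have hFi : ∀ i, ContinuousOn (fun y => vcomp c v i y ^ 2 + partialH 0 (vcomp c v i) y ^ 2) K :=
    fun i => (((hv.contDiffOn_vcomp c i).continuousOn.pow 2).add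
      ((contDiffOn_partialH (hv.contDiffOn_vcomp c i) 0).continuousOn.pow 2)).mono hKd
  have hFc : ContinuousOn F K := continuousOn_finsetSum _ fun i _ => hFi i
  have hpt : ∀ z ∈ b, ENNReal.ofReal (∑ i, vcomp c v i (bincl z) ^ 2) ≤
      ENNReal.ofReal (δ⁻¹ * (1 + δ)) * ∫⁻ t in Icc 0 δ, ENNReal.ofReal (F (glue z t)) := by
    intro z hz
    have hg : ContinuousOn (fun t : ℝ => glue z t) (Icc 0 δ) :=
      (continuous_glue.comp (Continuous.prodMk_right z)).continuousOn
    have hm : MapsTo (fun t : ℝ => glue z t) (Icc 0 δ) K := hbK z hz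
    have h1 : ∀ i, δ * vcomp c v i (bincl z) ^ 2 ≤ (1 + δ) * ∫ t in (0 : ℝ)..δ,
        (vcomp c v i (glue z t) ^ 2 + partialH 0 (vcomp c v i) (glue z t) ^ 2) := by
      intro i
      have := mul_sq_le_integral hδ (f := fun t => vcomp c v i (glue z t))
        (f' := fun t => partialH 0 (vcomp c v i) (glue z t))
        ((hv.contDiffOn_vcomp c i).continuousOn.comp hg (hm.mono_right hKd))
        ((contDiffOn_partialH (hv.contDiffOn_vcomp c i) 0).continuousOn.comp hg (hm.mono_right hKd))
        fun t ht => hasDerivAt_glue (hv.contDiffOn_vcomp c i) ht.1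
          (hKd (hm (Ioo_subset_Icc_self ht)))
      simpa [glue_zero] using this
    have hint : ∀ i, IntervalIntegrable (fun t => vcomp c v i (glue z t) ^ 2 +
        partialH 0 (vcomp c v i) (glue z t) ^ 2) volume 0 δ := fun i =>
      ContinuousOn.intervalIntegrable (by
        rw [uIcc_of_le hδ.le]
        exact (hFi i).comp hg hm)
    have h2 : δ * ∑ i, vcomp c v i (bincl z) ^ 2 ≤ (1 + δ) * ∫ t in (0 : ℝ)..δ, F (glue z t) := by
      simp only [hF]
      rw [intervalIntegral.integral_finsetSum fun i _ => hint i, Finset.mul_sum, Finset.mul_sum]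
      exact Finset.sum_le_sum fun i _ => h1 i
    have hFg : IntegrableOn (fun t => F (glue z t)) (Icc 0 δ) :=
      (hFc.comp hg hm).integrableOn_Icc
    rw [intervalIntegral.integral_of_le hδ.le, ← integral_Icc_eq_integral_Ioc] at h2
    rw [← ofReal_integral_eq_lintegral_ofReal hFg (Eventually.of_forall fun t =>
      Finset.sum_nonneg fun i _ => by positivity), ← ENNReal.ofReal_mul (by positivity)]
    refine ENNReal.ofReal_le_ofReal ?_
    rw [mul_assoc, ← div_eq_inv_mul, le_div_iff₀ hδ, mul_comm]
    exact h2
  calc ∫⁻ z in b, ENNReal.ofReal (∑ i, vcomp c v i (bincl z) ^ 2)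
      ≤ ∫⁻ z in b, ENNReal.ofReal (δ⁻¹ * (1 + δ)) *
          ∫⁻ t in Icc 0 δ, ENNReal.ofReal (F (glue z t)) := setLIntegral_mono' hb hpt
    _ = ENNReal.ofReal (δ⁻¹ * (1 + δ)) *
          ∫⁻ z in b, ∫⁻ t in Icc 0 δ, ENNReal.ofReal (F (glue z t)) :=
        lintegral_const_mul' _ _ ENNReal.ofReal_ne_top
    _ ≤ _ := by gcongr; exact lintegral_glue_le hb hK hbK hFc

/-- Components and their normal derivatives are controlled by a field and its covariant
derivative. -/
lemma exists_sum_sq_le (g : Metric n M) {c : M} {K : Set (Coord n)} (hK : IsCompact K)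
    (hKd : K ⊆ dom c) : ∃ C : ℝ, 0 ≤ C ∧ ∀ v : VField n M, IsSmooth v → ∀ y ∈ K,
      ∑ i, (vcomp c v i y ^ 2 + partialH 0 (vcomp c v i) y ^ 2) ≤
        C * (normSqV g (pt c y) (v (pt c y)) + normSqT g (pt c y) (covDeriv g v (pt c y))) := by
  obtain ⟨m, hm, hV⟩ := exists_mul_sum_sq_le_normSqV g hK hKd
  obtain ⟨m', hm', hT⟩ := exists_mul_sum_sq_le_normSqT g hK hKd
  obtain ⟨B, hB⟩ := hK.exists_bound_of_continuousOn (f := fun y => ∑ i, ∑ k,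
    christoffel g c i 0 k y ^ 2) (continuousOn_finsetSum _ fun i _ => continuousOn_finsetSum _
      fun k _ => ((contDiffOn_christoffel g c i 0 k).continuousOn.pow 2).mono hKd)
  -- Here `m` and `m'` compare sums of squared components with the norms of vectors and tensors, and
  -- `B` bounds the Christoffel symbols with lower index `0` that turn normal derivatives into
  -- components of the covariant derivative.
  refine ⟨(1 + 2 * |B|) * m⁻¹ + 2 * m'⁻¹, by positivity, fun v hv y hy => ?_⟩
  set S := ∑ i, vcomp c v i y ^ 2 with hS
  have hS0 : 0 ≤ S := Finset.sum_nonneg fun i _ => sq_nonneg _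
  have h1 : ∀ i, partialH 0 (vcomp c v i) y ^ 2 ≤
      2 * (∑ j, tcomp c (covDeriv g v) i j y ^ 2) + 2 * (∑ k, christoffel g c i 0 k y ^ 2) * S := by
    intro i
    have e : partialH 0 (vcomp c v i) y = tcomp c (covDeriv g v) i 0 y -
        ∑ k, christoffel g c i 0 k y * vcomp c v k y := by
      rw [tcomp_covDeriv g hv (hKd hy), ncomp]; ring
    have h2 := Finset.sum_mul_sq_le_sq_mul_sq Finset.univ (fun k => christoffel g c i 0 k y)
      (fun k => vcomp c v k y)
    have h3 : tcomp c (covDeriv g v) i 0 y ^ 2 ≤ ∑ j, tcomp c (covDeriv g v) i j y ^ 2 :=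
      Finset.single_le_sum (f := fun j => tcomp c (covDeriv g v) i j y ^ 2)
        (fun _ _ => sq_nonneg _) (Finset.mem_univ 0)
    rw [e]
    nlinarith [sq_nonneg (tcomp c (covDeriv g v) i 0 y +
      ∑ k, christoffel g c i 0 k y * vcomp c v k y)]
  have h4 : ∑ i, partialH 0 (vcomp c v i) y ^ 2 ≤
      2 * (∑ i, ∑ j, tcomp c (covDeriv g v) i j y ^ 2) + 2 * |B| * S := by
    refine (Finset.sum_le_sum fun i _ => h1 i).trans ?_
    rw [Finset.sum_add_distrib, ← Finset.mul_sum, ← Finset.sum_mul, ← Finset.mul_sum]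
    have := (le_abs_self _).trans ((hB y hy).trans (le_abs_self B))
    gcongr
  have h5 : S ≤ m⁻¹ * normSqV g (pt c y) (v (pt c y)) := by
    rw [← div_eq_inv_mul, le_div_iff₀ hm, mul_comm]; exact hV y hy v
  have h6 : ∑ i, ∑ j, tcomp c (covDeriv g v) i j y ^ 2 ≤
      m'⁻¹ * normSqT g (pt c y) (covDeriv g v (pt c y)) := by
    rw [← div_eq_inv_mul, le_div_iff₀ hm', mul_comm]; exact hT y hy _
  have h7 := normSqV_nonneg g (pt c y) (v (pt c y))
  have h8 := normSqT_nonneg g (pt c y) (covDeriv g v (pt c y))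
  rw [Finset.sum_add_distrib]
  have h9 : (1 + 2 * |B|) * S ≤ (1 + 2 * |B|) * m⁻¹ * normSqV g (pt c y) (v (pt c y)) := by
    rw [mul_assoc]; gcongr
  have ha : 0 ≤ (1 + 2 * |B|) * m⁻¹ * normSqT g (pt c y) (covDeriv g v (pt c y)) := by positivity
  have hb : 0 ≤ 2 * m'⁻¹ * normSqV g (pt c y) (v (pt c y)) := by positivity
  nlinarith

/-- The volume density is bounded below by a positive constant on a compact subset of the chart
domain. -/
lemma exists_setLIntegral_le_vol (g : Metric n M) {c : M} {K : Set (Coord n)} (hK : IsCompact K)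
    (hKd : K ⊆ dom c) : ∃ C : ℝ≥0∞, C ≠ ⊤ ∧ ∀ f : M → ℝ≥0∞,
      ∫⁻ y in K, f (pt c y) ≤ C * ∫⁻ x, f x ∂(vol g) := by
  obtain ⟨m, hm, h⟩ := hK.exists_forall_le' ((continuousOn_sqrt_gram_det g c).mono hKd) (a := 0)
    fun y hy => Real.sqrt_pos.2 (gram_det_pos g (hKd hy))
  refine ⟨ENNReal.ofReal m⁻¹, ENNReal.ofReal_ne_top, fun f => ?_⟩
  calc ∫⁻ y in K, f (pt c y)
      ≤ ∫⁻ y in K, ENNReal.ofReal m⁻¹ * (cden g c y * f (pt c y)) := by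
        refine setLIntegral_mono' hK.measurableSet fun y hy => ?_
        rw [← mul_assoc, cden, ← ENNReal.ofReal_mul (by positivity)]
        refine le_mul_of_one_le_left' ?_
        rw [ENNReal.one_le_ofReal, ← div_eq_inv_mul, le_div_iff₀ hm, one_mul]
        exact h y hy
    _ = ENNReal.ofReal m⁻¹ * ∫⁻ y in K, cden g c y * f (pt c y) :=
        lintegral_const_mul' _ _ ENNReal.ofReal_ne_top
    _ ≤ ENNReal.ofReal m⁻¹ * ∫⁻ y in dom c, cden g c y * f (pt c y) := by
        gcongr
    _ ≤ _ := by
        rw [← setLIntegral_src]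
        gcongr
        exact Measure.restrict_le_self

/-- The trace inequality near a boundary point. -/
lemma exists_trace_inequality (g : Metric n M) {c : M} {K : Set (Coord n)} (hK : IsCompact K)
    (hKd : K ⊆ dom c) {b : Set (BCoord n)} (hb : MeasurableSet b) {δ : ℝ} (hδ : 0 < δ)
    (hbK : ∀ z ∈ b, ∀ t ∈ Icc 0 δ, glue z t ∈ K) : ∃ C : ℝ≥0∞, C ≠ ⊤ ∧
      ∀ v : VField n M, IsSmooth v →
        ∫⁻ z in b, ENNReal.ofReal (∑ i, vcomp c v i (bincl z) ^ 2) ≤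
          C * (∫⁻ x, ENNReal.ofReal (normSqV g x (v x)) ∂(vol g) +
            ∫⁻ x, ENNReal.ofReal (normSqT g x (covDeriv g v x)) ∂(vol g)) := by
  obtain ⟨C₁, hC₁, h₁⟩ := exists_sum_sq_le g hK hKd
  obtain ⟨C₂, hC₂, h₂⟩ := exists_setLIntegral_le_vol g hK hKd
  refine ⟨ENNReal.ofReal (δ⁻¹ * (1 + δ)) * (ENNReal.ofReal C₁ * C₂),
    ENNReal.mul_ne_top ENNReal.ofReal_ne_top (ENNReal.mul_ne_top ENNReal.ofReal_ne_top hC₂),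
    fun v hv => (lintegral_boundary_le hK.measurableSet hKd hb hδ hbK hv).trans ?_⟩
  rw [mul_assoc]
  gcongr
  have hm : AEMeasurable (fun y => ENNReal.ofReal (normSqV g (pt c y) (v (pt c y))))
      (volume.restrict K) := ENNReal.measurable_ofReal.comp_aemeasurable
    (((continuousOn_normSqV g hv c).mono hKd).aemeasurable hK.measurableSet)
  calc ∫⁻ y in K, ENNReal.ofReal (∑ i, (vcomp c v i y ^ 2 + partialH 0 (vcomp c v i) y ^ 2))
      ≤ ∫⁻ y in K, ENNReal.ofReal C₁ * (ENNReal.ofReal (normSqV g (pt c y) (v (pt c y))) +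
          ENNReal.ofReal (normSqT g (pt c y) (covDeriv g v (pt c y)))) := by
        refine setLIntegral_mono' hK.measurableSet fun y hy => ?_
        rw [← ENNReal.ofReal_add (normSqV_nonneg _ _ _) (normSqT_nonneg _ _ _),
          ← ENNReal.ofReal_mul hC₁]
        exact ENNReal.ofReal_le_ofReal (h₁ v hv y hy)
    _ = ENNReal.ofReal C₁ * ((∫⁻ y in K, ENNReal.ofReal (normSqV g (pt c y) (v (pt c y)))) +
          ∫⁻ y in K, ENNReal.ofReal (normSqT g (pt c y) (covDeriv g v (pt c y)))) := by
        rw [lintegral_const_mul' _ _ ENNReal.ofReal_ne_top, lintegral_add_left' hm]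
    _ ≤ ENNReal.ofReal C₁ * (C₂ * (∫⁻ x, ENNReal.ofReal (normSqV g x (v x)) ∂(vol g)) +
          C₂ * ∫⁻ x, ENNReal.ofReal (normSqT g x (covDeriv g v x)) ∂(vol g)) := by
        gcongr
        · exact h₂ fun x => ENNReal.ofReal (normSqV g x (v x))
        · exact h₂ fun x => ENNReal.ofReal (normSqT g x (covDeriv g v x))
    _ = _ := by rw [← mul_add, mul_assoc]

end Manifold

section Manifold

variable {n : ℕ} [NeZero n] {M : Type*} [TopologicalSpace M]
  [ChartedSpace (EuclideanHalfSpace n) M] [IsManifold (𝓡∂ n) ∞ M]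
  [MeasurableSpace M] [BorelSpace M]

/-! ### The surface measure -/

lemma measurableSet_bdom (c : M) : MeasurableSet (bdom c : Set (BCoord n)) :=
  continuous_bincl.measurable (measurableSet_dom c)

/-- The density of the surface measure in the boundary chart. -/
def sden (g : Metric n M) (c : M) (y : Coord n) : ℝ :=
  √((gram g c y).submatrix (Subtype.val : {i : Fin n // i ≠ 0} → Fin n) Subtype.val).det

lemma continuousOn_sden (g : Metric n M) (c : M) : ContinuousOn (sden g c) (dom c) := by
  refine Real.continuous_sqrt.comp_continuousOn ?_
  simp_rw [Matrix.det_apply']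
  exact continuousOn_finsetSum _ fun σ _ => continuousOn_const.mul
    (continuousOn_finsetProd _ fun i _ => (contDiffOn_gram g c _ _).continuousOn)

lemma sden_pos (g : Metric n M) {c : M} {y : Coord n} (hy : y ∈ dom c) : 0 < sden g c y :=
  Real.sqrt_pos.2 ((gram_posDef g hy).submatrix Subtype.val_injective).det_pos

/-- The surface measure in the boundary chart. -/
def csurf (g : Metric n M) (c : M) : Measure (BCoord n) :=
  (volume.restrict (bdom c)).withDensity fun z => ENNReal.ofReal (sden g c (bincl z))

lemma chartSurf_eq (g : Metric n M) (c : M) :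
    chartSurf g c = (csurf g c).map fun z => pt c (bincl z) := rfl

lemma mapsTo_bincl (c : M) : MapsTo bincl (bdom c) (dom c : Set (Coord n)) := fun _ hz => hz

lemma aemeasurable_sden (g : Metric n M) (c : M) :
    AEMeasurable (fun z : BCoord n => ENNReal.ofReal (sden g c (bincl z)))
      (volume.restrict (bdom c)) :=
  ENNReal.measurable_ofReal.comp_aemeasurable (((continuousOn_sden g c).comp
    continuous_bincl.continuousOn (mapsTo_bincl c)).aemeasurable (measurableSet_bdom c))

lemma csurf_ac (g : Metric n M) (c : M) : csurf g c ≪ volume.restrict (bdom c) :=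
  withDensity_absolutelyContinuous _ _

lemma ac_csurf (g : Metric n M) (c : M) : volume.restrict (bdom c) ≪ csurf g c := by
  refine withDensity_absolutelyContinuous' (aemeasurable_sden g c) ?_
  filter_upwards [ae_restrict_mem (measurableSet_bdom c)] with z hz
  exact (ENNReal.ofReal_pos.2 (sden_pos g hz)).ne'

lemma aemeasurable_pt_bincl (g : Metric n M) (c : M) :
    AEMeasurable (fun z : BCoord n => pt c (bincl z)) (csurf g c) :=
  (((continuousOn_pt c).comp continuous_bincl.continuousOn (mapsTo_bincl c)).aemeasurable
    (measurableSet_bdom c)).mono_ac (csurf_ac g c)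

lemma ae_csurf_mem (g : Metric n M) (c : M) : ∀ᵐ z ∂(csurf g c), z ∈ bdom c :=
  (csurf_ac g c).ae_le (ae_restrict_mem (measurableSet_bdom c))

lemma measurable_bproj_mcrd (c : M) : Measurable fun p : M => (bproj (mcrd c p) : BCoord n) :=
  continuous_bproj.measurable.comp (measurable_mcrd c)

lemma ae_csurf_bproj (g : Metric n M) (c : M) :
    ∀ᵐ z ∂(csurf g c), bproj (mcrd c (pt c (bincl z))) = z := by
  filter_upwards [ae_csurf_mem g c] with z hz
  rw [mcrd_of_mem (pt_mem_src hz), crd_pt hz, bproj_bincl]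

/-- The boundary points in the chart domain around `c`. -/
def bsrc (n : ℕ) [NeZero n] {M : Type*} [TopologicalSpace M]
    [ChartedSpace (EuclideanHalfSpace n) M] (c : M) : Set M :=
  src n c ∩ mcrd c ⁻¹' {y : Coord n | y 0 = 0}

lemma measurableSet_bsrc (c : M) : MeasurableSet (bsrc n c) :=
  (measurableSet_src c).inter (measurable_mcrd c
    ((isClosed_singleton (x := (0 : ℝ))).preimage (by fun_prop :
      Continuous fun y : Coord n => y 0)).measurableSet)

lemma ae_csurf_bsrc (g : Metric n M) (c : M) : ∀ᵐ z ∂(csurf g c), pt c (bincl z) ∈ bsrc n c := by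
  filter_upwards [ae_csurf_mem g c] with z hz
  refine ⟨pt_mem_src hz, ?_⟩
  rw [mem_preimage, mcrd_of_mem (pt_mem_src hz), crd_pt hz]
  exact bincl_zero z

lemma pt_bincl_bproj {c p : M} (hp : p ∈ bsrc n c) :
    pt c (bincl (bproj (mcrd c p : Coord n))) = p := by
  rw [bincl_bproj hp.2, pt_mcrd hp.1]

lemma lintegral_chartSurf (g : Metric n M) (c : M) (f : M → ℝ≥0∞) :
    ∫⁻ x, f x ∂(chartSurf g c) =
      ∫⁻ z in bdom c, ENNReal.ofReal (sden g c (bincl z)) * f (pt c (bincl z)) := by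
  rw [chartSurf_eq, lintegral_map_of_leftInverse (aemeasurable_pt_bincl g c)
    (measurable_bproj_mcrd c) (ae_csurf_bproj g c) (measurableSet_bsrc c) (ae_csurf_bsrc g c)
    (fun _ hx => pt_bincl_bproj hx), csurf,
    lintegral_withDensity_eq_lintegral_mul_non_measurable₀ _ (aemeasurable_sden g c)
      (Eventually.of_forall fun _ => ENNReal.ofReal_lt_top)]
  rfl

lemma ae_chartSurf_iff (g : Metric n M) (c : M) {p : M → Prop} :
    (∀ᵐ x ∂(chartSurf g c), p x) ↔
      ∀ᵐ z ∂(volume.restrict (bdom c : Set (BCoord n))), p (pt c (bincl z)) := by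
  rw [chartSurf_eq, ae_map_iff_of_leftInverse (aemeasurable_pt_bincl g c)
    (measurable_bproj_mcrd c) (ae_csurf_bproj g c) (measurableSet_bsrc c) (ae_csurf_bsrc g c)
    (fun _ hx => pt_bincl_bproj hx)]
  exact ⟨fun h => (ac_csurf g c).ae_le h, fun h => (csurf_ac g c).ae_le h⟩

lemma chartSurf_le_surf (g : Metric n M) (c : M) : chartSurf g c ≤ surf g := le_iSup _ c

lemma ae_bdom_of_ae_surf {g : Metric n M} {p : M → Prop} (h : ∀ᵐ x ∂(surf g), p x) (c : M) :
    ∀ᵐ z ∂(volume.restrict (bdom c : Set (BCoord n))), p (pt c (bincl z)) :=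
  (ae_chartSurf_iff g c).1 (ae_mono (chartSurf_le_surf g c) h)

/-- Every chart surface measure is carried by the boundary, so the top measure restricted to the
closed boundary dominates all of them and hence their supremum. -/
lemma ae_surf_mem_boundary (g : Metric n M) : ∀ᵐ x ∂(surf g), x ∈ (𝓡∂ n).boundary M := by
  have hm : MeasurableSet ((𝓡∂ n).boundary M) :=
    ((𝓡∂ n).isClosed_boundary (n := ∞) (by simp)).measurableSet
  have hle : surf g ≤ (⊤ : Measure M).restrict ((𝓡∂ n).boundary M) := by
    refine iSup_le fun c => ?_
    have h1 : ∀ᵐ x ∂(chartSurf g c), x ∈ (𝓡∂ n).boundary M := by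
      rw [ae_chartSurf_iff]
      filter_upwards [ae_restrict_mem (measurableSet_bdom c)] with z hz
      exact (pt_mem_boundary_iff hz).2 (bincl_zero z)
    rw [← Measure.restrict_eq_self_of_ae_mem h1]
    exact Measure.restrict_mono le_rfl le_top
  exact ae_mono hle (ae_restrict_mem hm)

lemma exists_setLIntegral_le_surf (g : Metric n M) {c : M} {K : Set (Coord n)} (hK : IsCompact K)
    (hKd : K ⊆ dom c) {b : Set (BCoord n)} (hb : MeasurableSet b) (hbK : MapsTo bincl b K) :
    ∃ C : ℝ≥0∞, C ≠ ⊤ ∧ ∀ f : M → ℝ≥0∞,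
      ∫⁻ z in b, f (pt c (bincl z)) ≤ C * ∫⁻ x, f x ∂(surf g) := by
  obtain ⟨m, hm, h⟩ := hK.exists_forall_le' ((continuousOn_sden g c).mono hKd) (a := 0)
    fun y hy => sden_pos g (hKd hy)
  refine ⟨ENNReal.ofReal m⁻¹, ENNReal.ofReal_ne_top, fun f => ?_⟩
  calc ∫⁻ z in b, f (pt c (bincl z))
      ≤ ∫⁻ z in b, ENNReal.ofReal m⁻¹ *
          (ENNReal.ofReal (sden g c (bincl z)) * f (pt c (bincl z))) := by
        refine setLIntegral_mono' hb fun z hz => ?_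
        rw [← mul_assoc, ← ENNReal.ofReal_mul (by positivity)]
        refine le_mul_of_one_le_left' ?_
        rw [ENNReal.one_le_ofReal, ← div_eq_inv_mul, le_div_iff₀ hm, one_mul]
        exact h _ (hbK hz)
    _ = ENNReal.ofReal m⁻¹ *
          ∫⁻ z in b, ENNReal.ofReal (sden g c (bincl z)) * f (pt c (bincl z)) :=
        lintegral_const_mul' _ _ ENNReal.ofReal_ne_top
    _ ≤ ENNReal.ofReal m⁻¹ *
          ∫⁻ z in bdom c, ENNReal.ofReal (sden g c (bincl z)) * f (pt c (bincl z)) := by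
        gcongr
        exact fun z hz => hKd (hbK hz)
    _ ≤ _ := by
        rw [← lintegral_chartSurf]
        gcongr
        exact chartSurf_le_surf g c

/-! ### Differences of fields -/

lemma vrep_sub (c : M) (s v : VField n M) :
    vrep c (fun x => s x - v x) = fun y => vrep c s y - vrep c v y := by
  funext y; simp [vrep]

lemma vcomp_sub (c : M) (s v : VField n M) (i : Fin n) :
    vcomp c (fun x => s x - v x) i = fun y => vcomp c s i y - vcomp c v i y := by
  funext y; simp [vcomp]

lemma IsSmooth.sub {s v : VField n M} (hs : IsSmooth s) (hv : IsSmooth v) :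
    IsSmooth fun x => s x - v x :=
  isSmooth_of_contDiffOn_vrep fun c => by
    rw [vrep_sub]
    exact (hs.contDiffOn_vrep c).sub (hv.contDiffOn_vrep c)

lemma ncomp_sub (g : Metric n M) {s v : VField n M} (hs : IsSmooth s) (hv : IsSmooth v) {c : M}
    {y : Coord n} (hy : y ∈ dom c) (i j : Fin n) :
    ncomp g c (fun x => s x - v x) i j y = ncomp g c s i j y - ncomp g c v i j y := by
  have h1 : partialH j (vcomp c (fun x => s x - v x) i) y =
      partialH j (vcomp c s i) y - partialH j (vcomp c v i) y := by
    rw [vcomp_sub, partialH_def, partialH_def, partialH_def,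
      ((hasFDerivWithinAt_HS (hs.contDiffOn_vcomp c i) hy).fun_sub
        (hasFDerivWithinAt_HS (hv.contDiffOn_vcomp c i) hy)).fderivWithin
        (uniqueDiffOn_HS y (dom_subset_HS c hy)), _root_.sub_apply]
  rw [ncomp, ncomp, ncomp, h1]
  simp only [vcomp_sub, mul_sub, Finset.sum_sub_distrib]
  ring

lemma covDeriv_sub (g : Metric n M) {s v : VField n M} (hs : IsSmooth s) (hv : IsSmooth v) (x : M) :
    covDeriv g (fun x => s x - v x) x = covDeriv g s x - covDeriv g v x := by
  rw [covDeriv_eq, covDeriv_eq, covDeriv_eq, tensorOf, tensorOf, tensorOf]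
  simp_rw [ncomp_sub g hs hv (crd_mem_dom (mem_src_self x)), sub_smul, Finset.sum_sub_distrib]

/-! ### Traces of smooth fields -/

/-- A compact half-ball around a boundary point contains a product of a tangential neighbourhood
with a normal segment, by continuity of `glue`. -/
lemma exists_collar {c : M} {y : Coord n} (hy : y ∈ dom c) (hy0 : y 0 = 0) :
    ∃ (K : Set (Coord n)) (b : Set (BCoord n)) (δ : ℝ), IsCompact K ∧ K ⊆ dom c ∧ IsOpen b ∧
      bproj y ∈ b ∧ 0 < δ ∧ ∀ z ∈ b, ∀ t ∈ Icc 0 δ, glue z t ∈ K := by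
  obtain ⟨r, hr, hrd⟩ := exists_closedBall_inter_subset hy
  have h1 : (fun p : BCoord n × ℝ => glue p.1 p.2) ⁻¹' Metric.ball y r ∈ 𝓝 (bproj y, (0 : ℝ)) := by
    refine continuous_glue.continuousAt.preimage_mem_nhds (Metric.isOpen_ball.mem_nhds ?_)
    simp only [glue_zero, bincl_bproj hy0]
    exact Metric.mem_ball_self hr
  obtain ⟨b, hb, s, hs, hbs⟩ := mem_nhds_prod_iff.1 h1
  obtain ⟨b', hb', hbo, hyb⟩ := mem_nhds_iff.1 hb
  obtain ⟨δ, hδ, hδs⟩ := Metric.nhds_basis_closedBall.mem_iff.1 hs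
  refine ⟨Metric.closedBall y r ∩ HS n, b', δ, isCompact_closedBall_inter y r, hrd, hbo, hyb, hδ, fun z hz t ht => ⟨?_, ?_⟩⟩
  · have h2 : t ∈ s := hδs (by
      rw [Metric.mem_closedBall, Real.dist_eq, sub_zero, abs_of_nonneg ht.1]
      exact ht.2)
    have h3 : glue z t ∈ Metric.ball y r := @hbs (z, t) ⟨hb' hz, h2⟩
    exact Metric.ball_subset_closedBall h3
  · rw [mem_HS, glue_zero_apply]
    exact ht.1

/-- The trace of a smooth field is its restriction to the boundary. -/
lemma HasTrace.ae_eq [CompactSpace M] {g : Metric n M} {u v w : VField n M} (hw : HasTrace g u w)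
    (hv : IsSmooth v) (huv : ∀ᵐ x ∂(vol g), u x = v x) {c : M} {y : Coord n} (hy : y ∈ dom c)
    (hy0 : y 0 = 0) : ∃ b : Set (BCoord n), IsOpen b ∧ bproj y ∈ b ∧ b ⊆ bdom c ∧
      ∀ᵐ z ∂(volume.restrict b), ∀ i, vcomp c w i (bincl z) = vcomp c v i (bincl z) := by
  obtain ⟨K, b, δ, hK, hKd, hb, hyb, hδ, hbK⟩ := exists_collar hy hy0
  have hbK0 : MapsTo bincl b K := fun z hz => by
    rw [← glue_zero]; exact hbK z hz 0 ⟨le_rfl, hδ.le⟩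
  have hbd : b ⊆ bdom c := fun z hz => hKd (hbK0 hz)
  refine ⟨b, hb, hyb, hbd, ?_⟩
  obtain ⟨hwm, T, s, hT, hs, hA, hB, hC⟩ := hw
  obtain ⟨C₁, hC₁, h₁⟩ := exists_trace_inequality g hK hKd hb.measurableSet hδ hbK
  obtain ⟨C₂, hC₂, h₂⟩ := exists_setLIntegral_le_surf g hK hKd hb.measurableSet hbK0
  obtain ⟨m, hm, h₃⟩ := exists_mul_sum_sq_le_normSqV g hK hKd
  -- The squared distance of the proposed trace `w` from the restriction of `v`. The approximating
  -- sequence is compared with `v` by the trace inequality and with `w` by the definition of trace,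
  -- so the integral of `E` is bounded by quantities tending to zero.
  set E : BCoord n → ℝ := fun z => ∑ i, (vcomp c w i (bincl z) - vcomp c v i (bincl z)) ^ 2 with hE
  have hTv := hT.ae_eq_covDeriv hv huv
  have key : ∀ {p q r : ℝ}, 0 ≤ p → 0 ≤ q → r ≤ 2 * p + 2 * q →
      ENNReal.ofReal r ≤ 2 * ENNReal.ofReal p + 2 * ENNReal.ofReal q := by
    intro p q r hp hq hr
    rw [show (2 : ℝ≥0∞) = ENNReal.ofReal 2 by simp, ← ENNReal.ofReal_mul (by norm_num),
      ← ENNReal.ofReal_mul (by norm_num), ← ENNReal.ofReal_add (by positivity) (by positivity)]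
    exact ENNReal.ofReal_le_ofReal hr
  have hA' : ∀ k, ∫⁻ x, ENNReal.ofReal (normSqV g x (s k x - v x)) ∂(vol g) =
      ∫⁻ x, ENNReal.ofReal (normSqV g x (s k x - u x)) ∂(vol g) := fun k => by
    refine lintegral_congr_ae ?_
    filter_upwards [huv] with x hx
    rw [hx]
  have hB' : ∀ k, ∫⁻ x, ENNReal.ofReal (normSqT g x (covDeriv g (fun x => s k x - v x) x)) ∂(vol g) =
      ∫⁻ x, ENNReal.ofReal (normSqT g x (covDeriv g (s k) x - T x)) ∂(vol g) := fun k => by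
    refine lintegral_congr_ae ?_
    filter_upwards [hTv] with x hx
    rw [hx, covDeriv_sub g (hs k) hv]
  have hbound : ∀ k, ∫⁻ z in b, ENNReal.ofReal (E z) ≤
      2 * (C₁ * (∫⁻ x, ENNReal.ofReal (normSqV g x (s k x - u x)) ∂(vol g) +
        ∫⁻ x, ENNReal.ofReal (normSqT g x (covDeriv g (s k) x - T x)) ∂(vol g))) +
      2 * (ENNReal.ofReal m⁻¹ *
        (C₂ * ∫⁻ x, ENNReal.ofReal (normSqV g x (s k x - w x)) ∂(surf g))) := by
    intro k
    have hz := (hs k).sub hv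
    have hmeas : AEMeasurable (fun z : BCoord n => ENNReal.ofReal
        (∑ i, vcomp c (fun x => s k x - v x) i (bincl z) ^ 2)) (volume.restrict b) :=
      ENNReal.measurable_ofReal.comp_aemeasurable (ContinuousOn.aemeasurable
        (continuousOn_finsetSum _ fun i _ => (((hz.contDiffOn_vcomp c i).continuousOn.comp
          continuous_bincl.continuousOn ((mapsTo_bincl c).mono_left hbd)).pow 2)) hb.measurableSet)
    have e1 : ∫⁻ z in b, ENNReal.ofReal (∑ i, vcomp c (fun x => s k x - w x) i (bincl z) ^ 2) ≤
        ENNReal.ofReal m⁻¹ *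
          (C₂ * ∫⁻ x, ENNReal.ofReal (normSqV g x (s k x - w x)) ∂(surf g)) := by
      refine le_trans ?_ (mul_le_mul_right (h₂ fun x =>
        ENNReal.ofReal (normSqV g x (s k x - w x))) _)
      rw [← lintegral_const_mul' _ _ ENNReal.ofReal_ne_top]
      refine setLIntegral_mono' hb.measurableSet fun z hz => ?_
      rw [← ENNReal.ofReal_mul (by positivity)]
      refine ENNReal.ofReal_le_ofReal ?_
      rw [← div_eq_inv_mul, le_div_iff₀ hm, mul_comm]
      exact h₃ _ (hbK0 hz) fun x => s k x - w x
    have e2 := h₁ _ hz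
    rw [hB', hA'] at e2
    calc ∫⁻ z in b, ENNReal.ofReal (E z)
        ≤ ∫⁻ z in b, (2 * ENNReal.ofReal (∑ i, vcomp c (fun x => s k x - v x) i (bincl z) ^ 2) +
            2 * ENNReal.ofReal (∑ i, vcomp c (fun x => s k x - w x) i (bincl z) ^ 2)) := by
          refine lintegral_mono fun z => ?_
          refine key (Finset.sum_nonneg fun _ _ => sq_nonneg _)
            (Finset.sum_nonneg fun _ _ => sq_nonneg _) ?_
          simp only [hE, Finset.mul_sum, ← Finset.sum_add_distrib, vcomp_sub]
          refine Finset.sum_le_sum fun i _ => ?_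
          -- For `a = s - v` and `b = s - w`, the defect in `(a - b)² ≤ 2a² + 2b²` is `(a + b)²`.
          nlinarith [sq_nonneg (2 * vcomp c (s k) i (bincl z) - vcomp c v i (bincl z) -
            vcomp c w i (bincl z))]
      _ = 2 * (∫⁻ z in b, ENNReal.ofReal (∑ i, vcomp c (fun x => s k x - v x) i (bincl z) ^ 2)) +
            2 * ∫⁻ z in b, ENNReal.ofReal (∑ i, vcomp c (fun x => s k x - w x) i (bincl z) ^ 2) := by
          rw [lintegral_add_left' (hmeas.const_mul 2), lintegral_const_mul' _ _ (by simp),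
            lintegral_const_mul' _ _ (by simp)]
      _ ≤ _ := by gcongr
  have h0 : ∫⁻ z in b, ENNReal.ofReal (E z) = 0 := by
    refine le_antisymm (ge_of_tendsto' (x := (atTop : Filter ℕ)) ?_ hbound) bot_le
    have t1 := ENNReal.Tendsto.const_mul (a := 2) (ENNReal.Tendsto.const_mul (a := C₁)
      (hA.add hB) (Or.inr hC₁)) (Or.inr (by simp))
    have t2 := ENNReal.Tendsto.const_mul (a := 2) (ENNReal.Tendsto.const_mul
      (a := ENNReal.ofReal m⁻¹) (ENNReal.Tendsto.const_mul (a := C₂) hC (Or.inr hC₂))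
      (Or.inr ENNReal.ofReal_ne_top)) (Or.inr (by simp))
    simpa using t1.add t2
  have hEm : AEMeasurable (fun z => ENNReal.ofReal (E z)) (volume.restrict b) := by
    refine ENNReal.measurable_ofReal.comp_aemeasurable (Finset.aemeasurable_fun_sum _ fun i _ => ?_)
    refine AEMeasurable.pow_const (AEMeasurable.sub ?_ ?_) 2
    · exact ((hwm c i).mono_measure (Measure.restrict_mono hbd le_rfl)).aemeasurable
    · exact ((hv.contDiffOn_vcomp c i).continuousOn.comp
          continuous_bincl.continuousOn ((mapsTo_bincl c).mono_left hbd)).aemeasurable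
            hb.measurableSet
  filter_upwards [(lintegral_eq_zero_iff' hEm).1 h0] with z hz i
  have h4 : E z ≤ 0 := ENNReal.ofReal_eq_zero.1 hz
  have h5 : (vcomp c w i (bincl z) - vcomp c v i (bincl z)) ^ 2 ≤ E z :=
    Finset.single_le_sum (f := fun i => (vcomp c w i (bincl z) - vcomp c v i (bincl z)) ^ 2)
      (fun _ _ => sq_nonneg _) (Finset.mem_univ i)
  nlinarith [sq_nonneg (vcomp c w i (bincl z) - vcomp c v i (bincl z))]

/-- Equality almost everywhere on a boundary patch becomes equality at every point by continuity of
`v`. Working with a single component serves both boundary conditions: every `i` for `u = 0`, and `i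
= 0` for the normal one. -/
lemma HasTrace.vcomp_eq_zero [CompactSpace M] {g : Metric n M} {u v w : VField n M}
    (hw : HasTrace g u w) (hv : IsSmooth v) (huv : ∀ᵐ x ∂(vol g), u x = v x) {c : M} {i : Fin n}
    (h : ∀ᵐ x ∂(surf g), x ∈ src n c → x ∈ (𝓡∂ n).boundary M → coframe c i x (w x) = 0)
    {y : Coord n} (hy : y ∈ dom c) (hy0 : y 0 = 0) : vcomp c v i y = 0 := by
  obtain ⟨b, hb, hyb, hbd, hae⟩ := hw.ae_eq hv huv hy hy0
  have h1 : (fun z => vcomp c v i (bincl z)) =ᵐ[volume.restrict b] fun _ => 0 := by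
    filter_upwards [hae, ae_mono (Measure.restrict_mono hbd le_rfl) (ae_bdom_of_ae_surf h c),
      ae_restrict_mem hb.measurableSet] with z hz hz' hzb
    rw [← hz i]
    exact hz' (pt_mem_src (hbd hzb)) ((pt_mem_boundary_iff (hbd hzb)).2 (bincl_zero z))
  have h2 := Measure.eqOn_open_of_ae_eq h1 hb ((hv.contDiffOn_vcomp c i).continuousOn.comp
    continuous_bincl.continuousOn ((mapsTo_bincl c).mono_left hbd)) continuousOn_const hyb
  simp only [bincl_bproj hy0] at h2
  exact h2

/-! ### The normal component -/

/-- Coordinate changes map the boundary to the boundary, so the `0`-component of the change has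
vanishing tangential derivatives. The `0`-components of a boundary vector in two charts are
therefore proportional. -/
lemma coframe_zero_of_boundary {c d x : M} (hc : x ∈ src n c) (hd : x ∈ src n d)
    (hb : x ∈ (𝓡∂ n).boundary M) {v : TangentSpace (𝓡∂ n) x} (h : coframe c 0 x v = 0) :
    coframe d 0 x v = 0 := by
  have hy : (crd c x : Coord n) ∈ overlap c d := crd_mem_overlap hc hd
  have hf : HasFDerivWithinAt (fun y => trans c d y 0)
      ((EuclideanSpace.proj 0 : Coord n →L[ℝ] ℝ).comp (jac c d (crd c x))) (HS n) (crd c x) :=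
    ((EuclideanSpace.proj 0 : Coord n →L[ℝ] ℝ).hasFDerivAt.comp_hasFDerivWithinAt _
      (hasFDerivWithinAt_trans hy)).mono_of_mem_nhdsWithin (overlap_mem_nhdsWithin hy)
  have h0 : ∀ j ≠ 0, jac c d (crd c x) (stdVec j) 0 = 0 := fun j hj =>
    hasFDerivWithinAt_stdVec_eq_zero hf (mem_of_superset (overlap_mem_nhdsWithin hy)
      fun z hz hz0 => crd_zero_eq_zero hz.2 ((pt_mem_boundary_iff hz.1).2 hz0))
      (crd_zero_eq_zero hc hb) hj
  rw [coframe_eq, coords_change hc hd, eq_sum_stdVec (coords c x v), map_sum]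
  simp only [map_smul, WithLp.ofLp_sum, Finset.sum_apply, PiLp.smul_apply, smul_eq_mul]
  refine Finset.sum_eq_zero fun j _ => ?_
  by_cases hj : j = 0
  · subst hj
    rw [← coframe_eq, h, zero_mul]
  · rw [h0 j hj, mul_zero]

/-- In the chart at `x` the normal component is `-(g⁰⁰)^(-1/2) v⁰`, since pairing with `g⁰ʲ ∂/∂xʲ`
extracts the `0`-component. Tangency is thus readable in any chart. -/
lemma inner_normal_eq_zero_iff (g : Metric n M) {c x : M} (hc : x ∈ src n c)
    (hb : x ∈ (𝓡∂ n).boundary M) (v : TangentSpace (𝓡∂ n) x) :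
    g.inner x v (normal g x) = 0 ↔ coframe c 0 x v = 0 := by
  have h1 : g.inner x v (normal g x) =
      -((√((gram g x (crd x x))⁻¹ 0 0))⁻¹ * coframe x 0 x v) := by
    rw [coframe_eq_sum_inv g (mem_src_self x), normal]
    simp only [map_neg, map_smul, map_sum, smul_eq_mul]
  have h2 : 0 < (gram g x (crd x x))⁻¹ 0 0 :=
    (gram_posDef g (crd_mem_dom (mem_src_self x))).inv.diag_pos
  rw [h1, neg_eq_zero, mul_eq_zero, or_iff_right (inv_ne_zero (Real.sqrt_pos.2 h2).ne')]
  exact ⟨coframe_zero_of_boundary (mem_src_self x) hc hb,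
    coframe_zero_of_boundary hc (mem_src_self x) hb⟩

lemma HasTrace.eq_zero_of_boundary [CompactSpace M] {g : Metric n M} {u v w : VField n M}
    (hw : HasTrace g u w) (hv : IsSmooth v) (huv : ∀ᵐ x ∂(vol g), u x = v x)
    (h : ∀ᵐ x ∂(surf g), w x = 0) {x : M} (hx : x ∈ (𝓡∂ n).boundary M) : v x = 0 := by
  refine coords_ext (mem_src_self x) ?_
  ext i
  have := hw.vcomp_eq_zero hv huv (c := x) (i := i) (h.mono fun x hx _ _ => by rw [hx, map_zero])
    (crd_mem_dom (mem_src_self x)) (crd_zero_eq_zero (mem_src_self x) hx)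
  rw [vcomp, pt_crd (mem_src_self x)] at this
  rw [map_zero]
  exact this

lemma HasTrace.inner_normal_eq_zero [CompactSpace M] {g : Metric n M} {u v w : VField n M}
    (hw : HasTrace g u w) (hv : IsSmooth v) (huv : ∀ᵐ x ∂(vol g), u x = v x)
    (h : ∀ᵐ x ∂(surf g), g.inner x (w x) (normal g x) = 0) {x : M}
    (hx : x ∈ (𝓡∂ n).boundary M) : g.inner x (v x) (normal g x) = 0 := by
  rw [inner_normal_eq_zero_iff g (mem_src_self x) hx]
  have := hw.vcomp_eq_zero hv huv (c := x) (i := 0)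
    (h.mono fun x hx hs hb => (inner_normal_eq_zero_iff g hs hb _).1 hx)
    (crd_mem_dom (mem_src_self x)) (crd_zero_eq_zero (mem_src_self x) hx)
  rwa [vcomp, pt_crd (mem_src_self x)] at this

/-- The constant sequence `v` is admissible in the definition of trace. -/
lemma IsSmooth.hasTrace [CompactSpace M] {g : Metric n M} {u v : VField n M} (hv : IsSmooth v)
    (huv : ∀ᵐ x ∂(vol g), u x = v x) : HasTrace g u v := by
  refine ⟨fun c i => ContinuousOn.aestronglyMeasurable ((hv.contDiffOn_vcomp c i).continuousOn.comp
      continuous_bincl.continuousOn (mapsTo_bincl c)) (measurableSet_bdom c),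
    covDeriv g v, fun _ => v, hv.isWeakCovDeriv huv, fun _ => hv, ?_, ?_, ?_⟩
  · refine tendsto_const_nhds.congr fun _ => (Eq.symm ?_)
    refine (lintegral_congr_ae (g := fun _ => 0) ?_).trans (lintegral_zero)
    filter_upwards [huv] with x hx
    simp [hx, normSqV]
  · simp [normSqT, adj]
  · simp [normSqV]

end Manifold

/-! ### A Gauss theorem for weak derivatives on the half-space -/

section WeakGauss

variable {n : ℕ} [NeZero n]

/-- A cutoff that vanishes near the boundary of the half-space. -/
def collarCutoff (m : ℕ) (y : Coord n) : ℝ := Real.smoothTransition ((m + 1) * y 0 - 1)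

lemma contDiff_collarCutoff (m : ℕ) : ContDiff ℝ ∞ (collarCutoff m : Coord n → ℝ) :=
  Real.smoothTransition.contDiff.comp (by fun_prop)

lemma fderiv_collarCutoff (m : ℕ) (y : Coord n) (v : Coord n) :
    fderiv ℝ (collarCutoff m) y v =
      deriv Real.smoothTransition ((m + 1) * y 0 - 1) * ((m + 1) * v 0) := by
  have h1 : HasDerivAt Real.smoothTransition
      (deriv Real.smoothTransition ((m + 1) * y 0 - 1)) ((m + 1) * y 0 - 1) :=
    ((Real.smoothTransition.contDiff (n := ⊤)).differentiable (by simp) _).hasDerivAt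
  have h2 : HasFDerivAt (fun y : Coord n => ((m : ℝ) + 1) * y 0 - 1)
      (((m : ℝ) + 1) • (EuclideanSpace.proj 0 : Coord n →L[ℝ] ℝ)) y :=
    ((EuclideanSpace.proj 0 : Coord n →L[ℝ] ℝ).hasFDerivAt.const_mul _).sub_const 1
  have h3 := (h1.comp_hasFDerivAt y h2).fderiv
  rw [show collarCutoff m = Real.smoothTransition ∘ fun y : Coord n => ((m : ℝ) + 1) * y 0 - 1
    from rfl, h3]
  simp

lemma deriv_smoothTransition_eq_zero {t : ℝ} (ht : t < 0 ∨ 1 < t) :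
    deriv Real.smoothTransition t = 0 := by
  rcases ht with ht | ht
  · have : Real.smoothTransition =ᶠ[𝓝 t] fun _ => 0 := by
      filter_upwards [gt_mem_nhds ht] with s hs using Real.smoothTransition.zero_of_nonpos hs.le
    rw [this.deriv_eq, deriv_const]
  · have : Real.smoothTransition =ᶠ[𝓝 t] fun _ => 1 := by
      filter_upwards [lt_mem_nhds ht] with s hs using Real.smoothTransition.one_of_one_le hs.le
    rw [this.deriv_eq, deriv_const]

lemma exists_abs_deriv_smoothTransition_le :
    ∃ B : ℝ, 0 ≤ B ∧ ∀ t, |deriv Real.smoothTransition t| ≤ B := by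
  have hc : Continuous (deriv Real.smoothTransition) :=
    (Real.smoothTransition.contDiff (n := ⊤)).continuous_deriv (by simp)
  obtain ⟨B, hB⟩ := (isCompact_Icc (a := (0 : ℝ)) (b := 1)).exists_bound_of_continuousOn
    hc.continuousOn
  refine ⟨|B|, abs_nonneg _, fun t => ?_⟩
  by_cases ht : t ∈ Icc (0 : ℝ) 1
  · exact (hB t ht).trans (le_abs_self _)
  · rw [deriv_smoothTransition_eq_zero, abs_zero]
    · exact abs_nonneg _
    · by_contra! h
      exact ht h

/-- The integral of a weak derivative of a compactly supported function vanishes, if the function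
vanishes on the boundary of the half-space or the derivative is tangential. -/
lemma HasWeakPartial.integral_eq_zero {O K : Set (Coord n)} (hO : IsOpen O) (hK : IsCompact K)
    (hKO : K ⊆ O) {j : Fin n} {h k a : Coord n → ℝ}
    (hw : HasWeakPartial (O ∩ interior (HS n)) j h k)
    (hh : ∀ y ∈ O ∩ interior (HS n), y ∉ K → h y = 0)
    (hk : ∀ y ∈ O ∩ interior (HS n), y ∉ K → k y = 0)
    (hki : IntegrableOn k (O ∩ interior (HS n))) (ha : IntegrableOn a (O ∩ interior (HS n)))
    (hha : ∀ y ∈ O ∩ interior (HS n), |h y * (stdVec j : Coord n) 0| ≤ y 0 * a y) :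
    ∫ y in O ∩ interior (HS n), k y = 0 := by
  set U := O ∩ interior (HS n) with hU
  have hUm : MeasurableSet U := (hO.inter isOpen_interior).measurableSet
  obtain ⟨θ, h1, h2, h3, h4, h5⟩ := exists_smooth_cutoff hK hO hKO
  have hθ1 : ∀ y ∈ K, θ y = 1 := fun y hy => h4.self_of_nhdsSet y hy
  have hθd : ∀ y ∈ K, fderiv ℝ θ y = 0 := fun y hy => by
    have : θ =ᶠ[𝓝 y] fun _ => 1 := h4.filter_mono (nhds_le_nhdsSet hy)
    rw [this.fderiv_eq]; simp
  -- The test function is supported away from the boundary. Where `h` does not vanish, `θ` is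
  -- locally constant, so only the collar cutoff contributes to the derivative.
  have htest : ∀ m : ℕ, ∫ y in U, k y * (θ y * collarCutoff m y) =
      -∫ y in U, h y * (deriv Real.smoothTransition ((m + 1) * y 0 - 1) *
        ((m + 1) * (stdVec j : Coord n) 0)) := by
    intro m
    have hs : tsupport (fun y => θ y * collarCutoff m y) ⊆ U := by
      have hcl : IsClosed {y : Coord n | 1 ≤ ((m : ℝ) + 1) * y 0} :=
        isClosed_le continuous_const (by fun_prop)
      have hsub : tsupport (fun y => θ y * collarCutoff m y) ⊆
          {y : Coord n | 1 ≤ ((m : ℝ) + 1) * y 0} := by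
        refine closure_minimal (fun y hy => ?_) hcl
        by_contra hlt
        refine hy ?_
        simp only [mem_ofPred_eq, not_le] at hlt
        simp only [collarCutoff]
        rw [Real.smoothTransition.zero_of_nonpos (by linarith), mul_zero]
      refine fun y hy => ⟨h3 (tsupport_mul_subset_left hy), mem_interior_HS.2 ?_⟩
      have h6 : 1 ≤ ((m : ℝ) + 1) * y 0 := hsub hy
      by_contra! hle
      nlinarith [mul_nonpos_of_nonneg_of_nonpos (by positivity : (0 : ℝ) ≤ (m : ℝ) + 1) hle]
    have h6 := hw.2.2 _ (h1.mul (contDiff_collarCutoff m)) h2.mul_right hs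
    have h7 : ∫ y in U, h y * fderiv ℝ (fun y => θ y * collarCutoff m y) y (stdVec j) =
        ∫ y in U, h y * (deriv Real.smoothTransition ((m + 1) * y 0 - 1) *
        ((m + 1) * (stdVec j : Coord n) 0)) := by
      refine setIntegral_congr_fun hUm fun y hy => ?_
      by_cases hyK : y ∈ K
      · simp only
        rw [fderiv_fun_mul (h1.differentiable (by simp) y)
          ((contDiff_collarCutoff m).differentiable (by simp) y), hθd y hyK, hθ1 y hyK]
        simp [fderiv_collarCutoff]
      · simp [hh y hy hyK]
    rw [← h7, h6, neg_neg]
  have hcu : ∀ y ∈ U, 0 < y 0 := fun y hy => mem_interior_HS.1 hy.2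
  obtain ⟨B, hB0, hB⟩ := exists_abs_deriv_smoothTransition_le
  have hlarge : ∀ y ∈ U, ∀ᶠ m : ℕ in atTop, 1 < ((m : ℝ) + 1) * y 0 - 1 := by
    intro y hy
    obtain ⟨N, hN⟩ := exists_nat_gt (2 / y 0)
    filter_upwards [eventually_ge_atTop N] with m hm
    have h8 : (N : ℝ) ≤ m := by exact_mod_cast hm
    have h9 : 2 < (N : ℝ) * y 0 := (div_lt_iff₀ (hcu y hy)).1 hN
    nlinarith [hcu y hy]
  -- The cutoffs equal `1` for `y 0 ≥ 2 / (m + 1)`, so they tend to `1` pointwise in the open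
  -- half-space.
  have hL : Tendsto (fun m : ℕ => ∫ y in U, k y * (θ y * collarCutoff m y)) atTop
      (𝓝 (∫ y in U, k y)) := by
    refine tendsto_integral_of_dominated_convergence (fun y => |k y|) (fun m => ?_) hki.abs
      (fun m => ?_) ?_
    · exact hki.aestronglyMeasurable.mul
        (h1.continuous.mul (contDiff_collarCutoff m).continuous).aestronglyMeasurable
    · refine Eventually.of_forall fun y => ?_
      rw [norm_mul, Real.norm_eq_abs, Real.norm_eq_abs, abs_mul, abs_of_nonneg (h5 y).1, collarCutoff,
        abs_of_nonneg (Real.smoothTransition.nonneg _)]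
      exact mul_le_of_le_one_right (abs_nonneg _)
        (mul_le_one₀ (h5 y).2 (Real.smoothTransition.nonneg _) (Real.smoothTransition.le_one _))
    · filter_upwards [ae_restrict_mem hUm] with y hy
      refine tendsto_const_nhds.congr' ?_
      filter_upwards [hlarge y hy] with m hm
      by_cases hyK : y ∈ K
      · rw [hθ1 y hyK, collarCutoff, Real.smoothTransition.one_of_one_le hm.le]
        simp
      · simp [hk y hy hyK]
  -- The derivative of the cutoff is of size `m + 1` but lives on `1 / (m + 1) ≤ y 0 ≤ 2 / (m + 1)`.
  -- There the bound by `y 0 * a y` compensates it, leaving the integrable majorant `2 B |a|`, while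
  -- pointwise the terms vanish eventually.
  have hR : Tendsto (fun m : ℕ => -∫ y in U, h y * (deriv Real.smoothTransition
      ((m + 1) * y 0 - 1) * ((m + 1) * (stdVec j : Coord n) 0))) atTop (𝓝 0) := by
    suffices hS : Tendsto (fun m : ℕ => ∫ y in U, h y * (deriv Real.smoothTransition
        ((m + 1) * y 0 - 1) * ((m + 1) * (stdVec j : Coord n) 0))) atTop (𝓝 0) by
      simpa using hS.neg
    rw [← integral_zero (Coord n) ℝ (μ := volume.restrict U)]
    refine tendsto_integral_of_dominated_convergence (fun y => 2 * B * |a y|) (fun m => ?_)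
      (ha.abs.const_mul _) (fun m => ?_) ?_
    · refine hw.1.aestronglyMeasurable.mul (Continuous.aestronglyMeasurable ?_)
      have hc : Continuous (deriv Real.smoothTransition) :=
        (Real.smoothTransition.contDiff (n := ⊤)).continuous_deriv (by simp)
      exact (hc.comp (by fun_prop)).mul continuous_const
    · filter_upwards [ae_restrict_mem hUm] with y hy
      have e : h y * (deriv Real.smoothTransition ((m + 1) * y 0 - 1) *
          ((m + 1) * (stdVec j : Coord n) 0)) = deriv Real.smoothTransition ((m + 1) * y 0 - 1) *
          ((m + 1) * (h y * (stdVec j : Coord n) 0)) := by ring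
      rw [e, Real.norm_eq_abs, abs_mul]
      by_cases hm : 1 < ((m : ℝ) + 1) * y 0 - 1
      · rw [deriv_smoothTransition_eq_zero (Or.inr hm), abs_zero, zero_mul]
        positivity
      · rw [abs_mul, abs_of_nonneg (by positivity : (0 : ℝ) ≤ (m : ℝ) + 1)]
        have h8 : ((m : ℝ) + 1) * |h y * (stdVec j : Coord n) 0| ≤ 2 * |a y| := by
          calc ((m : ℝ) + 1) * |h y * (stdVec j : Coord n) 0|
              ≤ ((m : ℝ) + 1) * (y 0 * |a y|) := by
                gcongr
                exact (hha y hy).trans (mul_le_mul_of_nonneg_left (le_abs_self _) (hcu y hy).le)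
            _ = (((m : ℝ) + 1) * y 0) * |a y| := by ring
            _ ≤ 2 * |a y| := by
                gcongr
                linarith
        calc |deriv Real.smoothTransition ((m + 1) * y 0 - 1)| *
              (((m : ℝ) + 1) * |h y * (stdVec j : Coord n) 0|) ≤ B * (2 * |a y|) := by
              gcongr
              exact hB _
          _ = 2 * B * |a y| := by ring
    · filter_upwards [ae_restrict_mem hUm] with y hy
      refine tendsto_const_nhds.congr' ?_
      filter_upwards [hlarge y hy] with m hm
      rw [deriv_smoothTransition_eq_zero (Or.inr hm)]
      simp
  exact tendsto_nhds_unique (hL.congr htest) hR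

end WeakGauss

/-! ### Jacobi's formula for the derivative of a determinant -/

section Determinant

/-- The Leibniz expansion is differentiated one column at a time; pairing a row of the adjugate with
a column of `A'` gives the determinant with that column replaced. -/
lemma hasDerivAt_det {n : Type*} [Fintype n] [DecidableEq n] {A : ℝ → Matrix n n ℝ}
    {A' : Matrix n n ℝ} {t : ℝ} (h : ∀ i j, HasDerivAt (fun s => A s i j) (A' i j) t) :
    HasDerivAt (fun s => (A s).det) (∑ i, ∑ k, (A t).adjugate i k * A' k i) t := by
  have h1 : HasDerivAt (fun s => ∑ σ : Equiv.Perm n, ((Equiv.Perm.sign σ : ℤ) : ℝ) *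
      ∏ i, A s (σ i) i) (∑ σ : Equiv.Perm n, ((Equiv.Perm.sign σ : ℤ) : ℝ) *
      ∑ i, (∏ j ∈ Finset.univ.erase i, A t (σ j) j) • A' (σ i) i) t :=
    HasDerivAt.fun_sum fun σ _ => (HasDerivAt.fun_finsetProd fun i _ => h (σ i) i).const_mul _
  simp_rw [Matrix.det_apply']
  refine h1.congr_deriv ?_
  simp_rw [Finset.mul_sum]
  rw [Finset.sum_comm (s := (Finset.univ : Finset (Equiv.Perm n)))]
  refine Finset.sum_congr rfl fun i _ => ?_
  have h2 : ∑ k, (A t).adjugate i k * A' k i = ((A t).updateCol i fun k => A' k i).det := by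
    rw [← Matrix.cramer_apply, Matrix.cramer_eq_adjugate_mulVec]; rfl
  rw [h2, Matrix.det_apply']
  refine Finset.sum_congr rfl fun σ _ => ?_
  rw [← Finset.mul_prod_erase _ _ (Finset.mem_univ i), Matrix.updateCol_self, smul_eq_mul,
    mul_comm (A' (σ i) i)]
  congr 2
  exact Finset.prod_congr rfl fun j hj => (Matrix.updateCol_ne (Finset.ne_of_mem_erase hj)).symm

end Determinant

section Manifold

variable {n : ℕ} [NeZero n] {M : Type*} [TopologicalSpace M]
  [ChartedSpace (EuclideanHalfSpace n) M] [IsManifold (𝓡∂ n) ∞ M]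
  [MeasurableSpace M] [BorelSpace M]

/-! ### Killing fields are divergence free -/

lemma hasDerivAt_line {f : Coord n → ℝ} {c : M} (hf : ContDiffOn ℝ ∞ f (dom c)) {y : Coord n}
    (hy : y ∈ interior (dom c)) (j : Fin n) :
    HasDerivAt (fun t : ℝ => f (y + t • stdVec j)) (partialH j f y) 0 := by
  have hγ : HasDerivAt (fun t : ℝ => y + t • (stdVec j : Coord n)) (stdVec j) 0 := by
    simpa using ((hasDerivAt_id (0 : ℝ)).smul_const (stdVec j : Coord n)).const_add y
  have h1 : HasFDerivAt f (fderiv ℝ f y) (y + (0 : ℝ) • (stdVec j : Coord n)) := by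
    simpa using ((hf.contDiffAt (mem_interior_iff_mem_nhds.1 hy)).differentiableAt
      (by simp)).hasFDerivAt
  rw [partialH_eq_fderiv (interior_mono (dom_subset_HS c) hy)]
  exact h1.comp_hasDerivAt (0 : ℝ) hγ

lemma contDiffOn_sqrt_gram_det (g : Metric n M) (c : M) :
    ContDiffOn ℝ ∞ (fun y => √(gram g c y).det) (dom c) :=
  (contDiffOn_gram_det g c).sqrt fun _ hy => (gram_det_pos g hy).ne'

lemma partialH_sqrt_gram_det (g : Metric n M) {c : M} {y : Coord n} (hy : y ∈ interior (dom c))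
    (j : Fin n) : partialH j (fun y => √(gram g c y).det) y = √(gram g c y).det *
      ((1 / 2) * ∑ i, ∑ k, (gram g c y)⁻¹ i k * partialH j (fun z => gram g c z k i) y) := by
  have hyd := interior_subset hy
  have hpos := gram_det_pos g hyd
  have e0 : y + (0 : ℝ) • (stdVec j : Coord n) = y := by simp
  have h1 := hasDerivAt_det (A := fun t : ℝ => gram g c (y + t • stdVec j))
    (A' := Matrix.of fun i k => partialH j (fun z => gram g c z i k) y) (t := 0)
    fun i k => hasDerivAt_line (contDiffOn_gram g c i k) hy j
  have h2 := h1.sqrt (by rw [e0]; exact hpos.ne')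
  rw [(hasDerivAt_line (contDiffOn_sqrt_gram_det g c) hy j).unique h2, e0]
  simp only [Matrix.of_apply]
  have h3 : ∀ i k, (gram g c y).adjugate i k = (gram g c y).det * (gram g c y)⁻¹ i k := fun i k => by
    rw [Matrix.inv_def, Matrix.smul_apply, Ring.inverse_eq_inv', smul_eq_mul,
      mul_inv_cancel_left₀ hpos.ne']
  simp_rw [h3, mul_assoc, ← Finset.mul_sum]
  have h4 := Real.mul_self_sqrt hpos.le
  have h5 := Real.sqrt_pos.2 hpos
  field_simp
  rw [sq, h4, mul_comm]

lemma gram_inv_symm (g : Metric n M) (c : M) (y : Coord n) (i l : Fin n) :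
    (gram g c y)⁻¹ i l = (gram g c y)⁻¹ l i := by
  have h : (gram g c y)ᵀ = gram g c y := by ext a b; exact gram_symm g c y b a
  conv_lhs => rw [← h, ← Matrix.transpose_nonsing_inv]
  rfl

/-- On contraction, two of the three terms of the Christoffel symbol cancel by symmetry of the
metric and its inverse. With `partialH_sqrt_gram_det`, the trace is the logarithmic derivative of
`√(det gᵢⱼ)`. -/
lemma sum_christoffel (g : Metric n M) (c : M) (y : Coord n) (k : Fin n) :
    ∑ i, christoffel g c i i k y =
      (1 / 2) * ∑ i, ∑ l, (gram g c y)⁻¹ i l * partialH k (fun z => gram g c z l i) y := by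
  have hs := gram_inv_symm g c y
  have hg : ∀ a b l, partialH l (fun z => gram g c z a b) y = partialH l (fun z => gram g c z b a) y :=
    fun a b l => by simp_rw [gram_symm g c _ a b]
  have h1 : ∑ i, ∑ l, (gram g c y)⁻¹ i l * partialH i (fun z => gram g c z k l) y =
      ∑ i, ∑ l, (gram g c y)⁻¹ i l * partialH l (fun z => gram g c z i k) y := by
    rw [Finset.sum_comm]
    refine Finset.sum_congr rfl fun i _ => Finset.sum_congr rfl fun l _ => ?_
    rw [hs l i, hg i k]
  simp_rw [christoffel, ← Finset.mul_sum, mul_sub, mul_add, Finset.sum_sub_distrib,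
    Finset.sum_add_distrib]
  rw [h1]
  simp_rw [hg _ _ k]
  ring_nf

/-- The trace of an endomorphism that is skew with respect to the metric equals its own negative. -/
lemma sum_ncomp_eq_zero (g : Metric n M) {v : VField n M} (hv : IsSmooth v)
    (h0 : ∀ x, deformation g v x = 0) {c : M} {y : Coord n} (hy : y ∈ dom c) :
    ∑ j, ncomp g c v j j y = 0 := by
  have h1 := (deformation_eq_zero_iff g hv hy).1 (h0 _)
  have hs := gram_inv_symm g c y
  have h2 : ∑ j, ncomp g c v j j y =
      ∑ j, ∑ i, (gram g c y)⁻¹ j i * ∑ l, gram g c y i l * ncomp g c v l j y := by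
    refine Finset.sum_congr rfl fun j _ => ?_
    simp_rw [Finset.mul_sum, ← mul_assoc]
    rw [Finset.sum_comm]
    simp_rw [← Finset.sum_mul, sum_inv_mul_gram g hy]
    simp
  have h3 : ∑ j, ncomp g c v j j y = -∑ j, ncomp g c v j j y := by
    conv_lhs => rw [h2, Finset.sum_comm]
    conv_rhs => rw [h2]
    simp_rw [← Finset.sum_neg_distrib]
    refine Finset.sum_congr rfl fun j _ => Finset.sum_congr rfl fun i _ => ?_
    rw [hs i j]
    linear_combination (gram g c y)⁻¹ j i * h1 j i
  linarith

/-- The components of a Killing field with respect to the coordinate volume are divergence free. -/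
lemma sum_partialH_eq_zero (g : Metric n M) {v : VField n M} (hv : IsSmooth v)
    (h0 : ∀ x, deformation g v x = 0) {c : M} {y : Coord n} (hy : y ∈ interior (dom c)) :
    ∑ j, partialH j (fun z => √(gram g c z).det * vcomp c v j z) y = 0 := by
  have e0 : ∀ j : Fin n, y + (0 : ℝ) • (stdVec j : Coord n) = y := by simp
  -- The derivative of the density produces the contracted Christoffel symbol, so the sum over `j`
  -- is the density times the trace of the covariant derivative.
  have h1 : ∀ j, partialH j (fun z => √(gram g c z).det * vcomp c v j z) y =
      √(gram g c y).det * (partialH j (vcomp c v j) y +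
        (∑ i, christoffel g c i i j y) * vcomp c v j y) := by
    intro j
    have h2 := (hasDerivAt_line (contDiffOn_sqrt_gram_det g c) hy j).fun_mul
      (hasDerivAt_line (hv.contDiffOn_vcomp c j) hy j)
    rw [(hasDerivAt_line ((contDiffOn_sqrt_gram_det g c).mul (hv.contDiffOn_vcomp c j)) hy j).unique
      h2, e0, partialH_sqrt_gram_det g hy, ← sum_christoffel]
    ring
  simp_rw [h1, ← Finset.mul_sum]
  have h2 := sum_ncomp_eq_zero g hv h0 (interior_subset hy)
  simp_rw [ncomp, Finset.sum_add_distrib] at h2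
  rw [Finset.sum_comm (f := fun j k => christoffel g c j j k y * vcomp c v k y)] at h2
  simp_rw [← Finset.sum_mul] at h2
  rw [Finset.sum_add_distrib, h2, mul_zero]

/-- A smooth function vanishing on the boundary is bounded by the distance to it. -/
lemma exists_abs_le_mul {c : M} {f : Coord n → ℝ} (hf : ContDiffOn ℝ ∞ f (dom c))
    (h0 : ∀ y ∈ (dom c : Set (Coord n)), y 0 = 0 → f y = 0) {K : Set (Coord n)} (hK : IsCompact K)
    (hKd : K ⊆ dom c) : ∃ C : ℝ, 0 ≤ C ∧ ∀ y ∈ K, |f y| ≤ C * y 0 := by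
  have hpos : ∀ y ∈ (dom c : Set (Coord n)), 0 ≤ y 0 := fun y hy => mem_HS.1 (dom_subset_HS c hy)
  suffices h : ∃ C : ℝ, 0 ≤ C ∧ ∀ y ∈ K ∩ dom c, |f y| ≤ C * y 0 by
    obtain ⟨C, hC, h⟩ := h
    exact ⟨C, hC, fun y hy => h y ⟨hy, hKd hy⟩⟩
  -- Only local bounds are needed. Near a boundary point the mean value inequality along the normal
  -- direction applies; near an interior point `y 0` is bounded below, so boundedness of `f`
  -- suffices.
  refine hK.induction_on (p := fun s => ∃ C : ℝ, 0 ≤ C ∧ ∀ y ∈ s ∩ dom c, |f y| ≤ C * y 0)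
    ⟨0, le_rfl, by simp⟩ ?_ ?_ ?_
  · rintro s t hst ⟨C, hC, h⟩
    exact ⟨C, hC, fun y hy => h y ⟨hst hy.1, hy.2⟩⟩
  · rintro s t ⟨C, hC, h⟩ ⟨C', hC', h'⟩
    refine ⟨C + C', by positivity, fun y hy => ?_⟩
    have := hpos y hy.2
    rcases hy.1 with hs | ht
    · nlinarith [h y ⟨hs, hy.2⟩, mul_nonneg hC' this]
    · nlinarith [h' y ⟨ht, hy.2⟩, mul_nonneg hC this]
  · intro p hp
    obtain ⟨r, hr, hrd⟩ := exists_closedBall_inter_subset (hKd hp)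
    have hcc := isCompact_closedBall_inter (n := n) p r
    rcases (hpos p (hKd hp)).eq_or_lt with hp0 | hp0
    · obtain ⟨B, hB⟩ := hcc.exists_bound_of_continuousOn (f := fun y => fderivWithin ℝ f (dom c) y)
        (((hf.continuousOn_fderivWithin (uniqueDiffOn_dom c) (by simp))).mono hrd)
      have hB0 : 0 ≤ B := (norm_nonneg _).trans (hB p ⟨Metric.mem_closedBall_self hr.le,
        dom_subset_HS c (hKd hp)⟩)
      -- Half the radius keeps the foot point `z` of `y` on the boundary inside the larger
      -- half-ball, since `y 0 ≤ ‖y - p‖`.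
      refine ⟨Metric.ball p (r / 2), mem_nhdsWithin_of_mem_nhds (Metric.ball_mem_nhds p (by positivity)),
        B, hB0, fun y hy => ?_⟩
      have hy1 : ‖y - p‖ < r / 2 := by simpa [dist_eq_norm] using hy.1
      have hy0 : 0 ≤ y 0 := hpos y hy.2
      have hyp : y 0 ≤ ‖y - p‖ := by
        have := PiLp.norm_apply_le (y - p) 0
        rw [PiLp.sub_apply, ← hp0, sub_zero, Real.norm_eq_abs] at this
        exact (le_abs_self _).trans this
      have hstd : ‖(stdVec 0 : Coord n)‖ = 1 := by simp [stdVec]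
      set z : Coord n := y - y 0 • stdVec 0 with hz
      have hz0 : z 0 = 0 := by simp [hz, stdVec_apply]
      have hzm : z ∈ Metric.closedBall p r ∩ HS n := by
        refine ⟨?_, mem_HS.2 hz0.ge⟩
        rw [mem_closedBall_iff_norm]
        have : z - p = (y - p) - y 0 • stdVec 0 := by rw [hz]; abel
        rw [this]
        refine (norm_sub_le _ _).trans ?_
        rw [norm_smul, hstd, mul_one, Real.norm_eq_abs, abs_of_nonneg hy0]
        linarith
      have hym : y ∈ Metric.closedBall p r ∩ HS n :=
        ⟨by rw [mem_closedBall_iff_norm]; linarith, dom_subset_HS c hy.2⟩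
      have h1 := ((convex_closedBall p r).inter
        (convex_HS (n := n))).norm_image_sub_le_of_norm_hasFDerivWithin_le
        (f := f) (fun x hx => (((hf.differentiableOn (by simp) x (hrd hx)).hasFDerivWithinAt).mono
          hrd)) hB hzm hym
      rw [h0 z (hrd hzm) hz0, sub_zero, hz, sub_sub_cancel, norm_smul, hstd, mul_one,
        Real.norm_eq_abs, Real.norm_eq_abs, abs_of_nonneg hy0] at h1
      exact h1
    · obtain ⟨B, hB⟩ := hcc.exists_bound_of_continuousOn (hf.continuousOn.mono hrd)
      have hB0 : 0 ≤ B := (norm_nonneg _).trans (hB p ⟨Metric.mem_closedBall_self hr.le,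
        dom_subset_HS c (hKd hp)⟩)
      have hev : ∀ᶠ y : Coord n in 𝓝 p, p 0 / 2 < y 0 :=
        (Continuous.continuousAt (by fun_prop : Continuous fun y : Coord n => y 0)).eventually
          (lt_mem_nhds (by linarith))
      refine ⟨Metric.closedBall p r ∩ {y | p 0 / 2 < y 0}, mem_nhdsWithin_of_mem_nhds
        (inter_mem (Metric.closedBall_mem_nhds p hr) hev), B * (2 / p 0), by positivity,
        fun y hy => ?_⟩
      have h1 : |f y| ≤ B := hB y ⟨hy.1.1, dom_subset_HS c hy.2⟩
      have h2 : p 0 / 2 < y 0 := hy.1.2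
      have h3 : 1 ≤ 2 / p 0 * y 0 := by
        rw [div_mul_eq_mul_div, le_div_iff₀ hp0]; linarith
      calc |f y| ≤ B * 1 := by linarith
        _ ≤ B * (2 / p 0 * y 0) := by gcongr
        _ = _ := by ring

end Manifold

section Manifold

variable {n : ℕ} [NeZero n] {M : Type*} [TopologicalSpace M]
  [ChartedSpace (EuclideanHalfSpace n) M] [IsManifold (𝓡∂ n) ∞ M]
  [MeasurableSpace M] [BorelSpace M]

/-! ### Directional derivatives of functions -/

/-- The derivative of the function `χ` in the direction of the tangent vector `w` at `p`. -/
def dirDeriv (χ : M → ℝ) (p : M) (w : TangentSpace (𝓡∂ n) p) : ℝ :=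
  fderivWithin ℝ (fun y : Coord n => χ (pt p y)) (HS n) (crd p p) (coords p p w)

lemma contDiffOn_comp_pt {χ : M → ℝ} (hχ : ContMDiff (𝓡∂ n) 𝓘(ℝ, ℝ) ∞ χ) (c : M) :
    ContDiffOn ℝ ∞ (fun y : Coord n => χ (pt c y)) (dom c) :=
  contDiffOn_dom_of_contMDiffOn hχ.contMDiffOn

lemma eventuallyEq_comp_pt {χ : M → ℝ} {c : M} {y : Coord n} (hy : y ∈ dom c)
    (h : χ =ᶠ[𝓝 (pt c y)] 0) : (fun y : Coord n => χ (pt c y)) =ᶠ[𝓝[HS n] y] fun _ => 0 := by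
  rw [← nhdsWithin_dom_eq hy]
  exact (continuousOn_pt c y hy).eventually h

lemma dirDeriv_eq_zero {χ : M → ℝ} {p : M} (hp : p ∉ tsupport χ) (w : TangentSpace (𝓡∂ n) p) :
    dirDeriv χ p w = 0 := by
  have hy := crd_mem_dom (mem_src_self (n := n) p)
  have e := pt_crd (mem_src_self (n := n) p)
  have h := eventuallyEq_comp_pt (χ := χ) hy (by
    rw [e]; exact notMem_tsupport_iff_eventuallyEq.1 hp)
  rw [dirDeriv, h.fderivWithin_eq (by rw [e]; exact image_eq_zero_of_notMem_tsupport hp)]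
  simp

lemma dirDeriv_eq {χ : M → ℝ} (hχ : ContMDiff (𝓡∂ n) 𝓘(ℝ, ℝ) ∞ χ) {c p : M} (hp : p ∈ src n c)
    (w : TangentSpace (𝓡∂ n) p) : dirDeriv χ p w =
      ∑ j, partialH j (fun y : Coord n => χ (pt c y)) (crd c p) * coframe c j p w := by
  have hy : (crd c p : Coord n) ∈ overlap c p := crd_mem_overlap hp (mem_src_self p)
  have e1 : trans c p (crd c p : Coord n) = crd p p := by rw [trans, pt_crd hp]
  have h1 := hasFDerivWithinAt_dom (contDiffOn_comp_pt hχ p) (trans_mem_overlap hy).1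
  have h2 := h1.comp (crd c p : Coord n) (hasFDerivWithinAt_trans hy)
    fun z hz => (trans_mem_overlap hz).1
  have h3 : HasFDerivWithinAt (fun y : Coord n => χ (pt c y))
      ((fderivWithin ℝ (fun y : Coord n => χ (pt p y)) (HS n) (trans c p (crd c p))).comp
        (jac c p (crd c p))) (overlap c p) (crd c p) :=
    h2.congr (fun z hz => by simp only [Function.comp]; rw [pt_trans hz])
      (by simp only [Function.comp]; rw [pt_trans hy])
  have h4 := h3.fderivWithin (uniqueDiffOn_overlap c p _ hy)
  rw [fderivWithin_overlap hy] at h4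
  have h5 : dirDeriv χ p w = fderivWithin ℝ (fun y : Coord n => χ (pt c y)) (HS n) (crd c p)
      (coords c p w) := by
    rw [h4, ContinuousLinearMap.comp_apply, ← coords_change hp (mem_src_self p), e1]; rfl
  rw [h5, eq_sum_stdVec (coords c p w), map_sum]
  refine Finset.sum_congr rfl fun j _ => ?_
  rw [map_smul, smul_eq_mul, mul_comm, ← partialH_def]
  rfl

lemma continuousOn_dirDeriv {χ : M → ℝ} (hχ : ContMDiff (𝓡∂ n) 𝓘(ℝ, ℝ) ∞ χ) {v : VField n M}
    (hv : IsSmooth v) (c : M) :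
    ContinuousOn (fun y : Coord n => dirDeriv χ (pt c y) (v (pt c y))) (dom c) := by
  refine ContinuousOn.congr (f := fun y => ∑ j, partialH j (fun y : Coord n => χ (pt c y)) y *
    vcomp c v j y) (continuousOn_finsetSum _ fun j _ =>
      (contDiffOn_partialH (contDiffOn_comp_pt hχ c) j).continuousOn.mul
        (hv.contDiffOn_vcomp c j).continuousOn) fun y hy => ?_
  simp only
  rw [dirDeriv_eq hχ (pt_mem_src hy), crd_pt hy]
  rfl

lemma sum_dirDeriv_eq_zero {ι : Type*} [Fintype ι] {χ : ι → M → ℝ}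
    (hχ : ∀ i, ContMDiff (𝓡∂ n) 𝓘(ℝ, ℝ) ∞ (χ i)) (h1 : ∀ x, ∑ i, χ i x = 1) (p : M)
    (w : TangentSpace (𝓡∂ n) p) : ∑ i, dirDeriv (χ i) p w = 0 := by
  have hy : (crd p p : Coord n) ∈ dom p := crd_mem_dom (mem_src_self p)
  have h2 : HasFDerivWithinAt (fun y : Coord n => ∑ i, χ i (pt p y))
      (∑ i, fderivWithin ℝ (fun y : Coord n => χ i (pt p y)) (HS n) (crd p p)) (HS n) (crd p p) :=
    HasFDerivWithinAt.fun_sum fun i _ => hasFDerivWithinAt_HS (contDiffOn_comp_pt (hχ i) p) hy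
  simp_rw [h1] at h2
  have h3 := (uniqueDiffOn_HS _ (dom_subset_HS p hy)).eq h2
    (hasFDerivWithinAt_const (1 : ℝ) (crd p p : Coord n) (HS n))
  have h4 := congrArg (fun L : Coord n →L[ℝ] ℝ => L (coords p p w)) h3
  simpa [dirDeriv, _root_.sum_apply] using h4

/-! ### Integrability -/

/-- Polarization with the nonnegative numbers `|v + w|²` and `|v - w|²`; it serves as a domination
bound for inner products of square integrable fields. -/
lemma abs_inner_le (g : Metric n M) (p : M) (v w : TangentSpace (𝓡∂ n) p) :
    |g.inner p v w| ≤ normSqV g p v + normSqV g p w := by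
  have h1 := normSqV_nonneg g p (v + w)
  have h2 := normSqV_nonneg g p (v - w)
  have h3 := normSqV_nonneg g p v
  have h4 := normSqV_nonneg g p w
  have h5 := g.symm p v w
  simp only [normSqV, map_add, map_sub, _root_.add_apply, _root_.sub_apply] at h1 h2 h3 h4 ⊢
  rw [abs_le]
  constructor <;> linarith

lemma inner_eq_sum (g : Metric n M) {c p : M} (hp : p ∈ src n c) (v w : TangentSpace (𝓡∂ n) p) :
    g.inner p v w = ∑ j, coframe c j p v * g.inner p w (frame c j p) := by
  rw [g.symm]
  conv_lhs => rw [← vec_coords hp v, vec_eq_sum]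
  simp [coframe_eq]

lemma HasWeakPartial.aestronglyMeasurable_dom {c : M} {j : Fin n} {f h : Coord n → ℝ}
    (hw : HasWeakPartial (interior (dom c)) j f h) :
    AEStronglyMeasurable f (volume.restrict (dom c)) ∧
      AEStronglyMeasurable h (volume.restrict (dom c)) := by
  rw [← restrict_interior_dom]
  exact ⟨hw.1.aestronglyMeasurable, hw.2.1.aestronglyMeasurable⟩

lemma HasGradient.integrable [CompactSpace M] {g : Metric n M} {φ : M → ℝ} {F : VField n M}
    (h : HasGradient g φ F) : Integrable φ (vol g) := h.1.integrable (by norm_num)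

lemma HasGradient.integrable_inner [CompactSpace M] {g : Metric n M} {φ : M → ℝ} {F v : VField n M}
    (h : HasGradient g φ F) (hv : IsSmooth v) :
    Integrable (fun x => g.inner x (v x) (F x)) (vol g) := by
  refine ⟨aestronglyMeasurable_vol g fun c => ?_, ?_⟩
  · have h1 : AEStronglyMeasurable (fun y : Coord n => ∑ j, vcomp c v j y *
        g.inner (pt c y) (F (pt c y)) (frame c j (pt c y))) (volume.restrict (dom c)) :=
      Finset.aestronglyMeasurable_fun_sum _ fun j _ =>
        ((hv.contDiffOn_vcomp c j).continuousOn.aestronglyMeasurable (measurableSet_dom c)).mul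
          (h.2.2 c j).aestronglyMeasurable_dom.2
    refine h1.congr ?_
    filter_upwards [ae_restrict_mem (measurableSet_dom c)] with y hy
    exact (inner_eq_sum g (pt_mem_src hy) _ _).symm
  · have h1 : AEMeasurable (fun x => ENNReal.ofReal (normSqV g x (v x))) (vol g) :=
      ENNReal.measurable_ofReal.comp_aemeasurable
        (continuous_of_continuousOn_pt (continuousOn_normSqV g hv)).measurable.aemeasurable
    refine (lintegral_mono (g := fun x => ENNReal.ofReal (normSqV g x (v x)) +
      ENNReal.ofReal (normSqV g x (F x))) fun x => ?_).trans_lt ?_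
    · simp only
      rw [← ENNReal.ofReal_add (normSqV_nonneg _ _ _) (normSqV_nonneg _ _ _),
        Real.enorm_eq_ofReal_abs]
      exact ENNReal.ofReal_le_ofReal (abs_inner_le g x _ _)
    · rw [lintegral_add_left' h1]
      exact ENNReal.add_lt_top.2 ⟨(hv.memL2 g).2, h.2.1.2⟩

lemma HasGradient.integrableOn_chart [CompactSpace M] {g : Metric n M} {φ : M → ℝ} {F : VField n M}
    (h : HasGradient g φ F) {c : M} {K : Set (Coord n)} (hK : IsCompact K) (hKd : K ⊆ dom c) :
    IntegrableOn (fun y => φ (pt c y)) K ∧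
      ∀ j, IntegrableOn (fun y => g.inner (pt c y) (F (pt c y)) (frame c j (pt c y))) K := by
  obtain ⟨C, hC, hCl⟩ := exists_setLIntegral_le_vol g hK hKd
  refine ⟨⟨(h.2.2 c 0).aestronglyMeasurable_dom.1.mono_measure (Measure.restrict_mono hKd le_rfl),
    ?_⟩, fun j => ⟨(h.2.2 c j).aestronglyMeasurable_dom.2.mono_measure
      (Measure.restrict_mono hKd le_rfl), ?_⟩⟩
  · exact (hCl fun x => ‖φ x‖ₑ).trans_lt (ENNReal.mul_lt_top hC.lt_top h.integrable.2)
  · have h1 : IntegrableOn (fun y => gram g c y j j) K :=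
      ((contDiffOn_gram g c j j).continuousOn.mono hKd).integrableOn_compact hK
    refine (lintegral_mono (g := fun y => ENNReal.ofReal (normSqV g (pt c y) (F (pt c y))) +
      ‖gram g c y j j‖ₑ) fun y => ?_).trans_lt ?_
    · have h2 : 0 ≤ gram g c y j j := normSqV_nonneg g (pt c y) (frame c j (pt c y))
      simp only
      rw [Real.enorm_eq_ofReal h2, ← ENNReal.ofReal_add (normSqV_nonneg _ _ _) h2,
        Real.enorm_eq_ofReal_abs]
      exact ENNReal.ofReal_le_ofReal (abs_inner_le g (pt c y) _ _)
    · rw [lintegral_add_right' _ h1.aestronglyMeasurable.enorm]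
      exact ENNReal.add_lt_top.2 ⟨(hCl fun x => ENNReal.ofReal (normSqV g x (F x))).trans_lt
        (ENNReal.mul_lt_top hC.lt_top h.2.1.2), h1.2⟩

lemma integral_vol_eq (g : Metric n M) {c : M} {q : M → ℝ} (hq : ∀ x ∉ src n c, q x = 0)
    (hm : AEStronglyMeasurable q (vol g)) :
    ∫ x, q x ∂(vol g) = ∫ y in dom c, √(gram g c y).det * q (pt c y) := by
  rw [← setIntegral_eq_integral_of_forall_compl_eq_zero hq, vol_restrict_src, chartVol_eq,
    integral_map (aemeasurable_pt g c) (by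
      rw [← chartVol_eq, ← vol_restrict_src]; exact hm.restrict), cvol,
    integral_withDensity_eq_integral_toReal_smul₀ (aemeasurable_cden g c)
      (Eventually.of_forall fun _ => ENNReal.ofReal_lt_top)]
  refine integral_congr_ae (Eventually.of_forall fun y => ?_)
  simp only [cden, ENNReal.toReal_ofReal (Real.sqrt_nonneg _), smul_eq_mul]

/-! ### Tangential Killing fields are orthogonal to gradients -/

/-- Because `√(det g) v` is divergence free in coordinates, the integrand is the weak divergence of
`χ φ √(det g) v`. Each summand integrates to zero by the weak Gauss theorem. -/
lemma integral_chart_eq_zero [CompactSpace M] {g : Metric n M} {v : VField n M} (hv : IsSmooth v)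
    (h0 : ∀ x, deformation g v x = 0)
    (hb : ∀ x ∈ (𝓡∂ n).boundary M, g.inner x (v x) (normal g x) = 0) {φ : M → ℝ} {F : VField n M}
    (h : HasGradient g φ F) {χ : M → ℝ} (hχ : ContMDiff (𝓡∂ n) 𝓘(ℝ, ℝ) ∞ χ) {c : M}
    (hs : tsupport χ ⊆ src n c) :
    ∫ y in dom c, √(gram g c y).det * (φ (pt c y) * dirDeriv χ (pt c y) (v (pt c y)) +
      χ (pt c y) * g.inner (pt c y) (v (pt c y)) (F (pt c y))) = 0 := by
  set K : Set (Coord n) := crd c '' tsupport χ with hKdef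
  have hK : IsCompact K :=
    (isClosed_tsupport χ).isCompact.image_of_continuousOn ((continuousOn_crd c).mono hs)
  have hKd : K ⊆ dom c := by
    rintro _ ⟨p, hp, rfl⟩
    exact crd_mem_dom (hs hp)
  have hoff : ∀ y ∈ (dom c : Set (Coord n)), y ∉ K → pt c y ∉ tsupport χ := fun y hy hyK hyt =>
    hyK ⟨_, hyt, crd_pt hy⟩
  set ρ : Coord n → ℝ := fun y => χ (pt c y) with hρdef
  have hρ : ContDiffOn ℝ ∞ ρ (dom c) := contDiffOn_comp_pt hχ c
  have hρ0 : ∀ y ∈ (dom c : Set (Coord n)), y ∉ K → ρ y = 0 := fun y hy hyK =>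
    image_eq_zero_of_notMem_tsupport (f := χ) (hoff y hy hyK)
  have hρ1 : ∀ y ∈ (dom c : Set (Coord n)), y ∉ K → ∀ j, partialH j ρ y = 0 := by
    intro y hy hyK j
    have h2 : ρ =ᶠ[𝓝[HS n] y] fun _ => 0 :=
      eventuallyEq_comp_pt hy (notMem_tsupport_iff_eventuallyEq.1 (hoff y hy hyK))
    rw [partialH_def, h2.fderivWithin_eq (hρ0 y hy hyK)]
    simp
  set X : Fin n → Coord n → ℝ := fun j y => √(gram g c y).det * vcomp c v j y with hXdef
  have hX : ∀ j, ContDiffOn ℝ ∞ (X j) (dom c) := fun j =>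
    (contDiffOn_sqrt_gram_det g c).mul (hv.contDiffOn_vcomp c j)
  set f : Coord n → ℝ := fun y => φ (pt c y) with hf
  set F' : Fin n → Coord n → ℝ := fun j y => g.inner (pt c y) (F (pt c y)) (frame c j (pt c y))
    with hF'
  obtain ⟨hfK, hFK⟩ := h.integrableOn_chart hK hKd
  set k : Fin n → Coord n → ℝ := fun j y =>
    (partialH j ρ y * X j y + ρ y * partialH j (X j) y) * f y + ρ y * X j y * F' j y with hk
  have hw : ∀ j, HasWeakPartial (interior (dom c)) j (fun y => ρ y * X j y * f y) (k j) := by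
    intro j
    refine ((h.2.2 c j).smooth_mul isOpen_interior
      ((hρ.mul (hX j)).mono interior_subset)).congr_ae EventuallyEq.rfl ?_
    filter_upwards [ae_restrict_mem isOpen_interior.measurableSet] with y hy
    have h1 := (hasDerivAt_line (hρ.mul (hX j)) hy j).unique
      ((hasDerivAt_line hρ hy j).fun_mul (hasDerivAt_line (hX j) hy j))
    rw [← partialH_eq_fderiv (interior_mono (dom_subset_HS c) hy)]
    have h2 : partialH j (ρ * X j) y = partialH j ρ y * X j y + ρ y * partialH j (X j) y := by
      refine Eq.trans h1 ?_
      simp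
    simp only [hk]
    rw [← h2]
    rfl
  have hk0 : ∀ j, ∀ y ∈ (dom c : Set (Coord n)), y ∉ K → k j y = 0 := fun j y hy hyK => by
    simp [hk, hρ0 y hy hyK, hρ1 y hy hyK]
  have hki : ∀ j, IntegrableOn (k j) (dom c) := by
    intro j
    refine IntegrableOn.of_forall_sdiff_eq_zero (s := K) ?_ (measurableSet_dom c)
      fun y hy => hk0 j y hy.1 hy.2
    refine Integrable.add ?_ ?_
    · exact IntegrableOn.continuousOn_mul (((((contDiffOn_partialH hρ j).mul (hX j)).add
        (hρ.mul (contDiffOn_partialH (hX j) j))).continuousOn).mono hKd) hfK hK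
    · exact IntegrableOn.continuousOn_mul ((hρ.mul (hX j)).continuousOn.mono hKd) (hFK j) hK
  -- For `j ≠ 0` the derivative is tangential. For `j = 0`, tangency of `v` makes `X 0` vanish on
  -- the boundary, hence `|X 0| ≤ C y 0` on `K`, which supplies the majorant `C |ρ f|`.
  have hint : ∀ j, ∫ y in dom c, k j y = 0 := by
    intro j
    obtain ⟨C, hC, hCb⟩ := exists_abs_le_mul (hX 0) (fun y hy hy0 => by
      have h1 := (inner_normal_eq_zero_iff g (pt_mem_src hy) ((pt_mem_boundary_iff hy).2 hy0) _).1
        (hb _ ((pt_mem_boundary_iff hy).2 hy0))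
      simp only [hXdef]
      rw [vcomp, h1, mul_zero]) hK hKd
    have hw' := hw j
    rw [← restrict_interior_dom]
    rw [interior_dom] at hw' ⊢
    have hsub : domO c ∩ interior (HS n) ⊆ (dom c : Set (Coord n)) := by
      rw [← interior_dom]; exact interior_subset
    refine HasWeakPartial.integral_eq_zero (isOpen_domO c) hK
      (hKd.trans (by rw [dom_eq]; exact inter_subset_left)) hw'
      (fun y hy hyK => by rw [hρ0 y (hsub hy) hyK]; simp) (fun y hy hyK => hk0 j y (hsub hy) hyK)
      ((hki j).mono_set hsub)
      (a := K.indicator fun y => C * |ρ y * f y|) ?_ ?_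
    · refine Integrable.integrableOn ?_
      rw [integrable_indicator_iff hK.measurableSet]
      exact ((hfK.continuousOn_mul (hρ.continuousOn.mono hKd) hK).abs).const_mul C
    · intro y hy
      have hy0 : 0 ≤ y 0 := mem_HS.1 (interior_subset hy.2)
      by_cases hyK : y ∈ K
      · rw [indicator_of_mem hyK, stdVec_apply]
        by_cases hj : 0 = j
        · subst hj
          rw [if_pos rfl, mul_one, show ρ y * X 0 y * f y = X 0 y * (ρ y * f y) by ring, abs_mul]
          calc |X 0 y| * |ρ y * f y| ≤ C * y 0 * |ρ y * f y| := by
                gcongr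
                exact hCb y hyK
            _ = _ := by ring
        · rw [if_neg hj, mul_zero, abs_zero]
          positivity
      · rw [indicator_of_notMem hyK, hρ0 y (hsub hy) hyK]
        simp
  have hsum : ∫ y in dom c, ∑ j, k j y = 0 := by
    rw [integral_finsetSum _ fun j _ => hki j]
    exact Finset.sum_eq_zero fun j _ => hint j
  rw [← hsum, ← restrict_interior_dom]
  refine setIntegral_congr_fun isOpen_interior.measurableSet fun y hy => ?_
  have hyd := interior_subset hy
  have hdiv : ∑ j, partialH j (X j) y = 0 := sum_partialH_eq_zero g hv h0 hy
  have h1 : dirDeriv χ (pt c y) (v (pt c y)) = ∑ j, partialH j ρ y * vcomp c v j y := by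
    rw [dirDeriv_eq hχ (pt_mem_src hyd), crd_pt hyd]; rfl
  have h2 : g.inner (pt c y) (v (pt c y)) (F (pt c y)) = ∑ j, vcomp c v j y * F' j y :=
    inner_eq_sum g (pt_mem_src hyd) _ _
  simp only [hk, add_mul, Finset.sum_add_distrib]
  rw [h1, h2]
  have h3 : ∑ j, ρ y * partialH j (X j) y * f y = 0 := by
    rw [← Finset.sum_mul, ← Finset.mul_sum, hdiv, mul_zero, zero_mul]
  rw [h3, add_zero, mul_add, Finset.mul_sum, Finset.mul_sum, Finset.mul_sum, Finset.mul_sum]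
  congr 1
  · exact Finset.sum_congr rfl fun j _ => by simp only [hXdef, hf]; ring
  · exact Finset.sum_congr rfl fun j _ => by simp only [hXdef, hρdef]; ring

/-- A tangential Killing field is orthogonal to all gradients. -/
lemma pairing_eq_zero [CompactSpace M] [T2Space M] {g : Metric n M} {v : VField n M}
    (hv : IsSmooth v) (h0 : ∀ x, deformation g v x = 0)
    (hb : ∀ x ∈ (𝓡∂ n).boundary M, g.inner x (v x) (normal g x) = 0) {φ : M → ℝ} {F : VField n M}
    (h : HasGradient g φ F) : pairing g v F = 0 := by
  obtain ⟨t, ht⟩ := exists_finset_src (n := n) (M := M)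
  obtain ⟨f, hf⟩ := SmoothPartitionOfUnity.exists_isSubordinate (𝓡∂ n) isClosed_univ
    (fun c : t => src n (c : M)) (fun c => isOpen_src _) (by
      rw [← ht]
      exact iUnion₂_subset fun c hc => subset_iUnion (fun c : t => src n (c : M)) ⟨c, hc⟩)
  have hsm : ∀ c : t, ContMDiff (𝓡∂ n) 𝓘(ℝ, ℝ) ∞ (f c) := fun c => (f c).contMDiff
  have h1 : ∀ x, ∑ c, f c x = 1 := fun x => by
    rw [← finsum_eq_sum_of_fintype]; exact f.sum_eq_one (mem_univ x)
  -- The directional derivative of `φ f_c` along `v`, for the partition of unity `f`. The terms in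
  -- which `f_c` is differentiated cancel in the sum because the `f_c` add up to `1`.
  set q : t → M → ℝ := fun c x => φ x * dirDeriv (f c) x (v x) + f c x * g.inner x (v x) (F x)
    with hq
  have hbd : ∀ {a p : M → ℝ}, Continuous a → Integrable p (vol g) →
      Integrable (fun x => a x * p x) (vol g) := by
    intro a p ha hp
    obtain ⟨B, hB⟩ := isCompact_univ.exists_bound_of_continuousOn ha.continuousOn
    exact hp.bdd_mul ha.measurable.aestronglyMeasurable
      (Eventually.of_forall fun x => hB x (mem_univ x))
  have hqi : ∀ c, Integrable (q c) (vol g) := by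
    intro c
    refine Integrable.add ?_ (hbd (hsm c).continuous (h.integrable_inner hv))
    simp_rw [mul_comm (φ _)]
    exact hbd (continuous_of_continuousOn_pt (continuousOn_dirDeriv (hsm c) hv)) h.integrable
  have hq0 : ∀ c, ∫ x, q c x ∂(vol g) = 0 := by
    intro c
    rw [integral_vol_eq g (c := (c : M)) (fun x hx => ?_) (hqi c).aestronglyMeasurable]
    · exact integral_chart_eq_zero hv h0 hb h (hsm c) (hf c)
    · have hx' : x ∉ tsupport (f c) := fun h' => hx (hf c h')
      simp only [hq]
      rw [dirDeriv_eq_zero hx', image_eq_zero_of_notMem_tsupport hx']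
      simp
  have hsum : ∀ x, g.inner x (v x) (F x) = ∑ c, q c x := by
    intro x
    simp only [hq, Finset.sum_add_distrib]
    rw [← Finset.mul_sum, sum_dirDeriv_eq_zero hsm h1, ← Finset.sum_mul, h1]
    ring
  rw [pairing]
  simp_rw [hsum]
  rw [integral_finsetSum _ fun c _ => hqi c]
  exact Finset.sum_eq_zero fun c _ => hq0 c

lemma hasGradient_zero (g : Metric n M) : HasGradient g (fun _ => 0) (fun _ => 0) := by
  refine ⟨MemLp.zero, ⟨fun c i => ?_, by simp [normSqV]⟩, fun c j => ?_⟩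
  · have : vcomp c (fun _ => 0 : VField n M) i = fun _ => 0 := by funext y; simp [vcomp]
    rw [this]
    exact aestronglyMeasurable_const
  · simpa using HasWeakPartial.zero

/-- The field is its own Helmholtz projection, with potential `ψ = 0`, because it is orthogonal to
all gradients. -/
lemma memL2sigma_of_killing [CompactSpace M] [T2Space M] {g : Metric n M} {u v : VField n M}
    (hv : IsSmooth v) (h0 : ∀ x, deformation g v x = 0)
    (hb : ∀ x ∈ (𝓡∂ n).boundary M, g.inner x (v x) (normal g x) = 0)
    (huv : ∀ᵐ x ∂(vol g), u x = v x) : MemL2sigma g u := by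
  refine ⟨u, (hv.memL2 g).congr_ae huv, fun _ => 0, fun _ => 0, hasGradient_zero g,
    fun φ F h => ?_, by simp⟩
  have h1 : pairing g u F = pairing g v F := by
    refine integral_congr_ae ?_
    filter_upwards [huv] with x hx
    rw [hx]
  rw [h1, pairing_eq_zero hv h0 hb h]
  simp [pairing]

lemma isSmooth_zero : IsSmooth (fun _ => 0 : VField n M) :=
  isSmooth_of_contDiffOn_vrep fun c => by
    have : vrep c (fun _ => 0 : VField n M) = fun _ => 0 := by funext y; simp [vrep]
    rw [this]
    exact contDiffOn_const

lemma deformation_zero (g : Metric n M) (x : M) : deformation g (fun _ => 0 : VField n M) x = 0 := by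
  have h1 : covDeriv g (fun _ => 0 : VField n M) x = 0 := by
    have := covDeriv_sub g (isSmooth_zero (n := n) (M := M)) isSmooth_zero x
    simpa using this
  rw [deformation, h1, symPart_eq_zero_iff]
  simp

lemma mem_equil_of_killing [CompactSpace M] [T2Space M] {g : Metric n M} {u v : VField n M}
    (hv : IsSmooth v) (h0 : ∀ x, deformation g v x = 0)
    (hb : ∀ x ∈ (𝓡∂ n).boundary M, g.inner x (v x) (normal g x) = 0)
    (huv : ∀ᵐ x ∂(vol g), u x = v x) {α : ℝ}
    (hα : 0 < α → ∀ x ∈ (𝓡∂ n).boundary M, v x = 0) : u ∈ Equil g α := by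
  refine ⟨⟨hv.memH1 huv, memL2sigma_of_killing hv h0 hb huv⟩, weakDeformationZero_of_killing hv h0 huv,
    fun hpos => ⟨v, hv.hasTrace huv, ?_⟩, fun _ => ⟨v, hv.hasTrace huv, ?_⟩⟩
  · filter_upwards [ae_surf_mem_boundary g] with x hx using hα hpos x hx
  · filter_upwards [ae_surf_mem_boundary g] with x hx using hb x hx

end Manifold

end KillingNavier

end


/-! ### Assembly of the four assertions -/

theorem mainTheorem6 {n : ℕ} [NeZero n] {M : Type*} [TopologicalSpace M] [T2Space M]
    [CompactSpace M] [ConnectedSpace M] [ChartedSpace (EuclideanHalfSpace n) M]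
    [IsManifold (𝓡∂ n) ∞ M] [MeasurableSpace M] [BorelSpace M]
    (hbd : ((𝓡∂ n).boundary M).Nonempty) (g : KillingNavier.Metric n M) :
    (∀ α : ℝ, 0 < α →
      KillingNavier.Equil g α = {u | ∀ᵐ x ∂(KillingNavier.vol g), u x = 0}) ∧
    KillingNavier.Equil g 0 =
      {u | ∃ v : KillingNavier.VField n M, KillingNavier.IsSmooth v ∧
        (∀ x, KillingNavier.deformation g v x = 0) ∧
        (∀ x ∈ (𝓡∂ n).boundary M, g.inner x (v x) (KillingNavier.normal g x) = 0) ∧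
        ∀ᵐ x ∂(KillingNavier.vol g), u x = v x} ∧
    (∀ u : KillingNavier.VField n M, KillingNavier.MemH1 g u →
      KillingNavier.WeakDeformationZero g u →
      ∃ v : KillingNavier.VField n M, KillingNavier.IsSmooth v ∧
        (∀ x, KillingNavier.deformation g v x = 0) ∧
        ∀ᵐ x ∂(KillingNavier.vol g), u x = v x) ∧
    (∀ v : KillingNavier.VField n M, KillingNavier.IsSmooth v →
      (∀ x, KillingNavier.deformation g v x = 0) →
      (∀ x ∈ (𝓡∂ n).boundary M, v x = 0) → ∀ x, v x = 0) := by
  refine ⟨fun α hα => ?_, ?_, fun u _ hu => KillingNavier.exists_smooth_of_weakDeformationZero hu,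
    fun v hv h0 hb => KillingNavier.eq_zero_of_killing_of_boundary hbd g hv h0 hb⟩
  · refine Set.Subset.antisymm ?_ fun u hu => ?_
    -- The smooth representative vanishes on the boundary by comparison with the trace, and then
    -- everywhere by unique continuation.
    · rintro u ⟨-, hD, hT, -⟩
      obtain ⟨v, hv, h0, huv⟩ := KillingNavier.exists_smooth_of_weakDeformationZero hD
      obtain ⟨w, hw, hw0⟩ := hT hα
      have hz := KillingNavier.eq_zero_of_killing_of_boundary hbd g hv h0 fun x hx =>
        hw.eq_zero_of_boundary hv huv hw0 hx
      refine huv.mono fun x hx => ?_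
      rw [hx, hz]
    -- A null field has the smooth representative zero, which meets every condition.
    · exact KillingNavier.mem_equil_of_killing KillingNavier.isSmooth_zero
        (KillingNavier.deformation_zero g) (by simp) hu fun _ _ _ => rfl
  · refine Set.Subset.antisymm ?_ ?_
    · rintro u ⟨-, hD, -, hT⟩
      obtain ⟨v, hv, h0, huv⟩ := KillingNavier.exists_smooth_of_weakDeformationZero hD
      obtain ⟨w, hw, hw0⟩ := hT rfl
      exact ⟨v, hv, h0, fun x hx => hw.inner_normal_eq_zero hv huv hw0 hx, huv⟩
    · rintro u ⟨v, hv, h0, hb, huv⟩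
      exact KillingNavier.mem_equil_of_killing hv h0 hb huv fun h => absurd h (lt_irrefl 0)
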